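/- **Setting.** Let $(\Omega,\mathcal F,\mathbb P)$ be a probability space with a filtration $(\mathcal F_t)_{t\ge 0}$ satisfying the usual conditions, and $W$ an $r$-dimensional Brownian motion with respect to it. A switched stochastic system $S=(\mathbb R^n,M,\mathcal M,F,G)$ has a finite set of modes $M=\{1,\dots,l\}$, a set $\mathcal M$ of piecewise constant càdlàg switching signals $\mu:[0,\infty)\to M$ with finitely many discontinuities on bounded intervals, and, for every $m\in M$, locally Lipschitz functions $f_m:\mathbb R^n\to\mathbb R^n$ and $g_m:\mathbb R^n\to\mathbb R^{n\times r}$ of linear growth. A solution process from $x_0$ is a continuous adapted process $\xi$ with $\xi(0)=x_0$ a.s. and $d\xi=f_\mu(\xi)\,dt+g_\mu(\xi)\,dW_t$ (Itô), in one of two settings. * (a) $\mu$ is some signal in $\mathcal M$. * (b) $\mu$ is an adapted random signal with paths a.s. in $\mathcal M$ and transition rates $\lambda_{mm'}$. Here the $\lambda_{mm'}:\mathbb R^n\to\mathbb R$ are bounded and Lipschitz, $\lambda_{mm'}\ge 0$ for $m\ne m'$, and $\sum_{m'}\lambda_{mm'}=0$. For every $m'$, as $h\downarrow 0$, $\mathbb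 P(\mu(t+h)=m'\mid\mathcal F_t)=\mathbf 1_{\mu(t)=m'}+\lambda_{\mu(t)m'}(\xi(t))\,h+o(h)$, with remainder in $L^1$, uniformly for $t$ in bounded sets. Let $\Pi$ be a finite set of atomic propositions, $L:\mathbb R^n\to\Pi$ a measurable labeling and $T>0$. A word $(\sigma_0,\dots,\sigma_{k-1})\in\Pi^k$, $k\ge1$, is a finite trace of a path $x$ over $[0,T)$ if there are times $0=t_0<t_1<\dots<t_k=T$ with $L(x(t_j))=\sigma_j$ for $j<k$ such that, whenever $j+1<k$ and $\sigma_j\neq\sigma_{j+1}$, there is $t'\in[t_j,t_{j+1}]$ with $L(x)=\sigma_j$ on $(t_j,t')$, $L(x)=\sigma_{j+1}$ on $(t',t_{j+1})$ and $L(x(t'))\in\{\sigma_j,\sigma_{j+1}\}$. Let $\varphi$ be an LTL formula over finite traces (whose letters are the elements of $\Pi$) that is equivalent, on nonempty finite words, to a formula in positive normal form with $\square$ as its only temporal operator. Write $\mathbb P_{x_0}\{\sigma_\xi\models\varphi\}$ for the probability that all finite traces of $\xi$ over $[0,T)$ satisfy $\varphi$, and $\mathbb P_{x_0}\{\sigma_\xi\models\neg\varphi\}$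 for the probability that some finite trace satisfies $\neg\varphi$, i.e. that $\varphi$ is violated. Let $\mathcal A=(Q,Q_0,\Pi,\delta,F)$ be a deterministic finite automaton that accepts exactly the nonempty finite words satisfying $\neg\varphi$, and put $\sigma(q,q')=\{a\in\Pi:\delta(q,a)=q'\}$. For $p\in\Pi$ let $\mathcal R^p$ be the set of sequences $\mathbf q=(q_0,\dots,q_k)$, $k\ge1$, with $q_0\in Q_0$, $q_k\in F$, $q_j\ne q_{j+1}$ and $\sigma(q_j,q_{j+1})\neq\emptyset$ for all $j<k$, and $p\in\sigma(q_0,q_1)$. Let $\mathcal P(\mathbf q)=\{(q_j,q_{j+1},q_{j+2}):0\le j\le k-2\}$. A common barrier certificate for $(X_0,X_1)$ with constants $\gamma\in[0,1]$, $c\ge0$ is a twice continuously differentiable $B:\mathbb R^n\to[0,\infty)$ with $B\le\gamma$ on $X_0$, $B\ge1$ on $X_1$, and $\mathcal D_mB:=\frac{\partial B}{\partial x}f_m+\frac12\mathrm{Tr}\big(g_m^T\frac{\partial^2B}{\partial x^2}g_m\big)\le c$ on $\mathbb R^n$ for all $m\in M$. Multiple barrier certificates are twice continuously differentiable functions $B_m:\mathbb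 R^n\to[0,\infty)$, $m\in M$, with $B_m\le\gamma$ on $X_0$, $B_m\ge1$ on $X_1$, and $\mathcal D_mB_m+\sum_{m'\in M}\lambda_{mm'}B_{m'}\le c$ on $\mathbb R^n$ for all $m\in M$. **Claim.** Let $p\in\Pi$, $x_0\in L^{-1}(p)$, and let $\xi$ be a solution process of $S$ from $x_0$, in setting (a) or (b). Then $$\mathbb P_{x_0}\{\sigma_\xi\models\varphi\}\ \ge\ 1-\mathbb P_{x_0}\{\sigma_\xi\models\neg\varphi\}.$$ Moreover, suppose that $\delta(q_0,p)\neq q_0$ for all $q_0\in Q_0$, and that for every $\nu=(q,q',q'')$ in $\bigcup_{\mathbf q\in\mathcal R^p}\mathcal P(\mathbf q)$ a common barrier certificate (in setting (a)), respectively multiple barrier certificates (in setting (b)), for $X_0=L^{-1}(\sigma(q,q'))$ and $X_1=L^{-1}(\sigma(q',q''))$ with constants $\gamma_\nu,c_\nu$ are given. Then $$\mathbb P_{x_0}\{\sigma_\xi\models\neg\varphi\}\le\sum_{\mathbf q\in\mathcal R^p}\ \prod_{\nu\in\mathcal P(\mathbf q)}(\gamma_\nu+c_\nu T)$$ (the sum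 may be $+\infty$), and hence $$\mathbb P_{x_0}\{\sigma_\xi\models\varphi\}\ \ge\ 1-\sum_{\mathbf q\in\mathcal R^p}\ \prod_{\nu\in\mathcal P(\mathbf q)}(\gamma_\nu+c_\nu T).$$ -/

import Mathlib

open MeasureTheory ProbabilityTheory Filter Topology
open scoped NNReal ENNReal

noncomputable section

/-! ## Linear temporal logic over finite traces -/

/-- Formulas of `LTL_F` over a set `AP` of atomic propositions. -/
inductive LTLf (AP : Type*) where
  | tt : LTLf AP
  | atom : AP → LTLf AP
  | neg : LTLf AP → LTLf AP
  | and : LTLf AP → LTLf AP → LTLf AP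
  | or : LTLf AP → LTLf AP → LTLf AP
  | next : LTLf AP → LTLf AP
  | ev : LTLf AP → LTLf AP
  | alw : LTLf AP → LTLf AP
  | until : LTLf AP → LTLf AP → LTLf AP

/-- Satisfaction of a formula by a finite word, evaluated at its first letter. The atomic
propositions themselves are the letters. -/
def LTLf.Sat {AP : Type*} : List AP → LTLf AP → Prop
  | _, .tt => True
  | w, .atom p => w.head? = some p
  | w, .neg φ => ¬ LTLf.Sat w φ
  | w, .and φ ψ => LTLf.Sat w φ ∧ LTLf.Sat w ψ
  | w, .or φ ψ => LTLf.Sat w φ ∨ LTLf.Sat w ψ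
  | w, .next φ => 1 < w.length ∧ LTLf.Sat (w.drop 1) φ
  | w, .ev φ => ∃ k < w.length, LTLf.Sat (w.drop k) φ
  | w, .alw φ => ∀ k < w.length, LTLf.Sat (w.drop k) φ
  | w, .until φ ψ =>
      ∃ k < w.length, LTLf.Sat (w.drop k) ψ ∧ ∀ j < k, LTLf.Sat (w.drop j) φ

/-- Positive normal form whose only temporal operator is `□`. -/
inductive LTLf.IsSafePNF {AP : Type*} : LTLf AP → Prop
  | tt : IsSafePNF .tt
  | atom (p : AP) : IsSafePNF (.atom p)
  | negAtom (p : AP) : IsSafePNF (.neg (.atom p))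
  | and {φ ψ : LTLf AP} : IsSafePNF φ → IsSafePNF ψ → IsSafePNF (.and φ ψ)
  | or {φ ψ : LTLf AP} : IsSafePNF φ → IsSafePNF ψ → IsSafePNF (.or φ ψ)
  | alw {φ : LTLf AP} : IsSafePNF φ → IsSafePNF (.alw φ)

/-- A safe formula: one that can be represented (up to equivalence on nonempty finite words) in
positive normal form with `□` as the only temporal operator. -/
def LTLf.IsSafe {AP : Type*} (φ : LTLf AP) : Prop :=
  ∃ ψ : LTLf AP, ψ.IsSafePNF ∧ ∀ w : List AP, w ≠ [] → (φ.Sat w ↔ ψ.Sat w)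

/-! ## Deterministic finite automata and their accepting state runs -/

/-- A deterministic finite automaton with a set of initial states. -/
structure DetAut (AP Q : Type*) where
  init : Set Q
  step : Q → AP → Q
  final : Set Q

namespace DetAut

variable {AP Q : Type*}

/-- The word `w` is accepted: it has a state run from an initial to an accepting state. -/
def Accepts (A : DetAut AP Q) (w : List AP) : Prop :=
  ∃ q : ℕ → Q, q 0 ∈ A.init ∧ (∀ (k : ℕ) (hk : k < w.length), A.step (q k) w[k] = q (k + 1)) ∧
    q w.length ∈ A.final

/-- The automaton accepts exactly the (nonempty) finite words that satisfy `φ`. -/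
def Recognizes (A : DetAut AP Q) (φ : LTLf AP) : Prop :=
  ∀ w : List AP, w ≠ [] → (A.Accepts w ↔ φ.Sat w)

/-- The set `σ(q, q')` of letters that lead from `q` to `q'`. -/
def letters (A : DetAut AP Q) (q q' : Q) : Set AP := {a | A.step q a = q'}

/-- The set `𝓡` of accepting state runs `(q₀, …, qₙ)`, `n ≥ 1`, without self-loops. -/
def runs (A : DetAut AP Q) : Set (List Q) :=
  {q | 2 ≤ q.length ∧ (∃ a ∈ A.init, q.head? = some a) ∧ (∃ b ∈ A.final, q.getLast? = some b) ∧
    q.IsChain (fun a b => (A.letters a b).Nonempty ∧ a ≠ b)}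

/-- The set `𝓡ᵖ` of the runs in `𝓡` whose first transition can be taken with the letter `p`. -/
def runsFrom (A : DetAut AP Q) (p : AP) : Set (List Q) :=
  {q ∈ A.runs | ∃ a b rest, q = a :: b :: rest ∧ p ∈ A.letters a b}

end DetAut

/-- The set `𝓟(q)` of the state runs `(q_k, q_{k+1}, q_{k+2})` of length three contained in `q`. -/
def triples {Q : Type*} [DecidableEq Q] (q : List Q) : Finset (Q × Q × Q) :=
  (q.zip (q.tail.zip q.tail.tail)).toFinset

/-- The sum over `q ∈ 𝓡ᵖ` of the products of `γ_ν + c_ν T` over `ν ∈ 𝓟(q)`; the value is `∞` if the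
sum diverges. -/
def sumProdBound {AP Q : Type*} [DecidableEq Q] (A : DetAut AP Q) (p : AP) (T : ℝ≥0)
    (γ c : Q × Q × Q → ℝ) : ℝ≥0∞ :=
  ∑' q : A.runsFrom p, ∏ ν ∈ triples (q : List Q), ENNReal.ofReal (γ ν + c ν * T)

/-! ## Switched stochastic systems -/

/-- Piecewise constant càdlàg functions of time with finitely many discontinuities on bounded
intervals. -/
def IsSwitchingSignal {l : ℕ} (μ : ℝ≥0 → Fin l) : Prop :=
  (∀ t, ContinuousWithinAt μ (Set.Ici t) t) ∧ (∀ t, ∃ m, Tendsto μ (𝓝[<] t) (𝓝 m)) ∧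
    ∀ t, {s | s ≤ t ∧ ¬ ContinuousAt μ s}.Finite

/-- A switched stochastic system with state space `ℝⁿ`, modes `Fin l` and `r`-dimensional noise. -/
structure SwitchedSystem (n r l : ℕ) where
  /-- the admissible switching signals -/
  signals : Set (ℝ≥0 → Fin l)
  isSwitchingSignal : ∀ μ ∈ signals, IsSwitchingSignal μ
  /-- the drift of every mode -/
  f : Fin l → EuclideanSpace ℝ (Fin n) → EuclideanSpace ℝ (Fin n)
  /-- the diffusion matrix of every mode -/
  g : Fin l → EuclideanSpace ℝ (Fin n) → Matrix (Fin n) (Fin r) ℝ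
  lipschitz_f : ∀ m, LocallyLipschitz (f m)
  lipschitz_g : ∀ m i j, LocallyLipschitz (fun x => g m x i j)
  growth_f : ∀ m, ∃ K : ℝ, ∀ x, ‖f m x‖ ≤ K * (1 + ‖x‖)
  growth_g : ∀ m, ∃ K : ℝ, ∀ x i j, |g m x i j| ≤ K * (1 + ‖x‖)

/-- The filtration is right-continuous and complete. -/
structure UsualConditions {Ω : Type*} [mΩ : MeasurableSpace Ω] (P : Measure Ω)
    (𝔽 : Filtration ℝ≥0 mΩ) : Prop where
  rightContinuous : 𝔽.IsRightContinuous
  complete : ∀ N : Set Ω, P N = 0 → MeasurableSet[𝔽 0] N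

/-- `W` is a standard `r`-dimensional Brownian motion with respect to the filtration `𝔽`. -/
structure IsBrownianMotion {Ω : Type*} [mΩ : MeasurableSpace Ω] (P : Measure Ω)
    (𝔽 : Filtration ℝ≥0 mΩ) {r : ℕ} (W : ℝ≥0 → Ω → EuclideanSpace ℝ (Fin r)) : Prop where
  adapted : StronglyAdapted 𝔽 W
  zero : ∀ᵐ ω ∂P, W 0 ω = 0
  continuous : ∀ᵐ ω ∂P, Continuous (fun t => W t ω)
  indep : ∀ s t, s ≤ t →
    Indep (MeasurableSpace.comap (fun ω => W t ω - W s ω) inferInstance) (𝔽 s) P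
  gaussian : ∀ s t, s ≤ t → P.map (fun ω (i : Fin r) => W t ω i - W s ω i) =
    Measure.pi (fun _ => gaussianReal 0 (t - s))

/-- `I` is the Itô integral process `∫₀ᵗ H dW` of a matrix-valued adapted process `H` with right
continuous paths that have left limits: for every `t`, `I t` is the limit in probability of the
left-endpoint Riemann sums over the partitions of `[0, t]` into `N` equal parts, as `N → ∞`. -/
def IsItoIntegral {Ω : Type*} [MeasurableSpace Ω] (P : Measure Ω) {n r : ℕ}
    (W : ℝ≥0 → Ω → EuclideanSpace ℝ (Fin r)) (H : ℝ≥0 → Ω → Matrix (Fin n) (Fin r) ℝ)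
    (I : ℝ≥0 → Ω → EuclideanSpace ℝ (Fin n)) : Prop :=
  ∀ t : ℝ≥0, TendstoInMeasure P
    (fun (N : ℕ) (ω : Ω) => ∑ k ∈ Finset.range N,
      WithLp.toLp 2 ((H ((k : ℝ≥0) * t / N) ω).mulVec
        (fun j => W (((k : ℝ≥0) + 1) * t / N) ω j - W ((k : ℝ≥0) * t / N) ω j)))
    atTop (I t)

namespace SwitchedSystem

variable {n r l : ℕ}

/-- `ξ` is a continuous adapted process with `ξ(0) = x₀` a.s. that solves
`dξ = f_μ(ξ) dt + g_μ(ξ) dW` for the (possibly random) mode process `μ`: the process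
`ξ(t) - ξ(0) - ∫₀ᵗ f_μ(ξ) ds` is the Itô integral of `g_μ(ξ)`. -/
structure Solves (S : SwitchedSystem n r l) {Ω : Type*} [mΩ : MeasurableSpace Ω] (P : Measure Ω)
    (𝔽 : Filtration ℝ≥0 mΩ) (W : ℝ≥0 → Ω → EuclideanSpace ℝ (Fin r)) (μ : ℝ≥0 → Ω → Fin l)
    (x₀ : EuclideanSpace ℝ (Fin n)) (ξ : ℝ≥0 → Ω → EuclideanSpace ℝ (Fin n)) : Prop where
  adapted : StronglyAdapted 𝔽 ξ
  initial : ∀ᵐ ω ∂P, ξ 0 ω = x₀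
  continuous : ∀ᵐ ω ∂P, Continuous (fun t => ξ t ω)
  equation : IsItoIntegral P W (fun t ω => S.g (μ t ω) (ξ t ω))
    (fun t ω => ξ t ω - ξ 0 ω -
      ∫ s in (0 : ℝ)..t, S.f (μ s.toNNReal ω) (ξ s.toNNReal ω))

/-- `ξ` is a solution process of `S` starting from `x₀`, under some admissible switching signal. -/
def IsSolution (S : SwitchedSystem n r l) {Ω : Type*} [mΩ : MeasurableSpace Ω] (P : Measure Ω)
    (𝔽 : Filtration ℝ≥0 mΩ) (W : ℝ≥0 → Ω → EuclideanSpace ℝ (Fin r))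
    (x₀ : EuclideanSpace ℝ (Fin n)) (ξ : ℝ≥0 → Ω → EuclideanSpace ℝ (Fin n)) : Prop :=
  ∃ μ ∈ S.signals, S.Solves P 𝔽 W (fun t _ => μ t) x₀ ξ

end SwitchedSystem

/-- The matrix `∂²B/∂x²` of second partial derivatives. -/
def hessianMatrix {n : ℕ} (B : EuclideanSpace ℝ (Fin n) → ℝ) (x : EuclideanSpace ℝ (Fin n)) :
    Matrix (Fin n) (Fin n) ℝ :=
  Matrix.of fun i j => fderiv ℝ (fderiv ℝ B) x (EuclideanSpace.single i 1)
    (EuclideanSpace.single j 1)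

/-- Transition rates between modes: bounded and Lipschitz, nonnegative off the diagonal, with
vanishing row sums. -/
structure IsTransitionRate {n l : ℕ} (Λ : Fin l → Fin l → EuclideanSpace ℝ (Fin n) → ℝ) :
    Prop where
  bounded : ∀ m m', ∃ C : ℝ, ∀ x, |Λ m m' x| ≤ C
  lipschitz : ∀ m m', ∃ K : ℝ≥0, LipschitzWith K (Λ m m')
  nonneg : ∀ m m', m ≠ m' → ∀ x, 0 ≤ Λ m m' x
  sum_eq_zero : ∀ m x, ∑ m', Λ m m' x = 0

namespace SwitchedSystem

variable {n r l : ℕ}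

/-- `ξ` is a solution process of `S` starting from `x₀` under the random switching signal `μ` whose
transition probabilities have the rates `Λ`: given the past up to time `t`, the probability that
`μ(t + h) = m'` is `Λ_{m m'}(ξ(t)) h + o(h)` if the present mode `m = μ(t)` differs from `m'`, and
`1 + Λ_{m m}(ξ(t)) h + o(h)` if `m = m'`. The remainder is measured in mean, locally uniformly
in `t`. -/
structure IsRateSolution (S : SwitchedSystem n r l)
    (Λ : Fin l → Fin l → EuclideanSpace ℝ (Fin n) → ℝ) {Ω : Type*} [mΩ : MeasurableSpace Ω]
    (P : Measure Ω) (𝔽 : Filtration ℝ≥0 mΩ) (W : ℝ≥0 → Ω → EuclideanSpace ℝ (Fin r))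
    (μ : ℝ≥0 → Ω → Fin l) (x₀ : EuclideanSpace ℝ (Fin n))
    (ξ : ℝ≥0 → Ω → EuclideanSpace ℝ (Fin n)) : Prop where
  solves : S.Solves P 𝔽 W μ x₀ ξ
  mode_adapted : StronglyAdapted 𝔽 μ
  mode_signal : ∀ᵐ ω ∂P, (fun t => μ t ω) ∈ S.signals
  transition : ∀ (m' : Fin l) (t₁ : ℝ≥0) (ε : ℝ), 0 < ε → ∃ δ : ℝ≥0, 0 < δ ∧
    ∀ t h : ℝ≥0, t ≤ t₁ → 0 < h → h < δ →
      ∫ ω, |(P[fun ω' => if μ (t + h) ω' = m' then (1 : ℝ) else 0 | 𝔽 t]) ω -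
        ((if μ t ω = m' then (1 : ℝ) else 0) + Λ (μ t ω) m' (ξ t ω) * h)| ∂P ≤ ε * h

/-- `∂B/∂x f_m + ½ Tr(g_mᵀ ∂²B/∂x² g_m)`. -/
def generator (S : SwitchedSystem n r l) (B : EuclideanSpace ℝ (Fin n) → ℝ) (m : Fin l)
    (x : EuclideanSpace ℝ (Fin n)) : ℝ :=
  fderiv ℝ B x (S.f m x) +
    (1 / 2) * Matrix.trace ((S.g m x).transpose * hessianMatrix B x * S.g m x)

/-- `B` is a common barrier certificate for `(X₀, X₁)` with constants `γ` and `c`. -/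
structure IsCommonBarrier (S : SwitchedSystem n r l) (X₀ X₁ : Set (EuclideanSpace ℝ (Fin n)))
    (B : EuclideanSpace ℝ (Fin n) → ℝ) (γ c : ℝ) : Prop where
  contDiff : ContDiff ℝ 2 B
  nonneg : ∀ x, 0 ≤ B x
  gamma_mem : γ ∈ Set.Icc (0 : ℝ) 1
  c_nonneg : 0 ≤ c
  le_gamma : ∀ x ∈ X₀, B x ≤ γ
  one_le : ∀ x ∈ X₁, 1 ≤ B x
  generator_le : ∀ m x, S.generator B m x ≤ c

/-- `(B_m)` are multiple barrier certificates for `(X₀, X₁)` with constants `γ` and `c`, with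
respect to the transition rates `Λ`. -/
structure IsMultipleBarrier (S : SwitchedSystem n r l)
    (Λ : Fin l → Fin l → EuclideanSpace ℝ (Fin n) → ℝ) (X₀ X₁ : Set (EuclideanSpace ℝ (Fin n)))
    (B : Fin l → EuclideanSpace ℝ (Fin n) → ℝ) (γ c : ℝ) : Prop where
  contDiff : ∀ m, ContDiff ℝ 2 (B m)
  nonneg : ∀ m x, 0 ≤ B m x
  gamma_mem : γ ∈ Set.Icc (0 : ℝ) 1
  c_nonneg : 0 ≤ c
  le_gamma : ∀ m, ∀ x ∈ X₀, B m x ≤ γ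
  one_le : ∀ m, ∀ x ∈ X₁, 1 ≤ B m x
  generator_le : ∀ m x, S.generator (B m) m x + ∑ m', Λ m m' x * B m' x ≤ c

end SwitchedSystem

/-! ## Finite traces and satisfaction probabilities -/

/-- `σ = (σ₀, …, σ_{k-1})` is a finite trace over `[0, T)` of the path `x`, with times
`0 = t₀ < t₁ < … < t_k = T`. -/
def IsTrace {E AP : Type*} (L : E → AP) (T : ℝ≥0) (x : ℝ≥0 → E) (σ : List AP) : Prop :=
  σ ≠ [] ∧ ∃ t : ℕ → ℝ≥0, t 0 = 0 ∧ t σ.length = T ∧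
    (∀ (j : ℕ) (hj : j < σ.length), t j < t (j + 1) ∧ L (x (t j)) = σ[j]) ∧
    ∀ (j : ℕ) (hj : j + 1 < σ.length), σ[j] ≠ σ[j + 1] →
      ∃ s ∈ Set.Icc (t j) (t (j + 1)),
        (∀ u ∈ Set.Ioo (t j) s, L (x u) = σ[j]) ∧
        (∀ u ∈ Set.Ioo s (t (j + 1)), L (x u) = σ[j + 1]) ∧
        (L (x s) = σ[j] ∨ L (x s) = σ[j + 1])

/-- The probability that `ξ` satisfies `φ` over `[0, T)`: all finite traces of the path do. -/
def probSat {Ω E AP : Type*} [MeasurableSpace Ω] (P : Measure Ω) (L : E → AP) (T : ℝ≥0)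
    (ξ : ℝ≥0 → Ω → E) (φ : LTLf AP) : ℝ≥0∞ :=
  P {ω | ∀ σ, IsTrace L T (fun t => ξ t ω) σ → φ.Sat σ}

/-- The probability that `ξ` satisfies `¬φ` over `[0, T)`, that is, violates `φ`: some finite trace
of the path satisfies `¬φ`. -/
def probSatNeg {Ω E AP : Type*} [MeasurableSpace Ω] (P : Measure Ω) (L : E → AP) (T : ℝ≥0)
    (ξ : ℝ≥0 → Ω → E) (φ : LTLf AP) : ℝ≥0∞ :=
  P {ω | ∃ σ, IsTrace L T (fun t => ξ t ω) σ ∧ (LTLf.neg φ).Sat σ}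

end

noncomputable section

/-! ## Reduction of traces to chains of barrier certificates -/

/-! The proof applies Kushner's supermartingale inequality once for every triple of a run, with an
Euler scheme taking the place of Itô's formula.

Combinatorics. A trace that violates the formula is accepted by the automaton. Deleting the
self-loops of its state run leaves a run in `runsFrom`, whose transitions are taken at nondecreasing
times, the first one at time `0` (`exists_run_of_isTrace`). Every triple of that run forces the path
from a set where `B ≤ γ` into a set where `B ≥ 1`, and the end of one passage is the start of the
next (`Follows.visits`). Runs are lists over a finite set, so a union bound leaves a single chain of
certificates, which is passed through with probability at most the product of the `γ + c T`
(`measure_visits_le`). A triple that recurs is kept only at its last occurrence, which turns the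
product over a list into one over a set.

Why the factors multiply. In discrete time, a nonnegative process with drift at most `c` per unit of
time that starts below `γ` exceeds `1` up to time `T` with probability at most `γ + c T`, whatever
the past. Passing to the next certificate at the first time when the current one is high and the
next one is low loses nothing, so the conditional bounds multiply (`Stage.measureReal_win_le`).

Continuous time. The stochastic integral is known only as a limit in probability of left-endpoint
sums. The scheme `euler` therefore adds up `f δ + g ΔW` with coefficients read off the true process,
set to zero after its exit from a ball. Its increments are conditionally Gaussian with bounded
coefficients, so a second order Taylor expansion gives the one-step drift of a cut-off certificate
up to `o(δ)` (`exists_abs_integral_gaussianVec_sub_le`); random mode switches contribute the sum of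
the rates times the certificates (`exists_switchControl`). The scheme approximates the solution in
probability (`exists_grid`), so this drift is at most `c` up to an error of small total mean
(`exists_isSupermartingale`). Continuity of paths moves the passages to grid times, and finally
error, tolerance and radius are sent to their limits. -/

/-- A family of functions, one for every mode, with the two constants of a barrier certificate. -/
structure BarrierCert (n l : ℕ) where
  B : Fin l → EuclideanSpace ℝ (Fin n) → ℝ
  γ : ℝ
  c : ℝ

namespace BarrierCert

variable {n r l : ℕ}

/-- The constant certificate, which gives the trivial bound `1`. -/
def trivial (n l : ℕ) : BarrierCert n l := ⟨fun _ _ => 1, 1, 0⟩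

/-- The conditions on a certificate that do not refer to sets of states. -/
structure Valid (S : SwitchedSystem n r l)
    (Λ : Fin l → Fin l → EuclideanSpace ℝ (Fin n) → ℝ) (C : BarrierCert n l) : Prop where
  contDiff : ∀ m, ContDiff ℝ 2 (C.B m)
  nonneg : ∀ m x, 0 ≤ C.B m x
  γ_nonneg : 0 ≤ C.γ
  c_nonneg : 0 ≤ C.c
  generator_le : ∀ m x, S.generator (C.B m) m x + ∑ m', Λ m m' x * C.B m' x ≤ C.c

/-- Derivatives of constants vanish, and the vanishing row sums of the rates remove the coupling
term. -/
lemma trivial_valid (S : SwitchedSystem n r l)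
    (Λ : Fin l → Fin l → EuclideanSpace ℝ (Fin n) → ℝ) (hΛ : ∀ m x, ∑ m', Λ m m' x = 0) :
    (trivial n l).Valid S Λ where
  contDiff _ := contDiff_const
  nonneg _ _ := zero_le_one
  γ_nonneg := zero_le_one
  c_nonneg := le_rfl
  generator_le m x := by
    have h : hessianMatrix (n := n) (fun _ => (1 : ℝ)) x = 0 := by
      ext i j
      simp [hessianMatrix]
    simp [trivial, SwitchedSystem.generator, h, hΛ]

/-- The path `x` passes, from time `t` on and up to time `T`, through the sublevel sets and the
superlevel sets of the certificates in the list, in their order. -/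
def Visits (T : ℝ≥0) (x : ℝ≥0 → EuclideanSpace ℝ (Fin n)) :
    List (BarrierCert n l) → ℝ≥0 → Prop
  | [], _ => True
  | C :: Cs, t => (∀ m, C.B m (x t) ≤ C.γ) ∧
      ∃ t', t ≤ t' ∧ t' ≤ T ∧ (∀ m, 1 ≤ C.B m (x t')) ∧ Visits T x Cs t'

/-- The bound on the probability of passing through the sets of all certificates of a list. -/
def chainBound (T : ℝ) (Cs : List (BarrierCert n l)) : ℝ :=
  (Cs.map fun C => C.γ + C.c * T).prod

/-- The certificates along a list of labels; all but the last occurrence of a label are replaced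
by the trivial certificate. -/
def along {ι : Type*} [DecidableEq ι] (C : ι → BarrierCert n l) : List ι → List (BarrierCert n l)
  | [] => []
  | a :: as => (if a ∈ as then trivial n l else C a) :: along C as

/-- The trivial certificate has the factor `1 + 0 * T = 1`, so every label counts once. The plain
product along the list would be too weak, because a repeated factor `γ + c T` may exceed `1`. -/
lemma chainBound_along {ι : Type*} [DecidableEq ι] (C : ι → BarrierCert n l) (T : ℝ)
    (as : List ι) :
    chainBound T (along C as) = ∏ a ∈ as.toFinset, ((C a).γ + (C a).c * T) := by
  induction as with
  | nil => simp [chainBound, along]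
  | cons a as ih =>
    simp only [chainBound, along, List.map_cons, List.prod_cons, List.toFinset_cons] at ih ⊢
    rw [ih]
    by_cases h : a ∈ as
    · simp [h, trivial]
    · rw [Finset.prod_insert (by simpa using h)]
      simp [h]

lemma mem_along {ι : Type*} [DecidableEq ι] {C : ι → BarrierCert n l} {as : List ι}
    {D : BarrierCert n l} (h : D ∈ along C as) : D = trivial n l ∨ ∃ a ∈ as, D = C a := by
  induction as with
  | nil => simp [along] at h
  | cons a as ih =>
    simp only [along, List.mem_cons] at h
    rcases h with h | h
    · split_ifs at h
      · exact .inl h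
      · exact .inr ⟨a, by simp, h⟩
    · rcases ih h with h | ⟨b, hb, h⟩
      · exact .inl h
      · exact .inr ⟨b, by simp [hb], h⟩

end BarrierCert

/-! ### From accepted traces to runs without self-loops -/

namespace DetAut

variable {AP Q E : Type*}

/-- The path `x` takes the transitions of the state run in the given order, the first one at time
`t` and the others at later times, not after `T`. -/
def Follows (A : DetAut AP Q) (L : E → AP) (T : ℝ≥0) (x : ℝ≥0 → E) : List Q → ℝ≥0 → Prop
  | a :: b :: rest, t => L (x t) ∈ A.letters a b ∧
      ∃ t', t ≤ t' ∧ t' ≤ T ∧ Follows A L T x (b :: rest) t'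
  | _, _ => True

/-- Self-loops are deleted by induction from the end of the word. A deleted step only postpones the
next transition, so the order of the times survives. The first transition is not a self-loop, by the
hypothesis on the initial states, hence it is kept and happens at time `0` with the letter `p`. -/
lemma exists_run_of_isTrace (A : DetAut AP Q) (L : E → AP) (T : ℝ≥0) (x : ℝ≥0 → E) (p : AP)
    (hx : L (x 0) = p) (hp : ∀ q₀ ∈ A.init, A.step q₀ p ≠ q₀) (σ : List AP)
    (hσ : IsTrace L T x σ) (hacc : A.Accepts σ) :
    ∃ q ∈ A.runsFrom p, A.Follows L T x q 0 := by
  obtain ⟨hne, t, ht0, htT, ht, -⟩ := hσ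
  obtain ⟨q, hq0, hq, hqf⟩ := hacc
  have hlen : 0 < σ.length := List.length_pos_iff.mpr hne
  -- Here `d` letters remain to be read. The time `t'` of the next recorded transition is only
  -- bounded below by `t j`, since self-loops may precede it.
  have key : ∀ d j, j + d = σ.length → t j ≤ T ∧ ∃ rest : List Q,
      (∃ b ∈ A.final, (q j :: rest).getLast? = some b) ∧
      (q j :: rest).IsChain (fun a b => (A.letters a b).Nonempty ∧ a ≠ b) ∧
      ∃ t', t j ≤ t' ∧ t' ≤ T ∧ A.Follows L T x (q j :: rest) t' := by
    intro d
    induction d with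
    | zero =>
      intro j hj
      obtain rfl : j = σ.length := by omega
      exact ⟨htT.le, [], ⟨_, hqf, by simp⟩, by simp, T, htT.le, le_rfl, by simp [Follows]⟩
    | succ d ih =>
      intro j hj
      have hjl : j < σ.length := by omega
      obtain ⟨hT', rest, hlast, hchain, t', ht', ht'T, hfol⟩ := ih (j + 1) (by omega)
      have hlt := (ht j hjl).1
      have hjT : t j ≤ T := hlt.le.trans hT'
      refine ⟨hjT, ?_⟩
      by_cases heq : q j = q (j + 1)
      · rw [heq]
        exact ⟨rest, hlast, hchain, t', hlt.le.trans ht', ht'T, hfol⟩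
      · have hmem : L (x (t j)) ∈ A.letters (q j) (q (j + 1)) := by
          rw [(ht j hjl).2]; exact hq j hjl
        refine ⟨q (j + 1) :: rest, ?_, ?_, t j, le_rfl, hjT, hmem, t', hlt.le.trans ht', ht'T, hfol⟩
        · simpa [List.getLast?_cons_cons] using hlast
        · exact List.isChain_cons_cons.mpr ⟨⟨⟨_, hmem⟩, heq⟩, hchain⟩
  -- The induction is used from index `1` on; the first letter is handled separately to fix its time
  -- at `0`.
  obtain ⟨hT', rest, hlast, hchain, t', ht', ht'T, hfol⟩ := key (σ.length - 1) 1 (by omega)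
  have h0 := ht 0 hlen
  have hpσ : σ[0] = p := by rw [← h0.2, ht0, hx]
  have hstep : A.step (q 0) p = q 1 := by rw [← hpσ]; exact hq 0 hlen
  have hmem : p ∈ A.letters (q 0) (q 1) := hstep
  have hne01 : q 0 ≠ q 1 := fun h => hp _ hq0 (hstep.trans h.symm)
  refine ⟨q 0 :: q 1 :: rest, ⟨⟨by simp, ⟨_, hq0, rfl⟩, ?_, ?_⟩, _, _, _, rfl, hmem⟩, ?_⟩
  · simpa [List.getLast?_cons_cons] using hlast
  · exact List.isChain_cons_cons.mpr ⟨⟨⟨_, hmem⟩, hne01⟩, hchain⟩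
  · exact ⟨by rw [hx]; exact hmem, t', zero_le, ht'T, hfol⟩

/-- The length-three state runs contained in a state run, in their order. -/
def tripleList (q : List Q) : List (Q × Q × Q) := q.zip (q.tail.zip q.tail.tail)

/-- For a triple `(a, b, c)` the path has a label in `σ(a, b)` at one transition time and in `σ(b,
c)` at the next. This second time also starts the triple that follows. At replaced labels both
conditions read `1 ≤ 1`. -/
lemma Follows.visits {n l : ℕ} [DecidableEq Q] {A : DetAut AP Q}
    {L : EuclideanSpace ℝ (Fin n) → AP} {T : ℝ≥0} {x : ℝ≥0 → EuclideanSpace ℝ (Fin n)}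
    {C : Q × Q × Q → BarrierCert n l} {q : List Q}
    (hC : ∀ ν ∈ tripleList q, ∀ m, (∀ y ∈ L ⁻¹' A.letters ν.1 ν.2.1, (C ν).B m y ≤ (C ν).γ) ∧
      ∀ y ∈ L ⁻¹' A.letters ν.2.1 ν.2.2, 1 ≤ (C ν).B m y) {t : ℝ≥0}
    (h : A.Follows L T x q t) :
    BarrierCert.Visits T x (BarrierCert.along C (tripleList q)) t := by
  induction q generalizing t with
  | nil => simp [tripleList, BarrierCert.along, BarrierCert.Visits]
  | cons a q ih =>
    match q with
    | [] => simp [tripleList, BarrierCert.along, BarrierCert.Visits]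
    | [b] => simp [tripleList, BarrierCert.along, BarrierCert.Visits]
    | b :: c :: rest =>
      have htl : tripleList (a :: b :: c :: rest) = (a, b, c) :: tripleList (b :: c :: rest) := by
        simp [tripleList]
      obtain ⟨h1, t', htt', ht'T, h2⟩ := h
      have h3 : L (x t') ∈ A.letters b c := h2.1
      rw [htl] at hC ⊢
      refine ⟨?_, t', htt', ht'T, ?_, ih (fun ν hν => hC ν (List.mem_cons_of_mem _ hν)) h2⟩
      · intro m
        split_ifs
        · exact le_rfl
        · exact (hC _ List.mem_cons_self m).1 _ h1
      · intro m
        split_ifs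
        · exact le_rfl
        · exact (hC _ List.mem_cons_self m).2 _ h3

end DetAut

/-! ### Union bounds for satisfaction and violation -/

lemma one_sub_probSatNeg_le {Ω E AP : Type*} [MeasurableSpace Ω] (P : Measure Ω)
    [IsProbabilityMeasure P] (L : E → AP) (T : ℝ≥0) (ξ : ℝ≥0 → Ω → E) (φ : LTLf AP) :
    1 - probSatNeg P L T ξ φ ≤ probSat P L T ξ φ := by
  rw [tsub_le_iff_right, ← measure_univ (μ := P)]
  refine (measure_mono fun ω _ => ?_).trans (measure_union_le _ _)
  by_cases h : ∀ σ, IsTrace L T (fun t => ξ t ω) σ → φ.Sat σ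
  · exact .inl h
  · push Not at h
    obtain ⟨σ, h1, h2⟩ := h
    exact .inr ⟨σ, h1, by simpa [LTLf.Sat] using h2⟩

/-- Lists over the finite state set are countable, so almost every violating outcome lies in a
countable union of passage events, one per run. Subadditivity needs no measurability of these
events. -/
lemma probSatNeg_le_sumProdBound {n l : ℕ} {AP : Type*} {L : EuclideanSpace ℝ (Fin n) → AP}
    {φ : LTLf AP} {Q : Type*} [Finite Q] [DecidableEq Q] {A : DetAut AP Q}
    (hA : A.Recognizes φ.neg) {T : ℝ≥0} {p : AP} {x₀ : EuclideanSpace ℝ (Fin n)}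
    (hx₀ : x₀ ∈ L ⁻¹' {p}) {Ω : Type*} [MeasurableSpace Ω] {P : Measure Ω}
    {ξ : ℝ≥0 → Ω → EuclideanSpace ℝ (Fin n)} (hξ : ∀ᵐ ω ∂P, ξ 0 ω = x₀)
    (hp : ∀ q₀ ∈ A.init, A.step q₀ p ≠ q₀) (C : Q × Q × Q → BarrierCert n l)
    (hC : ∀ q ∈ A.runsFrom p, ∀ ν ∈ triples q, ∀ m,
      (∀ y ∈ L ⁻¹' A.letters ν.1 ν.2.1, (C ν).B m y ≤ (C ν).γ) ∧
      ∀ y ∈ L ⁻¹' A.letters ν.2.1 ν.2.2, 1 ≤ (C ν).B m y)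
    (hC₀ : ∀ q ∈ A.runsFrom p, ∀ ν ∈ triples q, 0 ≤ (C ν).γ ∧ 0 ≤ (C ν).c)
    (hbound : ∀ q ∈ A.runsFrom p,
      P {ω | BarrierCert.Visits T (fun t => ξ t ω)
        (BarrierCert.along C (DetAut.tripleList q)) 0} ≤
      ENNReal.ofReal (BarrierCert.chainBound T (BarrierCert.along C (DetAut.tripleList q)))) :
    probSatNeg P L T ξ φ ≤ sumProdBound A p T (fun ν => (C ν).γ) (fun ν => (C ν).c) := by
  have hmem : ∀ q (ν : Q × Q × Q), ν ∈ DetAut.tripleList q → ν ∈ triples q := fun q ν h => by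
    simpa [triples, DetAut.tripleList] using h
  have hae : {ω | ∃ σ, IsTrace L T (fun t => ξ t ω) σ ∧ (LTLf.neg φ).Sat σ} ≤ᵐ[P]
      ⋃ q : A.runsFrom p, {ω | BarrierCert.Visits T (fun t => ξ t ω)
        (BarrierCert.along C (DetAut.tripleList (q : List Q))) 0} := by
    filter_upwards [hξ] with ω hω hσ
    obtain ⟨σ, hσ, hsat⟩ := hσ
    obtain ⟨q, hq, hf⟩ := A.exists_run_of_isTrace L T (fun t => ξ t ω) p
      (by simpa [hω] using hx₀) hp σ hσ ((hA σ hσ.1).2 hsat)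
    exact Set.mem_iUnion.2 ⟨⟨q, hq⟩, hf.visits fun ν hν => hC q hq ν (hmem q ν hν)⟩
  refine (measure_mono_ae hae).trans ((measure_iUnion_le _).trans ?_)
  refine ENNReal.tsum_le_tsum fun q => (hbound q q.2).trans_eq ?_
  rw [BarrierCert.chainBound_along, ENNReal.ofReal_prod_of_nonneg]
  · rfl
  · intro ν hν
    obtain ⟨h1, h2⟩ := hC₀ q q.2 ν (hmem q ν (by simpa using hν))
    positivity


/-! ## Chains of approximate supermartingales in discrete time -/

/-- A process in discrete time together with the constants and the error terms of a supermartingale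
inequality. -/
structure Stage (Ω : Type*) where
  V : ℕ → Ω → ℝ
  γ : ℝ
  c : ℝ
  e : ℕ → Ω → ℝ

namespace Stage

variable {Ω : Type*} [mΩ : MeasurableSpace Ω]

/-- As long as `D` persists, the process is a nonnegative supermartingale up to the drift `c δ` and
the error `e` of each step. -/
structure IsSupermartingale (P : Measure Ω) (𝒢 : Filtration ℕ mΩ) (D : ℕ → Set Ω) (K : ℕ) (δ : ℝ)
    (C : Stage Ω) : Prop where
  measurable : ∀ j, Measurable[𝒢 j] (C.V j)
  integrable : ∀ j, Integrable (C.V j) P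
  nonneg : ∀ j ω, 0 ≤ C.V j ω
  γ_nonneg : 0 ≤ C.γ
  c_nonneg : 0 ≤ C.c
  e_integrable : ∀ j, Integrable (C.e j) P
  e_nonneg : ∀ j ω, 0 ≤ C.e j ω
  step : ∀ j < K, ∀ A, MeasurableSet[𝒢 j] A → A ⊆ D j →
    ∫ ω in A, C.V (j + 1) ω ∂P ≤ ∫ ω in A, (C.V j ω + C.c * δ + C.e j ω) ∂P

/-- From time `i` on, the processes of the list start low and become high one after the other. -/
def Win (K : ℕ) (ε : ℝ) (ω : Ω) : List (Stage Ω) → ℕ → Prop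
  | [], _ => True
  | C :: Cs, i => C.V i ω < C.γ + ε ∧ ∃ j, i ≤ j ∧ j ≤ K ∧ 1 - ε < C.V j ω ∧ Win K ε ω Cs j

/-- The starting condition of the first process of a list. -/
def Starts (ε : ℝ) (ω : Ω) : List (Stage Ω) → ℕ → Prop
  | [], _ => True
  | C :: _, i => C.V i ω < C.γ + ε

/-- The bound on the probability of `Win`, up to the error terms. -/
def bound (K : ℕ) (δ ε : ℝ) (Cs : List (Stage Ω)) : ℝ :=
  (Cs.map fun C => (C.γ + ε + C.c * δ * K) / (1 - ε)).prod

/-- The accumulated error terms. -/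
def error (K : ℕ) (δ ε : ℝ) : List (Stage Ω) → Ω → ℝ
  | [], _ => 0
  | C :: Cs, ω => error K δ ε Cs ω + bound K δ ε Cs / (1 - ε) * ∑ j ∈ Finset.range K, C.e j ω

variable {P : Measure Ω} [IsProbabilityMeasure P] {𝒢 : Filtration ℕ mΩ} {D : ℕ → Set Ω} {K : ℕ}
  {δ ε : ℝ}

omit mΩ in
lemma Win.starts {ω : Ω} {Cs : List (Stage Ω)} {i : ℕ} (h : Win K ε ω Cs i) :
    Starts ε ω Cs i := by
  cases Cs with
  | nil => trivial
  | cons C Cs => exact h.1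

omit mΩ in
-- Only the starting condition looks at the present index; the remaining indices are merely bounded
-- below by it. This justifies changing to the next stage at the earliest admissible index.
lemma Win.of_le {ω : Ω} {Cs : List (Stage Ω)} {i j : ℕ} (hij : i ≤ j) (h : Win K ε ω Cs j)
    (hi : Starts ε ω Cs i) : Win K ε ω Cs i := by
  cases Cs with
  | nil => trivial
  | cons C Cs =>
    obtain ⟨-, k, hk, h⟩ := h
    exact ⟨hi, k, hij.trans hk, h⟩

omit [IsProbabilityMeasure P] in
lemma measurableSet_starts {Cs : List (Stage Ω)}
    (hCs : ∀ C ∈ Cs, C.IsSupermartingale P 𝒢 D K δ) (i : ℕ) :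
    MeasurableSet[𝒢 i] {ω | Starts ε ω Cs i} := by
  cases Cs with
  | nil => exact MeasurableSet.univ
  | cons C Cs =>
    exact (hCs C (by simp)).measurable i measurableSet_Iio

omit [IsProbabilityMeasure P] in
lemma bound_nonneg (hδ : 0 ≤ δ) (hε : 0 < ε) (hε1 : ε < 1) {Cs : List (Stage Ω)}
    (hCs : ∀ C ∈ Cs, C.IsSupermartingale P 𝒢 D K δ) : 0 ≤ bound K δ ε Cs := by
  refine List.prod_nonneg fun a ha => ?_
  obtain ⟨C, hC, rfl⟩ := List.mem_map.1 ha
  have h1 := (hCs C hC).γ_nonneg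
  have h2 := (hCs C hC).c_nonneg
  have : 0 ≤ 1 - ε := by linarith
  positivity

omit [IsProbabilityMeasure P] in
lemma error_nonneg (hδ : 0 ≤ δ) (hε : 0 < ε) (hε1 : ε < 1) {Cs : List (Stage Ω)}
    (hCs : ∀ C ∈ Cs, C.IsSupermartingale P 𝒢 D K δ) (ω : Ω) : 0 ≤ error K δ ε Cs ω := by
  induction Cs with
  | nil => exact le_rfl
  | cons C Cs ih =>
    have hCs' : ∀ C ∈ Cs, C.IsSupermartingale P 𝒢 D K δ := fun C h => hCs C (by simp [h])
    have h1 := bound_nonneg hδ hε hε1 hCs'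
    have h2 := ih hCs'
    have h3 : 0 ≤ ∑ j ∈ Finset.range K, C.e j ω :=
      Finset.sum_nonneg fun j _ => (hCs C (by simp)).e_nonneg j ω
    have : 0 ≤ 1 - ε := by linarith
    simp only [error]
    positivity

omit [IsProbabilityMeasure P] in
lemma error_integrable {Cs : List (Stage Ω)}
    (hCs : ∀ C ∈ Cs, C.IsSupermartingale P 𝒢 D K δ) : Integrable (error K δ ε Cs) P := by
  induction Cs with
  | nil => exact integrable_zero _ _ _
  | cons C Cs ih =>
    refine (ih fun C h => hCs C (by simp [h])).add (Integrable.const_mul ?_ _)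
    exact integrable_finsetSum _ fun j _ => (hCs C (by simp)).e_integrable j

/-- Optional stopping as a backward induction on `d = K - i`. Let `H` be the event that the current
process is high and the next one may start. On `H` the later stages win with probability at most `b
≤ b / (1 - ε) * V`, up to their errors; off `H` the supermartingale inequality carries the bound
over one step. Testing against all sets `A` of the past replaces conditional expectations, and the
later errors `Y` simply add up over disjoint sets. -/
lemma measureReal_reach_le (hδ : 0 ≤ δ) (hε : 0 < ε) (hε1 : ε < 1)
    (hD : Antitone D) (hDm : ∀ j, MeasurableSet[𝒢 j] (D j)) {C : Stage Ω}
    {Cs : List (Stage Ω)} (hC : C.IsSupermartingale P 𝒢 D K δ)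
    (hCs : ∀ C ∈ Cs, C.IsSupermartingale P 𝒢 D K δ)
    (ih : ∀ i ≤ K, ∀ A, MeasurableSet[𝒢 i] A → A ⊆ D i →
      P.real {ω ∈ A | Win K ε ω Cs i ∧ ω ∈ D K} ≤
        ∫ ω in A, (bound K δ ε Cs + error K δ ε Cs ω) ∂P) (d : ℕ) :
    ∀ i, i + d = K → ∀ A, MeasurableSet[𝒢 i] A → A ⊆ D i →
      P.real {ω ∈ A | (∃ j, i ≤ j ∧ j ≤ K ∧ 1 - ε < C.V j ω ∧ Win K ε ω Cs j) ∧ ω ∈ D K} ≤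
        ∫ ω in A, (bound K δ ε Cs / (1 - ε) *
          (C.V i ω + C.c * δ * d + ∑ j ∈ Finset.Ico i K, C.e j ω) + error K δ ε Cs ω) ∂P := by
  have hb := bound_nonneg hδ hε hε1 hCs
  have hY := error_nonneg hδ hε hε1 hCs
  have hYi := error_integrable (ε := ε) hCs
  have hε' : 0 < 1 - ε := by linarith
  have hc := hC.c_nonneg
  set b := bound K δ ε Cs
  set Y := error K δ ε Cs
  have hint : ∀ (d i k : ℕ), Integrable (fun ω => b / (1 - ε) *
      (C.V k ω + C.c * δ * d + ∑ j ∈ Finset.Ico i K, C.e j ω) + Y ω) P := fun d i k =>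
    ((((hC.integrable k).add (integrable_const _)).add
      (integrable_finsetSum _ fun j _ => hC.e_integrable j)).const_mul _).add hYi
  have hnn : ∀ (d i k : ℕ) (ω : Ω), 0 ≤ b / (1 - ε) *
      (C.V k ω + C.c * δ * d + ∑ j ∈ Finset.Ico i K, C.e j ω) + Y ω := by
    intro d i k ω
    have h1 := hC.nonneg k ω
    have h2 : 0 ≤ ∑ j ∈ Finset.Ico i K, C.e j ω := Finset.sum_nonneg fun j _ => hC.e_nonneg j ω
    have h3 := hY ω
    positivity
  induction d with
  | zero =>
    intro i hi A hA hAD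
    obtain rfl : i = K := by omega
    have hH : MeasurableSet[𝒢 i] {ω | 1 - ε < C.V i ω} := hC.measurable i measurableSet_Ioi
    have hA1 := hA.inter hH
    calc _ ≤ P.real {ω ∈ A ∩ {ω | 1 - ε < C.V i ω} | Win i ε ω Cs i ∧ ω ∈ D i} := by
          refine measureReal_mono ?_
          rintro ω ⟨hω, ⟨j, h1, h2, h3, h4⟩, h5⟩
          obtain rfl : i = j := by omega
          exact ⟨⟨hω, h3⟩, h4, h5⟩
      _ ≤ ∫ ω in A ∩ {ω | 1 - ε < C.V i ω}, (b + Y ω) ∂P :=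
          ih i le_rfl _ hA1 (Set.inter_subset_left.trans hAD)
      _ ≤ ∫ ω in A ∩ {ω | 1 - ε < C.V i ω}, (b / (1 - ε) *
          (C.V i ω + C.c * δ * (0 : ℕ) + ∑ j ∈ Finset.Ico i i, C.e j ω) + Y ω) ∂P := by
          refine setIntegral_mono_on ((integrable_const _).add hYi).integrableOn
            (hint _ _ _).integrableOn (𝒢.le _ _ hA1) fun ω hω => ?_
          have h6 : 1 - ε < C.V i ω := hω.2
          have h7 : b = b / (1 - ε) * (1 - ε) := by field_simp
          simp only [Nat.cast_zero, mul_zero, add_zero, Finset.Ico_self, Finset.sum_empty]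
          have h8 : b / (1 - ε) * (1 - ε) ≤ b / (1 - ε) * C.V i ω :=
            mul_le_mul_of_nonneg_left h6.le (by positivity)
          linarith
      _ ≤ _ := setIntegral_mono_set (hint _ _ _).integrableOn
          (ae_of_all _ (hnn _ _ _)) (ae_of_all _ fun ω hω => hω.1)
  | succ d ihd =>
    intro i hi A hA hAD
    set H : Set Ω := {ω | 1 - ε < C.V i ω} ∩ {ω | Starts ε ω Cs i} with hHdef
    have hH : MeasurableSet[𝒢 i] H :=
      (hC.measurable i measurableSet_Ioi).inter (measurableSet_starts hCs i)
    have hA1 := hA.inter hH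
    have hA2 := hA.diff hH
    have hA3 : MeasurableSet[𝒢 (i + 1)] ((A \ H) ∩ D (i + 1)) :=
      (𝒢.mono (Nat.le_succ i) _ hA2).inter (hDm _)
    -- One step uses up one `C.c * δ` and the error `C.e i`, which accounts for the shift from `d +
    -- 1` to `d` and from `i` to `i + 1`.
    have hsum : ∀ ω, ∑ j ∈ Finset.Ico i K, C.e j ω =
        C.e i ω + ∑ j ∈ Finset.Ico (i + 1) K, C.e j ω := fun ω =>
      Finset.sum_eq_sum_Ico_succ_bot (by omega) _
    have hI : Integrable (fun ω => ∑ j ∈ Finset.Ico (i + 1) K, C.e j ω) P :=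
      integrable_finsetSum _ fun j _ => hC.e_integrable j
    have first : P.real {ω ∈ A ∩ H | Win K ε ω Cs i ∧ ω ∈ D K} ≤
        ∫ ω in A ∩ H, (b / (1 - ε) *
          (C.V i ω + C.c * δ * (d + 1 : ℕ) + ∑ j ∈ Finset.Ico i K, C.e j ω) + Y ω) ∂P := by
      refine (ih i (by omega) _ hA1 (Set.inter_subset_left.trans hAD)).trans ?_
      refine setIntegral_mono_on ((integrable_const _).add hYi).integrableOn
        (hint _ _ _).integrableOn (𝒢.le _ _ hA1) fun ω hω => ?_
      have h6 : 1 - ε < C.V i ω := hω.2.1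
      have h7 : b = b / (1 - ε) * (1 - ε) := by field_simp
      have h2 : 0 ≤ ∑ j ∈ Finset.Ico i K, C.e j ω := Finset.sum_nonneg fun j _ => hC.e_nonneg j ω
      have h9 : 0 ≤ C.c * δ * (d + 1 : ℕ) := by positivity
      have h8 : b / (1 - ε) * (1 - ε) ≤ b / (1 - ε) *
          (C.V i ω + C.c * δ * (d + 1 : ℕ) + ∑ j ∈ Finset.Ico i K, C.e j ω) :=
        mul_le_mul_of_nonneg_left (by linarith) (by positivity)
      linarith
    have second : P.real {ω ∈ (A \ H) ∩ D (i + 1) |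
          (∃ j, i + 1 ≤ j ∧ j ≤ K ∧ 1 - ε < C.V j ω ∧ Win K ε ω Cs j) ∧ ω ∈ D K} ≤
        ∫ ω in A \ H, (b / (1 - ε) *
          (C.V i ω + C.c * δ * (d + 1 : ℕ) + ∑ j ∈ Finset.Ico i K, C.e j ω) + Y ω) ∂P := by
      refine (ihd (i + 1) (by omega) _ hA3 Set.inter_subset_right).trans ?_
      -- The induction hypothesis lives on `D (i + 1)`, but this set is not in the past of `i`. As
      -- the integrand is nonnegative, the integral may be enlarged to `A \ H`, where the one-step
      -- inequality applies.
      refine (setIntegral_mono_set (hint _ _ _).integrableOn (ae_of_all _ (hnn _ _ _))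
        (t := A \ H) (ae_of_all _ fun ω hω => hω.1)).trans ?_
      have hst := hC.step i (by omega) _ hA2 (Set.sdiff_subset.trans hAD)
      have e1 : ∫ ω in A \ H, (b / (1 - ε) * (C.V (i + 1) ω + C.c * δ * d +
          ∑ j ∈ Finset.Ico (i + 1) K, C.e j ω) + Y ω) ∂P =
          b / (1 - ε) * ∫ ω in A \ H, C.V (i + 1) ω ∂P + ∫ ω in A \ H, (b / (1 - ε) *
            (C.c * δ * d + ∑ j ∈ Finset.Ico (i + 1) K, C.e j ω) + Y ω) ∂P := by
        rw [← integral_const_mul, ← integral_add]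
        · congr 1; ext ω; ring
        · exact ((hC.integrable _).const_mul _).integrableOn
        · exact ((((integrable_const _).add hI).const_mul _).add hYi).integrableOn
      have e2 : ∫ ω in A \ H, (b / (1 - ε) * (C.V i ω + C.c * δ * (d + 1 : ℕ) +
          ∑ j ∈ Finset.Ico i K, C.e j ω) + Y ω) ∂P =
          b / (1 - ε) * ∫ ω in A \ H, (C.V i ω + C.c * δ + C.e i ω) ∂P +
          ∫ ω in A \ H, (b / (1 - ε) *
            (C.c * δ * d + ∑ j ∈ Finset.Ico (i + 1) K, C.e j ω) + Y ω) ∂P := by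
        rw [← integral_const_mul, ← integral_add]
        · congr 1; ext ω; rw [hsum]; push_cast; ring
        · exact ((((hC.integrable _).add (integrable_const _)).add
            (hC.e_integrable _)).const_mul _).integrableOn
        · exact ((((integrable_const _).add hI).const_mul _).add hYi).integrableOn
      rw [e1, e2]
      gcongr
    calc _ ≤ P.real ({ω ∈ A ∩ H | Win K ε ω Cs i ∧ ω ∈ D K} ∪ {ω ∈ (A \ H) ∩ D (i + 1) |
          (∃ j, i + 1 ≤ j ∧ j ≤ K ∧ 1 - ε < C.V j ω ∧ Win K ε ω Cs j) ∧ ω ∈ D K}) := by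
          refine measureReal_mono ?_
          rintro ω ⟨hω, ⟨j, h1, h2, h3, h4⟩, h5⟩
          -- On `H`, success at any later `j` is already success at `i`; off `H`, the index `j`
          -- cannot be `i`.
          by_cases hωH : ω ∈ H
          · exact .inl ⟨⟨hω, hωH⟩, h4.of_le h1 hωH.2, h5⟩
          · have hij : i ≠ j := by
              rintro rfl
              exact hωH ⟨h3, h4.starts⟩
            exact .inr ⟨⟨⟨hω, hωH⟩, hD (by omega) h5⟩, ⟨j, by omega, h2, h3, h4⟩, h5⟩
      _ ≤ _ := measureReal_union_le _ _
      _ ≤ _ := add_le_add first second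
      _ = _ := by
        rw [← Set.sdiff_self_inter (s := A) (t := H), ← setIntegral_union
          Set.disjoint_sdiff_right (𝒢.le _ _ (hA.diff hA1)) (hint _ _ _).integrableOn
          (hint _ _ _).integrableOn, Set.union_sdiff_cancel Set.inter_subset_left]

/-- Induction on the number of stages. The starting condition bounds `V i` by `γ + ε`, so
`measureReal_reach_le` contributes the factor `(γ + ε + c δ K) / (1 - ε)` to the bound for the later
stages. -/
lemma measureReal_win_le_setIntegral (hδ : 0 ≤ δ) (hε : 0 < ε) (hε1 : ε < 1)
    (hD : Antitone D) (hDm : ∀ j, MeasurableSet[𝒢 j] (D j)) {Cs : List (Stage Ω)}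
    (hCs : ∀ C ∈ Cs, C.IsSupermartingale P 𝒢 D K δ) :
    ∀ i ≤ K, ∀ A, MeasurableSet[𝒢 i] A → A ⊆ D i →
      P.real {ω ∈ A | Win K ε ω Cs i ∧ ω ∈ D K} ≤
        ∫ ω in A, (bound K δ ε Cs + error K δ ε Cs ω) ∂P := by
  induction Cs with
  | nil =>
    intro i _ A hA _
    simp only [bound, error, List.map_nil, List.prod_nil, add_zero, integral_const, smul_eq_mul,
      mul_one, measureReal_restrict_apply_univ]
    exact measureReal_mono fun ω h => h.1
  | cons C Cs ih =>
    intro i hi A hA hAD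
    have hC := hCs C (by simp)
    have hCs' : ∀ C ∈ Cs, C.IsSupermartingale P 𝒢 D K δ := fun C h => hCs C (by simp [h])
    have hb := bound_nonneg hδ hε hε1 hCs'
    have hYi := error_integrable (ε := ε) hCs'
    have hc := hC.c_nonneg
    have hε' : 0 < 1 - ε := by linarith
    have hstart := measurableSet_starts (ε := ε) hCs i
    have hA1 := hA.inter hstart
    have key := measureReal_reach_le hδ hε hε1 hD hDm hC hCs' (ih hCs') (K - i) i (by omega) _ hA1
      (Set.inter_subset_left.trans hAD)
    have hint : Integrable (fun ω => bound K δ ε (C :: Cs) + error K δ ε (C :: Cs) ω) P :=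
      (integrable_const _).add (error_integrable hCs)
    refine (measureReal_mono ?_).trans (key.trans ?_)
    · rintro ω ⟨h1, ⟨h2, h3⟩, h4⟩
      exact ⟨⟨h1, h2⟩, h3, h4⟩
    · refine (setIntegral_mono_on ?_ hint.integrableOn (𝒢.le _ _ hA1) fun ω hω => ?_).trans
        (setIntegral_mono_set hint.integrableOn (ae_of_all _ fun ω =>
          add_nonneg (bound_nonneg hδ hε hε1 hCs) (error_nonneg hδ hε hε1 hCs ω))
          (ae_of_all _ fun ω hω => hω.1))
      · exact (((((hC.integrable _).add (integrable_const _)).add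
          (integrable_finsetSum _ fun j _ => hC.e_integrable j)).const_mul _).add hYi).integrableOn
      · have h1 : C.V i ω < C.γ + ε := hω.2
        have h2 : ∑ j ∈ Finset.Ico i K, C.e j ω ≤ ∑ j ∈ Finset.range K, C.e j ω := by
          refine Finset.sum_le_sum_of_subset_of_nonneg (fun j hj => ?_) fun j _ _ =>
            hC.e_nonneg j ω
          simp only [Finset.mem_Ico, Finset.mem_range] at hj ⊢
          omega
        have h3 : ((K - i : ℕ) : ℝ) ≤ K := by exact_mod_cast Nat.sub_le _ _
        have h4 : C.c * δ * (K - i : ℕ) ≤ C.c * δ * K :=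
          mul_le_mul_of_nonneg_left h3 (by positivity)
        have h5 : bound K δ ε (C :: Cs) =
            bound K δ ε Cs / (1 - ε) * (C.γ + ε + C.c * δ * K) := by
          simp only [bound, List.map_cons, List.prod_cons]
          ring
        have h6 : bound K δ ε Cs / (1 - ε) *
            (C.V i ω + C.c * δ * (K - i : ℕ) + ∑ j ∈ Finset.Ico i K, C.e j ω) ≤
            bound K δ ε Cs / (1 - ε) *
            ((C.γ + ε + C.c * δ * K) + ∑ j ∈ Finset.range K, C.e j ω) :=
          mul_le_mul_of_nonneg_left (by linarith) (by positivity)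
        simp only [error]
        rw [h5]
        linarith

lemma measureReal_win_le (hδ : 0 ≤ δ) (hε : 0 < ε) (hε1 : ε < 1)
    (hD : Antitone D) (hDm : ∀ j, MeasurableSet[𝒢 j] (D j)) {Cs : List (Stage Ω)}
    (hCs : ∀ C ∈ Cs, C.IsSupermartingale P 𝒢 D K δ) :
    P.real {ω | Win K ε ω Cs 0 ∧ ω ∈ D K} ≤ bound K δ ε Cs + ∫ ω, error K δ ε Cs ω ∂P := by
  have h := measureReal_win_le_setIntegral hδ hε hε1 hD hDm hCs 0 (Nat.zero_le _) (D 0) (hDm 0)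
    subset_rfl
  have hint := (integrable_const (bound K δ ε Cs)).add (error_integrable (ε := ε) hCs)
  have h' := setIntegral_le_integral (s := D 0) hint (ae_of_all _ fun ω =>
    add_nonneg (bound_nonneg hδ hε hε1 hCs) (error_nonneg hδ hε hε1 hCs ω))
  refine (measureReal_mono ?_).trans (h.trans (h'.trans_eq ?_))
  · rintro ω ⟨h1, h2⟩
    exact ⟨hD (Nat.zero_le _) h2, h1, h2⟩
  · simp only [Pi.add_apply]
    rw [integral_add (integrable_const _) (error_integrable (ε := ε) hCs)]
    simp

omit [IsProbabilityMeasure P] in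
/-- If the errors of every stage sum up to at most `η` in mean, then the accumulated error is at
most a multiple of `η`. -/
lemma integral_error_le (hδ : 0 ≤ δ) (hε : 0 < ε) (hε1 : ε < 1) {Cs : List (Stage Ω)}
    (hCs : ∀ C ∈ Cs, C.IsSupermartingale P 𝒢 D K δ) {η b : ℝ} (hb : ∀ Ds, Ds <:+ Cs →
      bound K δ ε Ds ≤ b)
    (hη : ∀ C ∈ Cs, ∑ j ∈ Finset.range K, ∫ ω, C.e j ω ∂P ≤ η) :
    ∫ ω, error K δ ε Cs ω ∂P ≤ Cs.length * (b / (1 - ε) * η) := by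
  induction Cs with
  | nil => simp [error]
  | cons C Cs ih =>
    have hCs' : ∀ C ∈ Cs, C.IsSupermartingale P 𝒢 D K δ := fun C h => hCs C (by simp [h])
    have ih' := ih hCs' (fun Ds h => hb Ds (h.trans (List.suffix_cons _ _)))
      (fun C h => hη C (by simp [h]))
    have hI : Integrable (fun ω => ∑ j ∈ Finset.range K, C.e j ω) P :=
      integrable_finsetSum _ fun j _ => (hCs C (by simp)).e_integrable j
    simp only [error]
    rw [integral_add (error_integrable hCs') (hI.const_mul _), integral_const_mul,
      integral_finsetSum _ fun j _ => (hCs C (by simp)).e_integrable j]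
    have h1 := hη C (by simp)
    have h2 := hb Cs (List.suffix_cons _ _)
    have h3 := bound_nonneg hδ hε hε1 hCs'
    have h4 : 0 < 1 - ε := by linarith
    have h5 : bound K δ ε Cs / (1 - ε) * ∑ j ∈ Finset.range K, ∫ ω, C.e j ω ∂P ≤
        b / (1 - ε) * η := by
      refine mul_le_mul (by gcongr) h1 (Finset.sum_nonneg fun j _ => integral_nonneg fun ω =>
        (hCs C (by simp)).e_nonneg j ω) ?_
      exact div_nonneg (h3.trans h2) h4.le
    push_cast [List.length_cons]
    linarith

end Stage


/-! ## Gaussian increments and second order expansions -/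

/-- The centered Gaussian measure on `ℝʳ` with covariance matrix `δ` times the identity. -/
def gaussianVec (r : ℕ) (δ : ℝ≥0) : Measure (Fin r → ℝ) :=
  Measure.pi fun _ => gaussianReal 0 δ

instance (r : ℕ) (δ : ℝ≥0) : IsProbabilityMeasure (gaussianVec r δ) := by
  unfold gaussianVec; infer_instance

namespace gaussianVec

variable {r : ℕ} {δ : ℝ≥0}

lemma memLp_eval (i : Fin r) (p : ℝ≥0) : MemLp (fun w : Fin r → ℝ => w i) p (gaussianVec r δ) :=
  (memLp_id_gaussianReal p).comp_measurePreserving (measurePreserving_eval _ i)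

lemma integrable_eval (i : Fin r) : Integrable (fun w : Fin r → ℝ => w i) (gaussianVec r δ) :=
  (memLp_eval i 1).integrable (by simp)

lemma integrable_pow_four (i : Fin r) :
    Integrable (fun w : Fin r → ℝ => w i ^ 4) (gaussianVec r δ) := by
  have h := (memLp_eval (δ := δ) i 4).integrable_norm_pow (by norm_num)
  refine h.congr (ae_of_all _ fun w => ?_)
  simp only [Real.norm_eq_abs]
  exact Even.pow_abs (by decide) _

lemma integral_eval (i : Fin r) : ∫ w, w i ∂gaussianVec r δ = 0 := by
  have h : Measure.map (Function.eval i) (gaussianVec r δ) = gaussianReal 0 δ :=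
    (measurePreserving_eval _ i).map_eq
  have := integral_map (μ := gaussianVec r δ) (measurable_pi_apply i).aemeasurable
    (f := fun x : ℝ => x) aestronglyMeasurable_id
  rw [← this]
  change ∫ x, x ∂Measure.map (Function.eval i) (gaussianVec r δ) = 0
  rw [h, integral_id_gaussianReal]

lemma integrable_mul (i j : Fin r) :
    Integrable (fun w : Fin r → ℝ => w i * w j) (gaussianVec r δ) :=
  MemLp.integrable_mul (p := 2) (q := 2) (by simpa using memLp_eval i 2)
    (by simpa using memLp_eval j 2)

lemma integral_mul (i j : Fin r) :
    ∫ w, w i * w j ∂gaussianVec r δ = if i = j then (δ : ℝ) else 0 := by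
  split_ifs with hij
  · subst hij
    have h : Measure.map (Function.eval i) (gaussianVec r δ) = gaussianReal 0 δ :=
      (measurePreserving_eval _ i).map_eq
    have := integral_map (μ := gaussianVec r δ) (measurable_pi_apply i).aemeasurable
      (f := fun x : ℝ => x * x) (by fun_prop)
    rw [← this]
    change ∫ x, x * x ∂Measure.map (Function.eval i) (gaussianVec r δ) = δ
    rw [h]
    have hv := variance_id_gaussianReal (μ := 0) (v := δ)
    rw [variance_of_integral_eq_zero aemeasurable_id (by simp)] at hv
    simpa [sq] using hv
  · have h : iIndepFun (fun (i : Fin r) (w : Fin r → ℝ) => w i) (gaussianVec r δ) :=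
      iIndepFun_pi (X := fun _ x => x) fun _ => aemeasurable_id
    have h2 := (h.indepFun hij).integral_mul_eq_mul_integral
      (measurable_pi_apply i).aestronglyMeasurable (measurable_pi_apply j).aestronglyMeasurable
    simp only [Pi.mul_apply] at h2
    rw [h2, integral_eval, zero_mul]

/-- Scaling by `√δ` reduces to the standard Gaussian. Only the order `δ ^ 2` matters later, not the
value of the constant. -/
lemma integral_pow_four (i : Fin r) :
    ∫ w, w i ^ 4 ∂gaussianVec r δ = δ ^ 2 * ∫ x, x ^ 4 ∂gaussianReal 0 1 := by
  have h : Measure.map (Function.eval i) (gaussianVec r δ) = gaussianReal 0 δ :=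
    (measurePreserving_eval _ i).map_eq
  have := integral_map (μ := gaussianVec r δ) (measurable_pi_apply i).aemeasurable
    (f := fun x : ℝ => x ^ 4) (by fun_prop)
  rw [← this]
  change ∫ x, x ^ 4 ∂Measure.map (Function.eval i) (gaussianVec r δ) = _
  have h2 : gaussianReal 0 δ = Measure.map (fun x => √(δ : ℝ) * x) (gaussianReal 0 1) := by
    rw [gaussianReal_map_const_mul]
    congr 1
    · simp
    · ext; simp
  rw [h, h2, integral_map (by fun_prop) (by fun_prop), ← integral_const_mul]
  congr 1
  ext x
  have : √(δ : ℝ) ^ 4 = δ ^ 2 := by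
    rw [show 4 = 2 * 2 from rfl, pow_mul, Real.sq_sqrt δ.coe_nonneg]
  rw [mul_pow, this]

variable {E : Type*} [NormedAddCommGroup E] [NormedSpace ℝ E]

lemma norm_step_sq_le (a : E) (β : Fin r → E) {C : ℝ} (ha : ‖a‖ ≤ C)
    (hβ : ∀ k, ‖β k‖ ≤ C) (δ : ℝ≥0) (w : Fin r → ℝ) :
    ‖(δ : ℝ) • a + ∑ k, w k • β k‖ ^ 2 ≤ 2 * C ^ 2 * δ ^ 2 + 2 * C ^ 2 * r * ∑ k, w k ^ 2 := by
  have h1 : ‖(δ : ℝ) • a‖ ≤ δ * C := by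
    rw [norm_smul, Real.norm_eq_abs, NNReal.abs_eq]
    gcongr
  have h2 : ‖∑ k, w k • β k‖ ≤ (∑ k, |w k|) * C := by
    rw [Finset.sum_mul]
    refine (norm_sum_le _ _).trans (Finset.sum_le_sum fun k _ => ?_)
    rw [norm_smul, Real.norm_eq_abs]
    exact mul_le_mul_of_nonneg_left (hβ k) (abs_nonneg _)
  have h3 : (∑ k, |w k|) ^ 2 ≤ r * ∑ k, w k ^ 2 := by
    simpa using sq_sum_le_card_mul_sum_sq (s := Finset.univ) (f := fun k => |w k|)
  have h4 := (norm_add_le ((δ : ℝ) • a) (∑ k, w k • β k)).trans (add_le_add h1 h2)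
  calc _ ≤ (δ * C + (∑ k, |w k|) * C) ^ 2 := by gcongr
    _ ≤ 2 * C ^ 2 * δ ^ 2 + 2 * C ^ 2 * (∑ k, |w k|) ^ 2 := by
      nlinarith [sq_nonneg (δ * C - (∑ k, |w k|) * C)]
    _ ≤ _ := by
      have := mul_le_mul_of_nonneg_left h3 (by positivity : 0 ≤ 2 * C ^ 2)
      linarith

/-- The second and fourth moments of a Gaussian step with bounded coefficients. -/
lemma exists_moment_bound (E : Type*) [NormedAddCommGroup E] [NormedSpace ℝ E] (r : ℕ) (C : ℝ) :
    ∃ κ : ℝ, 0 ≤ κ ∧ ∀ δ : ℝ≥0, δ ≤ 1 → ∀ (a : E)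
      (β : Fin r → E), ‖a‖ ≤ C → (∀ k, ‖β k‖ ≤ C) →
      (Integrable (fun w => ‖(δ : ℝ) • a + ∑ k, w k • β k‖ ^ 2) (gaussianVec r δ) ∧
        ∫ w, ‖(δ : ℝ) • a + ∑ k, w k • β k‖ ^ 2 ∂gaussianVec r δ ≤ κ * δ) ∧
      Integrable (fun w => ‖(δ : ℝ) • a + ∑ k, w k • β k‖ ^ 4) (gaussianVec r δ) ∧
        ∫ w, ‖(δ : ℝ) • a + ∑ k, w k • β k‖ ^ 4 ∂gaussianVec r δ ≤ κ * δ ^ 2 := by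
  set c4 := ∫ x, x ^ 4 ∂gaussianReal 0 1
  have hc4 : 0 ≤ c4 := integral_nonneg fun x => by positivity
  -- `κ₁` controls the second moment and `κ₂` the fourth. The factors come from `(a + b) ^ 2 ≤ 2 a ^
  -- 2 + 2 b ^ 2` and Cauchy–Schwarz over the `r` coordinates, applied once and twice; `δ ≤ 1`
  -- absorbs the higher powers of `δ`.
  set κ₁ := 2 * C ^ 2 + 2 * C ^ 2 * r * r
  set κ₂ := 8 * C ^ 4 + 8 * C ^ 4 * r ^ 3 * (r * c4)
  refine ⟨κ₁ + κ₂, by positivity, fun δ hδ a β ha hβ => ?_⟩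
  have hδ1 : (δ : ℝ) ≤ 1 := by exact_mod_cast hδ
  have hδ0 : (0 : ℝ) ≤ δ := δ.coe_nonneg
  have hsq : ∀ k : Fin r, Integrable (fun w : Fin r → ℝ => w k ^ 2) (gaussianVec r δ) := fun k => by
    simpa [sq] using integrable_mul k k
  have hcont : Continuous fun w : Fin r → ℝ => (δ : ℝ) • a + ∑ k, w k • β k := by fun_prop
  have hm2 : AEStronglyMeasurable (fun w => ‖(δ : ℝ) • a + ∑ k, w k • β k‖ ^ 2)
    (gaussianVec r δ) := (hcont.norm.pow 2).aestronglyMeasurable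
  have hm4 : AEStronglyMeasurable (fun w => ‖(δ : ℝ) • a + ∑ k, w k • β k‖ ^ 4)
    (gaussianVec r δ) := (hcont.norm.pow 4).aestronglyMeasurable
  have hb2 := norm_step_sq_le a β ha hβ δ
  have hI2 : Integrable (fun w : Fin r → ℝ => 2 * C ^ 2 * (δ : ℝ) ^ 2 +
      2 * C ^ 2 * r * ∑ k, w k ^ 2) (gaussianVec r δ) :=
    (integrable_const _).add ((integrable_finsetSum _ fun k _ => hsq k).const_mul _)
  have hb4 : ∀ w : Fin r → ℝ, ‖(δ : ℝ) • a + ∑ k, w k • β k‖ ^ 4 ≤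
      8 * C ^ 4 * δ ^ 4 + 8 * C ^ 4 * r ^ 3 * ∑ k, w k ^ 4 := by
    intro w
    have h1 : (∑ k, w k ^ 2) ^ 2 ≤ r * ∑ k, w k ^ 4 := by
      have := sq_sum_le_card_mul_sum_sq (s := Finset.univ) (f := fun k => w k ^ 2)
      simpa [← pow_mul] using this
    calc _ = (‖(δ : ℝ) • a + ∑ k, w k • β k‖ ^ 2) ^ 2 := by ring
      _ ≤ (2 * C ^ 2 * (δ : ℝ) ^ 2 + 2 * C ^ 2 * r * ∑ k, w k ^ 2) ^ 2 := by
        gcongr; exact hb2 w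
      _ ≤ 8 * C ^ 4 * δ ^ 4 + 8 * C ^ 4 * r ^ 2 * (∑ k, w k ^ 2) ^ 2 := by
        nlinarith [sq_nonneg (2 * C ^ 2 * (δ : ℝ) ^ 2 - 2 * C ^ 2 * r * ∑ k, w k ^ 2)]
      _ ≤ 8 * C ^ 4 * δ ^ 4 + 8 * C ^ 4 * r ^ 2 * (r * ∑ k, w k ^ 4) := by gcongr
      _ = _ := by ring
  have hI4 : Integrable (fun w : Fin r → ℝ => 8 * C ^ 4 * (δ : ℝ) ^ 4 +
      8 * C ^ 4 * r ^ 3 * ∑ k, w k ^ 4) (gaussianVec r δ) :=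
    (integrable_const _).add
      ((integrable_finsetSum _ fun k _ => integrable_pow_four k).const_mul _)
  have hi2 := hI2.mono' hm2 (ae_of_all _ fun w => by
    rw [Real.norm_of_nonneg (by positivity)]; exact hb2 w)
  have hi4 := hI4.mono' hm4 (ae_of_all _ fun w => by
    rw [Real.norm_of_nonneg (by positivity)]; exact hb4 w)
  refine ⟨⟨hi2, (integral_mono hi2 hI2 hb2).trans ?_⟩, hi4, (integral_mono hi4 hI4 hb4).trans ?_⟩
  · rw [integral_add (integrable_const _)
      ((integrable_finsetSum _ fun k _ => hsq k).const_mul _), integral_const_mul (2 * C ^ 2 * (r : ℝ)),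
      integral_finsetSum _ fun k _ => hsq k]
    have : ∀ k : Fin r, ∫ w : Fin r → ℝ, w k ^ 2 ∂gaussianVec r δ = δ := fun k => by
      simpa [sq] using integral_mul (δ := δ) k k
    simp only [this, integral_const, probReal_univ, smul_eq_mul, one_mul, Finset.sum_const,
      Finset.card_univ, Fintype.card_fin, nsmul_eq_mul]
    have h1 : (δ : ℝ) ^ 2 ≤ δ := by nlinarith
    have h2 : 2 * C ^ 2 * (δ : ℝ) ^ 2 ≤ 2 * C ^ 2 * δ := by gcongr
    have h3 : 0 ≤ κ₂ * δ := by positivity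
    calc _ ≤ κ₁ * δ := by simp only [κ₁]; linarith
      _ ≤ _ := by linarith
  · rw [integral_add (integrable_const _)
      ((integrable_finsetSum _ fun k _ => integrable_pow_four k).const_mul _),
      integral_const_mul (8 * C ^ 4 * (r : ℝ) ^ 3),
      integral_finsetSum _ fun k _ => integrable_pow_four k]
    simp only [integral_pow_four, integral_const, probReal_univ, smul_eq_mul, one_mul,
      Finset.sum_const, Finset.card_univ, Fintype.card_fin, nsmul_eq_mul]
    have h1 : (δ : ℝ) ^ 4 ≤ δ ^ 2 := pow_le_pow_of_le_one hδ0 hδ1 (by norm_num)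
    have h2 : 8 * C ^ 4 * (δ : ℝ) ^ 4 ≤ 8 * C ^ 4 * δ ^ 2 := by gcongr
    have h3 : 0 ≤ κ₁ * δ ^ 2 := by positivity
    calc _ ≤ κ₂ * δ ^ 2 := by simp only [κ₂]; linarith
      _ ≤ _ := by linarith

end gaussianVec

/-! ### Second order Taylor expansion with a uniform remainder -/

section Taylor

variable {E : Type*} [NormedAddCommGroup E] [NormedSpace ℝ E]

/-- The mean value inequality is used twice: for the first derivative on the ball of radius `‖v‖`,
and then for `F` minus half the quadratic form of its Hessian at `z`. Symmetry of the Hessian makes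
the derivative of that form equal to `H (x - z)`. -/
lemma abs_taylor_remainder_le {F : E → ℝ} (hF : ContDiff ℝ 2 F) (z v : E) {C : ℝ}
    (hC : ∀ x, ‖x - z‖ ≤ ‖v‖ → ‖fderiv ℝ (fderiv ℝ F) x - fderiv ℝ (fderiv ℝ F) z‖ ≤ C) :
    |F (z + v) - F z - fderiv ℝ F z v - (1 / 2) * fderiv ℝ (fderiv ℝ F) z v v| ≤
      C * ‖v‖ ^ 2 := by
  set H := fderiv ℝ (fderiv ℝ F) z
  have hsymm : ∀ u w, H u w = H w u := fun u w =>
    (hF.contDiffAt.isSymmSndFDerivAt (by simp)).eq u w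
  have hF1 : ∀ x, HasFDerivAt F (fderiv ℝ F x) x := fun x =>
    (hF.differentiable (by norm_num) x).hasFDerivAt
  have hF2 : ∀ x, HasFDerivAt (fderiv ℝ F) (fderiv ℝ (fderiv ℝ F) x) x := fun x =>
    ((hF.fderiv_right (m := 1) (by norm_num)).differentiable (by norm_num) x).hasFDerivAt
  have hmem : ∀ x ∈ Metric.closedBall z ‖v‖, ‖x - z‖ ≤ ‖v‖ := fun x hx => by
    simpa [dist_eq_norm] using hx
  have hz : z ∈ Metric.closedBall z ‖v‖ := by simp
  have hzv : z + v ∈ Metric.closedBall z ‖v‖ := by simp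
  have h1 : ∀ x ∈ Metric.closedBall z ‖v‖,
      ‖fderiv ℝ F x - fderiv ℝ F z - H (x - z)‖ ≤ C * ‖v‖ := by
    intro x hx
    have hC0 : 0 ≤ C := (norm_nonneg (fderiv ℝ (fderiv ℝ F) z - H)).trans (hC z (by simp))
    refine ((convex_closedBall z ‖v‖).norm_image_sub_le_of_norm_hasFDerivWithin_le'
      (fun y _ => (hF2 y).hasFDerivWithinAt) (fun y hy => hC y (hmem y hy)) hz hx).trans ?_
    exact mul_le_mul_of_nonneg_left (hmem x hx) hC0
  set u : E → ℝ := fun x => F x - (1 / 2) * H (x - z) (x - z)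
  have hu : ∀ x, HasFDerivAt u (fderiv ℝ F x - H (x - z)) x := by
    intro x
    have hs : HasFDerivAt (fun x : E => x - z) (ContinuousLinearMap.id ℝ E) x :=
      (hasFDerivAt_id x).sub_const z
    have h3 : HasFDerivAt (fun x => H (x - z)) (H.comp (ContinuousLinearMap.id ℝ E)) x :=
      H.hasFDerivAt.comp x hs
    have h4 := (hF1 x).sub ((h3.clm_apply hs).const_mul (1 / 2))
    refine h4.congr_fderiv ?_
    ext w
    have h5 := hsymm w (x - z)
    simp at h5 ⊢
    linarith
  have h2 := (convex_closedBall z ‖v‖).norm_image_sub_le_of_norm_hasFDerivWithin_le'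
    (f := u) (φ := fderiv ℝ F z) (C := C * ‖v‖) (fun y _ => (hu y).hasFDerivWithinAt)
    (fun y hy => by
      have := h1 y hy
      rwa [sub_right_comm] at this) hz hzv
  simp only [u, add_sub_cancel_left, sub_self, map_zero, Real.norm_eq_abs,
    mul_zero, sub_zero] at h2
  calc _ = |F (z + v) - 1 / 2 * H v v - F z - fderiv ℝ F z v| := by congr 1; ring
    _ ≤ _ := h2
    _ = _ := by ring

omit [NormedSpace ℝ E] in
lemma exists_modulus {V : Type*} [NormedAddCommGroup V] {G : E → V} (hG : Continuous G)
    (hGc : HasCompactSupport G) {ε : ℝ} (hε : 0 < ε) :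
    ∃ ρ M : ℝ, 0 < ρ ∧ 0 ≤ M ∧ (∀ x, ‖G x‖ ≤ M) ∧ (∀ x z, ‖G x - G z‖ ≤ M) ∧
      ∀ x z, ‖x - z‖ < ρ → ‖G x - G z‖ ≤ ε := by
  obtain ⟨M, hM⟩ := hG.bounded_above_of_compact_support hGc
  have hM0 : 0 ≤ M := (norm_nonneg (G 0)).trans (hM 0)
  obtain ⟨ρ, hρ, hρε⟩ := Metric.uniformContinuous_iff.1
    (hGc.uniformContinuous_of_continuous hG) ε hε
  refine ⟨ρ, 2 * M, hρ, by positivity, fun x => (hM x).trans (by linarith), fun x z => ?_,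
    fun x z h => ?_⟩
  · exact (norm_sub_le _ _).trans (by linarith [hM x, hM z])
  · rw [← dist_eq_norm] at h ⊢
    exact (hρε h).le

/-- The second derivative of a compactly supported function of class `C²` is bounded and uniformly
continuous. -/
lemma exists_modulus_fderiv_fderiv {F : E → ℝ} (hF : ContDiff ℝ 2 F) (hFc : HasCompactSupport F)
    {ε : ℝ} (hε : 0 < ε) :
    ∃ ρ M : ℝ, 0 < ρ ∧ 0 ≤ M ∧ (∀ x, ‖fderiv ℝ (fderiv ℝ F) x‖ ≤ M) ∧
      (∀ x z, ‖fderiv ℝ (fderiv ℝ F) x - fderiv ℝ (fderiv ℝ F) z‖ ≤ M) ∧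
      ∀ x z, ‖x - z‖ < ρ → ‖fderiv ℝ (fderiv ℝ F) x - fderiv ℝ (fderiv ℝ F) z‖ ≤ ε := by
  have hcont : Continuous (fderiv ℝ (fderiv ℝ F)) :=
    (hF.fderiv_right (m := 1) (by norm_num)).continuous_fderiv (by norm_num)
  have h1 : HasCompactSupport (fderiv ℝ F) := hFc.fderiv ℝ
  have h2 : HasCompactSupport (fderiv ℝ (fderiv ℝ F)) := h1.fderiv ℝ
  have h3 := exists_modulus (V := E →L[ℝ] E →L[ℝ] ℝ) (G := fderiv ℝ (fderiv ℝ F))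
  exact h3 hcont h2 hε

/-- Short steps use the uniform continuity of the second derivative. For steps longer than `ρ` one
has `M ‖v‖ ^ 2 ≤ M / ρ ^ 2 * ‖v‖ ^ 4`, which is harmless because fourth moments of a step are of
order `δ ^ 2`. -/
lemma exists_taylor_bound {F : E → ℝ} (hF : ContDiff ℝ 2 F) (hFc : HasCompactSupport F) {ε : ℝ}
    (hε : 0 < ε) : ∃ C : ℝ, 0 ≤ C ∧ ∀ z v,
      |F (z + v) - F z - fderiv ℝ F z v - (1 / 2) * fderiv ℝ (fderiv ℝ F) z v v| ≤
        ε * ‖v‖ ^ 2 + C * ‖v‖ ^ 4 := by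
  obtain ⟨ρ, M, hρ, hM0, -, hM, hρε⟩ := exists_modulus_fderiv_fderiv hF hFc hε
  refine ⟨M / ρ ^ 2, by positivity, fun z v => ?_⟩
  by_cases hv : ‖v‖ < ρ
  · have h1 : ∀ x, ‖x - z‖ ≤ ‖v‖ →
        ‖fderiv ℝ (fderiv ℝ F) x - fderiv ℝ (fderiv ℝ F) z‖ ≤ ε := fun x hx =>
      hρε x z (hx.trans_lt hv)
    exact (abs_taylor_remainder_le hF z v h1).trans (le_add_of_nonneg_right (by positivity))
  · push Not at hv
    have h0 : ∀ x, ‖x - z‖ ≤ ‖v‖ →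
        ‖fderiv ℝ (fderiv ℝ F) x - fderiv ℝ (fderiv ℝ F) z‖ ≤ M := fun x _ => hM x z
    refine (abs_taylor_remainder_le hF z v h0).trans ?_
    have h1 : M * ‖v‖ ^ 2 ≤ M / ρ ^ 2 * ‖v‖ ^ 4 := by
      rw [div_mul_eq_mul_div, le_div_iff₀ (by positivity)]
      have : ρ ^ 2 ≤ ‖v‖ ^ 2 := by gcongr
      calc _ ≤ M * ‖v‖ ^ 2 * ‖v‖ ^ 2 := by gcongr
        _ = _ := by ring
    have : 0 ≤ ε * ‖v‖ ^ 2 := by positivity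
    linarith

/-- The mean of a function over a Gaussian step, up to an error of smaller order than the variance
of the step. -/
lemma exists_abs_integral_gaussianVec_sub_le (r : ℕ) {F : E → ℝ} (hF : ContDiff ℝ 2 F)
    (hFc : HasCompactSupport F) {C : ℝ} (hC : 0 ≤ C) {η : ℝ} (hη : 0 < η) :
    ∃ δ₀ : ℝ≥0, 0 < δ₀ ∧ ∀ δ : ℝ≥0, δ ≤ δ₀ → ∀ (z a : E) (β : Fin r → E), ‖a‖ ≤ C →
      (∀ k, ‖β k‖ ≤ C) →
      |∫ w, (F (z + ((δ : ℝ) • a + ∑ k, w k • β k)) - F z) ∂gaussianVec r δ -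
        δ * (fderiv ℝ F z a + (1 / 2) * ∑ k, fderiv ℝ (fderiv ℝ F) z (β k) (β k))| ≤ η * δ := by
  obtain ⟨κ, hκ, hmom⟩ := gaussianVec.exists_moment_bound E r C
  obtain ⟨-, M, -, hM0, hM, -⟩ := exists_modulus_fderiv_fderiv hF hFc one_pos
  -- With this tolerance the second moment, at most `κ δ`, costs at most half of `η δ`. The choice
  -- of `δ₀` below gives the other half to the terms of order `δ ^ 2`: the fourth moment and the
  -- drift term `H a a`.
  obtain ⟨C', hC', htay⟩ := exists_taylor_bound hF hFc (ε := η / (2 * (κ + 1))) (by positivity)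
  set δ₀ : ℝ := min 1 (η / (2 * (C' * κ + M * C ^ 2 + 1)))
  have hδ₀ : 0 < δ₀ := by positivity
  refine ⟨⟨δ₀, hδ₀.le⟩, hδ₀, fun δ hδ z a β ha hβ => ?_⟩
  have hδ' : (δ : ℝ) ≤ δ₀ := hδ
  have hδ1 : δ ≤ 1 := by
    have : (δ : ℝ) ≤ 1 := hδ'.trans (min_le_left _ _)
    exact_mod_cast this
  have hδ2 : (δ : ℝ) ≤ η / (2 * (C' * κ + M * C ^ 2 + 1)) := hδ'.trans (min_le_right _ _)
  obtain ⟨⟨hi2, hm2⟩, hi4, hm4⟩ := hmom δ hδ1 a β ha hβ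
  set ν := gaussianVec r δ
  set v : (Fin r → ℝ) → E := fun w => (δ : ℝ) • a + ∑ k, w k • β k with hv
  set D := fderiv ℝ F z
  set H := fderiv ℝ (fderiv ℝ F) z
  have hvc : Continuous v := by fun_prop
  obtain ⟨MF, hMF⟩ := hF.continuous.bounded_above_of_compact_support hFc
  have hiF : Integrable (fun w => F (z + v w) - F z) ν := by
    refine Integrable.of_bound (C := 2 * MF) ?_ (ae_of_all _ fun w => ?_)
    · exact ((hF.continuous.comp (continuous_const.add hvc)).sub
        continuous_const).aestronglyMeasurable
    · exact (norm_sub_le _ _).trans (by linarith [hMF (z + v w), hMF z])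
  have hDv : ∀ w, D (v w) = δ * D a + ∑ k, w k * D (β k) := fun w => by
    simp [hv, map_sum]
  have hHv : ∀ w, H (v w) (v w) = δ ^ 2 * H a a + ∑ k, w k * (δ * (H a (β k) + H (β k) a)) +
      ∑ j, ∑ k, w j * w k * H (β j) (β k) := fun w => by
    simp only [hv, map_add, map_smul, map_sum, add_apply,
      smul_apply, sum_apply, smul_eq_mul]
    simp only [mul_add, Finset.mul_sum, Finset.sum_add_distrib]
    have e1 : ∀ j k : Fin r, w j * (w k * H (β k) (β j)) = w k * w j * H (β k) (β j) :=
      fun j k => by ring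
    have e2 : ∀ k : Fin r, (δ : ℝ) * (w k * H (β k) a) = w k * (δ * H (β k) a) := fun k => by ring
    have e3 : ∀ k : Fin r, w k * ((δ : ℝ) * H a (β k)) = w k * (δ * H a (β k)) := fun k => by ring
    simp only [e1, e2]
    rw [Finset.sum_comm (f := fun j k => w k * w j * H (β k) (β j))]
    ring
  have hiD1 : Integrable (fun w : Fin r → ℝ => ∑ k, w k * D (β k)) ν :=
    integrable_finsetSum _ fun k _ => (gaussianVec.integrable_eval k).mul_const _
  have hiD : Integrable (fun w => D (v w)) ν := by
    simp only [hDv]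
    exact (integrable_const _).add hiD1
  have hIntD : ∫ w, D (v w) ∂ν = δ * D a := by
    simp only [hDv]
    rw [integral_add (integrable_const _) hiD1, integral_finsetSum _ fun k _ =>
      (gaussianVec.integrable_eval k).mul_const _]
    simp [integral_mul_const, ν, gaussianVec.integral_eval]
  have hiH1 : Integrable (fun w : Fin r → ℝ => ∑ k, w k * (δ * (H a (β k) + H (β k) a))) ν :=
    integrable_finsetSum _ fun k _ => (gaussianVec.integrable_eval k).mul_const _
  have hiH3 : ∀ j : Fin r, Integrable (fun w : Fin r → ℝ => ∑ k, w j * w k * H (β j) (β k)) ν :=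
    fun j => integrable_finsetSum _ fun k _ => (gaussianVec.integrable_mul j k).mul_const _
  have hiH2 : Integrable (fun w : Fin r → ℝ => ∑ j, ∑ k, w j * w k * H (β j) (β k)) ν :=
    integrable_finsetSum _ fun j _ => hiH3 j
  have hiH : Integrable (fun w => H (v w) (v w)) ν := by
    simp only [hHv]
    exact ((integrable_const _).add hiH1).add hiH2
  -- Terms linear in the noise are centered and distinct coordinates are uncorrelated, so only the
  -- diagonal survives.
  have hIntH : ∫ w, H (v w) (v w) ∂ν = δ ^ 2 * H a a + δ * ∑ k, H (β k) (β k) := by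
    simp only [hHv]
    have hi0 : Integrable (fun w : Fin r → ℝ => (δ : ℝ) ^ 2 * H a a +
        ∑ k, w k * (δ * (H a (β k) + H (β k) a))) ν := (integrable_const _).add hiH1
    rw [integral_add hi0 hiH2, integral_add (integrable_const _) hiH1,
      integral_finsetSum _ fun k _ => (gaussianVec.integrable_eval k).mul_const _,
      integral_finsetSum _ fun j _ => hiH3 j]
    have : ∀ j, ∫ w : Fin r → ℝ, ∑ k, w j * w k * H (β j) (β k) ∂ν = δ * H (β j) (β j) := by
      intro j
      rw [integral_finsetSum _ fun k _ => (gaussianVec.integrable_mul j k).mul_const _]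
      simp [integral_mul_const, gaussianVec.integral_mul]
    simp [this, integral_mul_const, ν, gaussianVec.integral_eval, Finset.mul_sum]
  have hrem : |∫ w, (F (z + v w) - F z - D (v w) - (1 / 2) * H (v w) (v w)) ∂ν| ≤
      η / (2 * (κ + 1)) * (κ * δ) + C' * (κ * δ ^ 2) := by
    calc _ ≤ ∫ w, |F (z + v w) - F z - D (v w) - (1 / 2) * H (v w) (v w)| ∂ν :=
          abs_integral_le_integral_abs
      _ ≤ ∫ w, (η / (2 * (κ + 1)) * ‖v w‖ ^ 2 + C' * ‖v w‖ ^ 4) ∂ν :=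
          integral_mono (((hiF.sub hiD).sub (hiH.const_mul _)).abs)
            ((hi2.const_mul _).add (hi4.const_mul _)) fun w => htay z (v w)
      _ = η / (2 * (κ + 1)) * ∫ w, ‖v w‖ ^ 2 ∂ν + C' * ∫ w, ‖v w‖ ^ 4 ∂ν := by
          rw [integral_add (hi2.const_mul _) (hi4.const_mul _), integral_const_mul,
            integral_const_mul]
      _ ≤ _ := by gcongr
  have hsplit : ∫ w, (F (z + v w) - F z - D (v w) - (1 / 2) * H (v w) (v w)) ∂ν =
      ∫ w, (F (z + v w) - F z) ∂ν - δ * D a -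
        (1 / 2) * (δ ^ 2 * H a a + δ * ∑ k, H (β k) (β k)) := by
    have hi0 : Integrable (fun w => F (z + v w) - F z - D (v w)) ν := hiF.sub hiD
    rw [integral_sub hi0 (hiH.const_mul _), integral_sub hiF hiD, integral_const_mul,
      hIntD, hIntH]
  have hHa : |H a a| ≤ M * C ^ 2 := by
    calc |H a a| ≤ ‖H‖ * ‖a‖ * ‖a‖ := H.le_opNorm₂ a a
      _ ≤ M * C * C := by gcongr; exact hM z
      _ = _ := by ring
  have hfin : ∫ w, (F (z + v w) - F z) ∂ν - δ * (D a + (1 / 2) * ∑ k, H (β k) (β k)) =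
      ∫ w, (F (z + v w) - F z - D (v w) - (1 / 2) * H (v w) (v w)) ∂ν +
        (1 / 2) * δ ^ 2 * H a a := by
    rw [hsplit]; ring
  rw [hfin]
  have hδ0 : (0 : ℝ) ≤ δ := δ.coe_nonneg
  have h5 : |(1 / 2) * (δ : ℝ) ^ 2 * H a a| ≤ δ ^ 2 * (M * C ^ 2) := by
    rw [abs_mul, abs_of_nonneg (by positivity)]
    have : 0 ≤ (δ : ℝ) ^ 2 * (M * C ^ 2) := by positivity
    calc _ ≤ (1 / 2) * (δ : ℝ) ^ 2 * (M * C ^ 2) := by gcongr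
      _ ≤ _ := by linarith
  have h6 : η / (2 * (κ + 1)) * (κ * δ) ≤ η / 2 * δ := by
    have : η / (2 * (κ + 1)) * κ ≤ η / 2 := by
      rw [div_mul_eq_mul_div, div_le_div_iff₀ (by positivity) (by positivity)]
      nlinarith
    calc _ = η / (2 * (κ + 1)) * κ * δ := by ring
      _ ≤ _ := by gcongr
  have h7 : C' * (κ * δ ^ 2) + δ ^ 2 * (M * C ^ 2) ≤ η / 2 * δ := by
    have h8 : (C' * κ + M * C ^ 2) * δ ≤ η / 2 := by
      rw [le_div_iff₀ (by positivity)] at hδ2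
      nlinarith
    calc _ = (C' * κ + M * C ^ 2) * δ * δ := by ring
      _ ≤ _ := by gcongr
  calc _ ≤ _ := abs_add_le _ _
    _ ≤ _ := add_le_add hrem h5
    _ ≤ η * δ := by linarith

end Taylor


/-! ## Generators and localized certificates -/

lemma exists_uniform_bound {ι X V : Type*} [Finite ι] [TopologicalSpace X] [NormedAddCommGroup V]
    {K : Set X} (hK : IsCompact K) (h : ι → X → V) (hh : ∀ i, Continuous (h i)) :
    ∃ C : ℝ, 0 ≤ C ∧ ∀ i, ∀ x ∈ K, ‖h i x‖ ≤ C := by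
  cases nonempty_fintype ι
  choose C hC using fun i => hK.exists_bound_of_continuousOn (hh i).continuousOn
  refine ⟨∑ i, |C i|, Finset.sum_nonneg fun i _ => abs_nonneg _, fun i x hx => ?_⟩
  exact (hC i x hx).trans ((le_abs_self _).trans
    (Finset.single_le_sum (f := fun i => |C i|) (fun j _ => abs_nonneg _) (Finset.mem_univ i)))

lemma exists_uniform_bound_of_finite {ι X : Type*} [Finite ι] (h : ι → X → ℝ)
    (hh : ∀ i, ∃ C, ∀ x, h i x ≤ C) : ∃ C : ℝ, 0 ≤ C ∧ ∀ i x, h i x ≤ C := by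
  cases nonempty_fintype ι
  choose C hC using hh
  refine ⟨∑ i, |C i|, Finset.sum_nonneg fun i _ => abs_nonneg _, fun i x => ?_⟩
  exact (hC i x).trans ((le_abs_self _).trans
    (Finset.single_le_sum (f := fun i => |C i|) (fun j _ => abs_nonneg _) (Finset.mem_univ i)))

namespace SwitchedSystem

variable {n r l : ℕ} (S : SwitchedSystem n r l)

/-- The columns of the diffusion matrix. -/
def col (m : Fin l) (x : EuclideanSpace ℝ (Fin n)) (k : Fin r) : EuclideanSpace ℝ (Fin n) :=
  WithLp.toLp 2 fun i => S.g m x i k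

lemma toLp_mulVec (m : Fin l) (x : EuclideanSpace ℝ (Fin n)) (w : Fin r → ℝ) :
    WithLp.toLp 2 ((S.g m x).mulVec w) = ∑ k, w k • S.col m x k := by
  ext i
  simp [Matrix.mulVec, dotProduct, col, mul_comm]

lemma continuous_f (m : Fin l) : Continuous (S.f m) := (S.lipschitz_f m).continuous

lemma continuous_col (m : Fin l) (k : Fin r) : Continuous fun x => S.col m x k := by
  refine (PiLp.continuous_toLp 2 _).comp (continuous_pi fun i => ?_)
  exact (S.lipschitz_g m i k).continuous

/-- The trace of `gᵀ H g` is the sum of the Hessian evaluated on the columns of `g`, the form in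
which the Gaussian expansion produces it. -/
lemma generator_eq (B : EuclideanSpace ℝ (Fin n) → ℝ) (m : Fin l)
    (x : EuclideanSpace ℝ (Fin n)) :
    S.generator B m x = fderiv ℝ B x (S.f m x) +
      (1 / 2) * ∑ k, fderiv ℝ (fderiv ℝ B) x (S.col m x k) (S.col m x k) := by
  have hcol : ∀ k, S.col m x k = ∑ i, S.g m x i k • EuclideanSpace.single i (1 : ℝ) := by
    intro k
    ext i
    simp [col, Finset.sum_apply, Pi.single_apply]
  unfold generator
  congr 2
  simp only [Matrix.trace, Matrix.diag_apply, Matrix.mul_apply, Matrix.transpose_apply,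
    hessianMatrix, Matrix.of_apply]
  refine Finset.sum_congr rfl fun k _ => ?_
  rw [hcol k]
  simp only [map_sum, map_smul, sum_apply, smul_apply, smul_eq_mul]
  exact Finset.sum_congr rfl fun i _ => mul_comm _ _

/-- The generator with the coefficients evaluated at `x` and the functions evaluated at `z`. -/
def mixedGenerator (Λ : Fin l → Fin l → EuclideanSpace ℝ (Fin n) → ℝ)
    (B : Fin l → EuclideanSpace ℝ (Fin n) → ℝ) (m : Fin l) (x z : EuclideanSpace ℝ (Fin n)) : ℝ :=
  fderiv ℝ (B m) z (S.f m x) +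
    (1 / 2) * ∑ k, fderiv ℝ (fderiv ℝ (B m)) z (S.col m x k) (S.col m x k) +
    ∑ m', Λ m m' x * B m' z

lemma exists_coeff_bound (Λ : Fin l → Fin l → EuclideanSpace ℝ (Fin n) → ℝ)
    (hΛ : ∀ m m', Continuous (Λ m m')) (R : ℝ) :
    ∃ C : ℝ, 0 ≤ C ∧ ∀ x, ‖x‖ ≤ R → (∀ m, ‖S.f m x‖ ≤ C) ∧ (∀ m k, ‖S.col m x k‖ ≤ C) ∧
      ∀ m m', |Λ m m' x| ≤ C := by
  have hK : IsCompact (Metric.closedBall (0 : EuclideanSpace ℝ (Fin n)) R) :=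
    isCompact_closedBall 0 R
  obtain ⟨C₁, h1, hC₁⟩ := exists_uniform_bound hK S.f S.continuous_f
  obtain ⟨C₂, h2, hC₂⟩ := exists_uniform_bound hK (fun (i : Fin l × Fin r) x => S.col i.1 x i.2)
    fun i => S.continuous_col i.1 i.2
  obtain ⟨C₃, h3, hC₃⟩ := exists_uniform_bound hK (fun (i : Fin l × Fin l) x => Λ i.1 i.2 x)
    fun i => hΛ i.1 i.2
  refine ⟨C₁ + C₂ + C₃, by positivity, fun x hx => ?_⟩
  have hx' : x ∈ Metric.closedBall (0 : EuclideanSpace ℝ (Fin n)) R := by simpa using hx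
  exact ⟨fun m => (hC₁ m x hx').trans (by linarith),
    fun m k => (hC₂ (m, k) x hx').trans (by linarith),
    fun m m' => (hC₃ (m, m') x hx').trans (by linarith)⟩

lemma continuous_mixedGenerator {Λ : Fin l → Fin l → EuclideanSpace ℝ (Fin n) → ℝ}
    (hΛ : ∀ m m', Continuous (Λ m m')) {B : Fin l → EuclideanSpace ℝ (Fin n) → ℝ}
    (hB : ∀ m, ContDiff ℝ 2 (B m)) (m : Fin l) :
    Continuous fun y : EuclideanSpace ℝ (Fin n) × EuclideanSpace ℝ (Fin n) =>
      S.mixedGenerator Λ B m y.1 y.2 := by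
  have h1 : Continuous (fderiv ℝ (B m)) := (hB m).continuous_fderiv (by norm_num)
  have h2 : Continuous (fderiv ℝ (fderiv ℝ (B m))) :=
    ((hB m).fderiv_right (m := 1) (by norm_num)).continuous_fderiv (by norm_num)
  unfold mixedGenerator
  refine (Continuous.add ?_ (continuous_const.mul (continuous_finsetSum _ fun k _ => ?_))).add
    (continuous_finsetSum _ fun m' _ => ?_)
  · exact (h1.comp continuous_snd).clm_apply ((S.continuous_f m).comp continuous_fst)
  · have h3 := (S.continuous_col m k).comp
      (continuous_fst (X := EuclideanSpace ℝ (Fin n)) (Y := EuclideanSpace ℝ (Fin n)))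
    exact ((h2.comp continuous_snd).clm_apply h3).clm_apply h3
  · exact ((hΛ m m').comp continuous_fst).mul ((hB m').continuous.comp continuous_snd)

/-- The bound holds for every `z`: outside the union of the supports, the functions and their
derivatives all vanish, and on it `(x, z)` ranges over a compact set. -/
lemma exists_mixedGenerator_bound {Λ : Fin l → Fin l → EuclideanSpace ℝ (Fin n) → ℝ}
    (hΛ : ∀ m m', Continuous (Λ m m')) {B : Fin l → EuclideanSpace ℝ (Fin n) → ℝ}
    (hB : ∀ m, ContDiff ℝ 2 (B m)) (hBc : ∀ m, HasCompactSupport (B m)) (R : ℝ) :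
    ∃ C : ℝ, 0 ≤ C ∧ ∀ m x z, ‖x‖ ≤ R → |S.mixedGenerator Λ B m x z| ≤ C := by
  have hK : IsCompact (Metric.closedBall (0 : EuclideanSpace ℝ (Fin n)) R ×ˢ
      ⋃ m, tsupport (B m)) :=
    (isCompact_closedBall 0 R).prod (isCompact_iUnion fun m => hBc m)
  obtain ⟨C, hC0, hC⟩ := exists_uniform_bound hK
    (fun m (y : EuclideanSpace ℝ (Fin n) × EuclideanSpace ℝ (Fin n)) =>
      S.mixedGenerator Λ B m y.1 y.2) (S.continuous_mixedGenerator hΛ hB)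
  refine ⟨C, hC0, fun m x z hx => ?_⟩
  by_cases hz : z ∈ ⋃ m, tsupport (B m)
  · exact hC m (x, z) ⟨by simpa using hx, hz⟩
  · simp only [Set.mem_iUnion, not_exists] at hz
    have h0 : ∀ m', B m' z = 0 := fun m' => image_eq_zero_of_notMem_tsupport (hz m')
    have h1 : fderiv ℝ (B m) z = 0 := by
      by_contra h
      exact hz m (support_fderiv_subset ℝ h)
    have h2 : fderiv ℝ (fderiv ℝ (B m)) z = 0 := by
      by_contra h
      exact hz m (tsupport_fderiv_subset ℝ (support_fderiv_subset ℝ h))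
    simpa [mixedGenerator, h0, h1, h2] using hC0

/-- Uniform continuity on a compact product; the second radius `R + 1` leaves room for points `z`
within distance `1` of `x`. -/
lemma exists_mixedGenerator_modulus {Λ : Fin l → Fin l → EuclideanSpace ℝ (Fin n) → ℝ}
    (hΛ : ∀ m m', Continuous (Λ m m')) {B : Fin l → EuclideanSpace ℝ (Fin n) → ℝ}
    (hB : ∀ m, ContDiff ℝ 2 (B m)) (R : ℝ) {ε : ℝ} (hε : 0 < ε) :
    ∃ ρ : ℝ, 0 < ρ ∧ ∀ m x z, ‖x‖ ≤ R → ‖z - x‖ < ρ →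
      S.mixedGenerator Λ B m x z ≤ S.mixedGenerator Λ B m x x + ε := by
  have hK : IsCompact (Metric.closedBall (0 : EuclideanSpace ℝ (Fin n)) R ×ˢ
      Metric.closedBall (0 : EuclideanSpace ℝ (Fin n)) (R + 1)) :=
    (isCompact_closedBall 0 R).prod (isCompact_closedBall 0 (R + 1))
  have huc := fun m => Metric.uniformContinuousOn_iff.1
    (hK.uniformContinuousOn_of_continuous (S.continuous_mixedGenerator hΛ hB m).continuousOn) ε hε
  choose ρ hρ huc using huc
  obtain ⟨ρ', hρ', hle⟩ : ∃ ρ' > 0, ∀ m, ρ' ≤ ρ m := by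
    rcases isEmpty_or_nonempty (Fin l) with h | h
    · exact ⟨1, one_pos, fun m => h.elim m⟩
    · obtain ⟨m₀, hm₀⟩ := Finite.exists_min ρ
      exact ⟨ρ m₀, hρ m₀, hm₀⟩
  refine ⟨min 1 ρ', by positivity, fun m x z hx hzx => ?_⟩
  have h1 : ‖z‖ ≤ R + 1 := by
    have : ‖z - x‖ < 1 := hzx.trans_le (min_le_left _ _)
    calc ‖z‖ = ‖x + (z - x)‖ := by congr 1; abel
      _ ≤ ‖x‖ + ‖z - x‖ := norm_add_le _ _
      _ ≤ _ := by linarith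
  have h2 := huc m (x, z) ⟨by simpa using hx, by simpa using h1⟩ (x, x)
    ⟨by simpa using hx, by simpa using by linarith⟩ (by
      rw [Prod.dist_eq]
      simp only [dist_self, dist_eq_norm]
      rw [max_eq_right (norm_nonneg _)]
      exact hzx.trans_le ((min_le_right _ _).trans (hle m)))
  rw [Real.dist_eq] at h2
  linarith [le_abs_self (S.mixedGenerator Λ B m x z - S.mixedGenerator Λ B m x x)]

end SwitchedSystem

/-! ### Cutting certificates off outside a ball -/

namespace BarrierCert

variable {n r l : ℕ}

/-- A smooth function that is `1` on the ball of radius `R + 1` and has compact support. -/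
def cutoffBump (n : ℕ) (R : ℝ≥0) : ContDiffBump (0 : EuclideanSpace ℝ (Fin n)) where
  rIn := R + 1
  rOut := R + 2
  rIn_pos := by positivity
  rIn_lt_rOut := by linarith

/-- The functions of a certificate, multiplied by a cutoff function. -/
def localized (C : BarrierCert n l) (R : ℝ≥0) (m : Fin l) (x : EuclideanSpace ℝ (Fin n)) : ℝ :=
  cutoffBump n R x * C.B m x

variable {S : SwitchedSystem n r l} {Λ : Fin l → Fin l → EuclideanSpace ℝ (Fin n) → ℝ}
  {C : BarrierCert n l} {R : ℝ≥0}

lemma Valid.contDiff_localized (hC : C.Valid S Λ) (R : ℝ≥0) (m : Fin l) :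
    ContDiff ℝ 2 (C.localized R m) :=
  (cutoffBump n R).contDiff.mul (hC.contDiff m)

lemma hasCompactSupport_localized (C : BarrierCert n l) (R : ℝ≥0) (m : Fin l) :
    HasCompactSupport (C.localized R m) :=
  (cutoffBump n R).hasCompactSupport.mul_right

lemma Valid.localized_nonneg (hC : C.Valid S Λ) (m : Fin l) (x : EuclideanSpace ℝ (Fin n)) :
    0 ≤ C.localized R m x :=
  mul_nonneg (cutoffBump n R).nonneg (hC.nonneg m x)

/-- The cutoff is `1` up to radius `R + 1`, so there is agreement on a neighbourhood of each point
of the ball of radius `R`. Derivatives then agree too, and the generator inequality is inherited. -/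
lemma localized_eventuallyEq (m : Fin l) {x : EuclideanSpace ℝ (Fin n)} (hx : ‖x‖ ≤ R) :
    C.localized R m =ᶠ[𝓝 x] C.B m := by
  have h : Metric.ball (0 : EuclideanSpace ℝ (Fin n)) (R + 1) ∈ 𝓝 x :=
    Metric.isOpen_ball.mem_nhds (by simpa using hx.trans_lt (by linarith))
  filter_upwards [h] with y hy
  have : cutoffBump n R y = 1 :=
    (cutoffBump n R).one_of_mem_closedBall (Metric.ball_subset_closedBall hy)
  simp [localized, this]

lemma localized_eq (m : Fin l) {x : EuclideanSpace ℝ (Fin n)} (hx : ‖x‖ ≤ R) :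
    C.localized R m x = C.B m x := (localized_eventuallyEq m hx).eq_of_nhds

lemma Valid.mixedGenerator_localized_le (hC : C.Valid S Λ) (m : Fin l)
    {x : EuclideanSpace ℝ (Fin n)} (hx : ‖x‖ ≤ R) :
    S.mixedGenerator Λ (C.localized R) m x x ≤ C.c := by
  have h := hC.generator_le m x
  rw [S.generator_eq] at h
  have h1 := localized_eventuallyEq (C := C) m hx
  have h2 : fderiv ℝ (C.localized R m) =ᶠ[𝓝 x] fderiv ℝ (C.B m) := h1.fderiv
  simpa only [SwitchedSystem.mixedGenerator, h1.fderiv_eq, h2.fderiv_eq, localized_eq _ hx] using h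

end BarrierCert


/-! ## One step of a process with conditionally Gaussian increments -/

/-- By independence the joint law of `θ` and `Y` is a product, so Fubini allows integration over `Y`
with `θ` frozen. The function `G` dominates the inner integrals and supplies integrability. -/
lemma integral_comp_indepFun {Ω Θ Y' : Type*} [MeasurableSpace Ω] [MeasurableSpace Θ]
    [MeasurableSpace Y'] {P : Measure Ω} [IsProbabilityMeasure P] {θ : Ω → Θ} {Y : Ω → Y'}
    (h : IndepFun θ Y P) (hθ : Measurable θ) (hY : Measurable Y) {ν : Measure Y'}
    [IsProbabilityMeasure ν] (hν : P.map Y = ν)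
    {ψ : Θ × Y' → ℝ} (hψ : Measurable ψ) (hint : ∀ ω, Integrable (fun w => ψ (θ ω, w)) ν)
    {G : Ω → ℝ} (hG : Integrable G P) (hGb : ∀ ω, ∫ w, |ψ (θ ω, w)| ∂ν ≤ G ω) :
    Integrable (fun ω => ψ (θ ω, Y ω)) P ∧ Integrable (fun ω => ∫ w, ψ (θ ω, w) ∂ν) P ∧
      ∫ ω, ψ (θ ω, Y ω) ∂P = ∫ ω, ∫ w, ψ (θ ω, w) ∂ν ∂P := by
  have hmap : P.map (fun ω => (θ ω, Y ω)) = (P.prod ν).map (Prod.map θ id) := by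
    rw [(indepFun_iff_map_prod_eq_prod_map_map hθ.aemeasurable hY.aemeasurable).1 h, hν,
      ← Measure.map_prod_map _ _ hθ measurable_id, Measure.map_id]
  have hm2 : Measurable (Prod.map θ (id : Y' → Y')) := hθ.prodMap measurable_id
  have hi2 : Integrable (fun y : Ω × Y' => ψ (θ y.1, y.2)) (P.prod ν) := by
    have hm : AEStronglyMeasurable (fun y : Ω × Y' => ψ (θ y.1, y.2)) (P.prod ν) :=
      (hψ.comp hm2).aestronglyMeasurable
    rw [integrable_prod_iff hm]
    refine ⟨ae_of_all _ hint, hG.mono' hm.norm.integral_prod_right' (ae_of_all _ fun ω => ?_)⟩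
    rw [Real.norm_of_nonneg (integral_nonneg fun w => norm_nonneg _)]
    exact hGb ω
  refine ⟨?_, hi2.integral_prod_left, ?_⟩
  · have h1 : Integrable ψ (P.map fun ω => (θ ω, Y ω)) := by
      rw [hmap, integrable_map_measure hψ.aestronglyMeasurable hm2.aemeasurable]
      exact hi2
    exact h1.comp_measurable (hθ.prodMk hY)
  · rw [← integral_prod _ hi2, ← integral_map (f := ψ) (hθ.prodMk hY).aemeasurable
      hψ.aestronglyMeasurable, hmap, integral_map hm2.aemeasurable hψ.aestronglyMeasurable]
    rfl

/-- A Gaussian step that starts from an orthogonal configuration in mean square. -/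
lemma integral_norm_add_step_sq_le {E : Type*} [NormedAddCommGroup E] [InnerProductSpace ℝ E]
    {r : ℕ} {δ : ℝ≥0} {C κ : ℝ} (x a : E) (β : Fin r → E) (ha : ‖a‖ ≤ C)
    (hi : Integrable (fun w => ‖(δ : ℝ) • a + ∑ k, w k • β k‖ ^ 2) (gaussianVec r δ))
    (hκ : ∫ w, ‖(δ : ℝ) • a + ∑ k, w k • β k‖ ^ 2 ∂gaussianVec r δ ≤ κ * δ) :
    Integrable (fun w => ‖x + ((δ : ℝ) • a + ∑ k, w k • β k)‖ ^ 2) (gaussianVec r δ) ∧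
      ∫ w, ‖x + ((δ : ℝ) • a + ∑ k, w k • β k)‖ ^ 2 ∂gaussianVec r δ ≤
        (1 + δ) * ‖x‖ ^ 2 + (C ^ 2 + κ) * δ := by
  have hexp : ∀ w : Fin r → ℝ, ‖x + ((δ : ℝ) • a + ∑ k, w k • β k)‖ ^ 2 =
      (‖x‖ ^ 2 + 2 * (δ * inner ℝ x a)) + ∑ k, w k * (2 * inner ℝ x (β k)) +
        ‖(δ : ℝ) • a + ∑ k, w k • β k‖ ^ 2 := by
    intro w
    rw [norm_add_sq_real, inner_add_right, inner_smul_right, inner_sum]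
    simp only [inner_smul_right, mul_add, Finset.mul_sum]
    have : ∀ k, 2 * (w k * inner ℝ x (β k)) = w k * (2 * inner ℝ x (β k)) := fun k => by ring
    simp only [this]
    ring
  have hi1 : Integrable (fun w : Fin r → ℝ => ∑ k, w k * (2 * inner ℝ x (β k)))
      (gaussianVec r δ) :=
    integrable_finsetSum _ fun k _ => (gaussianVec.integrable_eval k).mul_const _
  have hi2 : Integrable (fun w : Fin r → ℝ => (‖x‖ ^ 2 + 2 * (δ * inner ℝ x a)) +
      ∑ k, w k * (2 * inner ℝ x (β k))) (gaussianVec r δ) := (integrable_const _).add hi1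
  simp only [hexp]
  refine ⟨hi2.add hi, ?_⟩
  rw [integral_add hi2 hi, integral_add (integrable_const _) hi1, integral_finsetSum _ fun k _ =>
    (gaussianVec.integrable_eval k).mul_const _]
  simp only [integral_mul_const, gaussianVec.integral_eval, zero_mul, Finset.sum_const_zero,
    integral_const, probReal_univ, one_smul, add_zero]
  have h1 : inner ℝ x a ≤ ‖x‖ * ‖a‖ := real_inner_le_norm x a
  have h2 : 2 * inner ℝ x a ≤ ‖x‖ ^ 2 + C ^ 2 := by
    have : ‖a‖ ^ 2 ≤ C ^ 2 := by gcongr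
    nlinarith [sq_nonneg (‖x‖ - ‖a‖)]
  have h3 : 2 * (δ * inner ℝ x a) ≤ δ * (‖x‖ ^ 2 + C ^ 2) := by
    calc 2 * (δ * inner ℝ x a) = δ * (2 * inner ℝ x a) := by ring
      _ ≤ _ := mul_le_mul_of_nonneg_left h2 δ.coe_nonneg
  linarith

section Step

variable {n r l : ℕ} {Ω : Type*} {m : MeasurableSpace Ω} [mΩ : MeasurableSpace Ω] {P : Measure Ω}
  [IsProbabilityMeasure P] {Y : Ω → Fin r → ℝ} {δ : ℝ≥0} {C κ : ℝ}
  {X a : Ω → EuclideanSpace ℝ (Fin n)} {β : Ω → Fin r → EuclideanSpace ℝ (Fin n)}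

lemma integrable_norm_step_pow_four (hY : Measurable Y) (hm : m ≤ mΩ)
    (hind : Indep (MeasurableSpace.comap Y inferInstance) m P)
    (hYlaw : P.map Y = gaussianVec r δ) (ha : Measurable[m] a) (hβ : Measurable[m] β)
    (haC : ∀ ω, ‖a ω‖ ≤ C) (hβC : ∀ ω k, ‖β ω k‖ ≤ C)
    (hmom : ∀ (a : EuclideanSpace ℝ (Fin n)) (β : Fin r → EuclideanSpace ℝ (Fin n)), ‖a‖ ≤ C →
      (∀ k, ‖β k‖ ≤ C) →
      Integrable (fun w => ‖(δ : ℝ) • a + ∑ k, w k • β k‖ ^ 4) (gaussianVec r δ) ∧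
        ∫ w, ‖(δ : ℝ) • a + ∑ k, w k • β k‖ ^ 4 ∂gaussianVec r δ ≤ κ * δ ^ 2) :
    Integrable (fun ω => ‖(δ : ℝ) • a ω + ∑ k, Y ω k • β ω k‖ ^ 4) P ∧
      ∫ ω, ‖(δ : ℝ) • a ω + ∑ k, Y ω k • β ω k‖ ^ 4 ∂P ≤ κ * δ ^ 2 := by
  set θ : Ω → EuclideanSpace ℝ (Fin n) × (Fin r → EuclideanSpace ℝ (Fin n)) := fun ω => (a ω, β ω)
  have hθ : Measurable[m] θ := ha.prodMk hβ
  have hindep : IndepFun θ Y P :=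
    (indep_of_indep_of_le_right hind (measurable_iff_comap_le.1 hθ)).symm
  obtain ⟨h1, h2, h3⟩ := integral_comp_indepFun hindep (hθ.mono hm le_rfl) hY hYlaw
    (ψ := fun y => ‖(δ : ℝ) • y.1.1 + ∑ k, y.2 k • y.1.2 k‖ ^ 4) (by fun_prop)
    (fun ω => (hmom _ _ (haC ω) (hβC ω)).1) (G := fun _ => κ * δ ^ 2) (integrable_const _)
    (fun ω => by
      simp only [abs_of_nonneg (pow_nonneg (norm_nonneg _) 4)]
      exact (hmom _ _ (haC ω) (hβC ω)).2)
  refine ⟨h1, h3.le.trans ?_⟩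
  calc _ ≤ ∫ _, κ * (δ : ℝ) ^ 2 ∂P :=
        integral_mono h2 (integrable_const _) fun ω => (hmom _ _ (haC ω) (hβC ω)).2
    _ = _ := by simp

lemma integrable_norm_add_step_sq (hY : Measurable Y) (hm : m ≤ mΩ)
    (hind : Indep (MeasurableSpace.comap Y inferInstance) m P)
    (hYlaw : P.map Y = gaussianVec r δ) (ha : Measurable[m] a) (hβ : Measurable[m] β)
    (haC : ∀ ω, ‖a ω‖ ≤ C) (hβC : ∀ ω k, ‖β ω k‖ ≤ C)
    (hmom : ∀ (a : EuclideanSpace ℝ (Fin n)) (β : Fin r → EuclideanSpace ℝ (Fin n)), ‖a‖ ≤ C →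
      (∀ k, ‖β k‖ ≤ C) →
      Integrable (fun w => ‖(δ : ℝ) • a + ∑ k, w k • β k‖ ^ 2) (gaussianVec r δ) ∧
        ∫ w, ‖(δ : ℝ) • a + ∑ k, w k • β k‖ ^ 2 ∂gaussianVec r δ ≤ κ * δ)
    (hX : Measurable[m] X) (hXi : Integrable (fun ω => ‖X ω‖ ^ 2) P) :
    Integrable (fun ω => ‖X ω + ((δ : ℝ) • a ω + ∑ k, Y ω k • β ω k)‖ ^ 2) P ∧
      ∫ ω, ‖X ω + ((δ : ℝ) • a ω + ∑ k, Y ω k • β ω k)‖ ^ 2 ∂P ≤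
        (1 + δ) * ∫ ω, ‖X ω‖ ^ 2 ∂P + (C ^ 2 + κ) * δ := by
  set θ : Ω → EuclideanSpace ℝ (Fin n) × EuclideanSpace ℝ (Fin n) ×
    (Fin r → EuclideanSpace ℝ (Fin n)) := fun ω => (X ω, a ω, β ω)
  have hθ : Measurable[m] θ := hX.prodMk (ha.prodMk hβ)
  have hindep : IndepFun θ Y P :=
    (indep_of_indep_of_le_right hind (measurable_iff_comap_le.1 hθ)).symm
  have hst : ∀ ω, _ := fun ω => integral_norm_add_step_sq_le (X ω) (a ω) (β ω) (haC ω)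
    (hmom _ _ (haC ω) (hβC ω)).1 (hmom _ _ (haC ω) (hβC ω)).2
  have hG : Integrable (fun ω => (1 + δ) * ‖X ω‖ ^ 2 + (C ^ 2 + κ) * δ) P :=
    (hXi.const_mul _).add (integrable_const _)
  obtain ⟨h1, h2, h3⟩ := integral_comp_indepFun hindep (hθ.mono hm le_rfl) hY hYlaw
    (ψ := fun y => ‖y.1.1 + ((δ : ℝ) • y.1.2.1 + ∑ k, y.2 k • y.1.2.2 k)‖ ^ 2) (by fun_prop)
    (fun ω => (hst ω).1) hG
    (fun ω => by
      simp only [abs_of_nonneg (pow_nonneg (norm_nonneg _) 2)]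
      exact (hst ω).2)
  refine ⟨h1, h3.le.trans ((integral_mono h2 hG fun ω => (hst ω).2).trans_eq ?_)⟩
  rw [integral_add (hXi.const_mul _) (integrable_const _), integral_const_mul]
  simp

/-- Everything except the increment `Y` is known in `m`. Freezing it leaves the deterministic
Gaussian expansion `htay`, which holds uniformly in the frozen data; on `A` its leading term is at
most `δ h`. -/
lemma setIntegral_step_sub_le (hY : Measurable Y) (hm : m ≤ mΩ)
    (hind : Indep (MeasurableSpace.comap Y inferInstance) m P)
    (hYlaw : P.map Y = gaussianVec r δ) (ha : Measurable[m] a) (hβ : Measurable[m] β)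
    (haC : ∀ ω, ‖a ω‖ ≤ C) (hβC : ∀ ω k, ‖β ω k‖ ≤ C) (hX : Measurable[m] X)
    {M : Ω → Fin l} (hM : Measurable[m] M) {F : Fin l → EuclideanSpace ℝ (Fin n) → ℝ}
    (hF : ∀ i, Continuous (F i)) {b : ℝ} (hFb : ∀ i x, |F i x| ≤ b) {η : ℝ}
    (htay : ∀ (i : Fin l) (z a : EuclideanSpace ℝ (Fin n))
      (β : Fin r → EuclideanSpace ℝ (Fin n)), ‖a‖ ≤ C → (∀ k, ‖β k‖ ≤ C) →
      |∫ w, (F i (z + ((δ : ℝ) • a + ∑ k, w k • β k)) - F i z) ∂gaussianVec r δ -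
        δ * (fderiv ℝ (F i) z a + (1 / 2) * ∑ k, fderiv ℝ (fderiv ℝ (F i)) z (β k) (β k))| ≤
          η * δ)
    {A : Set Ω} (hA : MeasurableSet[m] A) {h : Ω → ℝ} (hh : Integrable h P)
    (hle : ∀ ω ∈ A, fderiv ℝ (F (M ω)) (X ω) (a ω) +
      (1 / 2) * ∑ k, fderiv ℝ (fderiv ℝ (F (M ω))) (X ω) (β ω k) (β ω k) ≤ h ω) :
    ∫ ω in A, (F (M ω) (X ω + ((δ : ℝ) • a ω + ∑ k, Y ω k • β ω k)) - F (M ω) (X ω)) ∂P ≤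
      ∫ ω in A, (δ * h ω + η * δ) ∂P := by
  -- The indicator of `A` is carried along as a real coordinate, which turns the integral over `A`
  -- into an unrestricted one.
  set θ : Ω → (Fin l × ℝ) × EuclideanSpace ℝ (Fin n) × EuclideanSpace ℝ (Fin n) ×
    (Fin r → EuclideanSpace ℝ (Fin n)) := fun ω => ((M ω, A.indicator 1 ω), X ω, a ω, β ω)
  have hθ : Measurable[m] θ :=
    (hM.prodMk (Measurable.indicator (@measurable_one ℝ Ω _ m _) hA)).prodMk (hX.prodMk (ha.prodMk hβ))
  have hindep : IndepFun θ Y P :=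
    (indep_of_indep_of_le_right hind (measurable_iff_comap_le.1 hθ)).symm
  have hF' : Measurable fun y : Fin l × EuclideanSpace ℝ (Fin n) => F y.1 y.2 :=
    measurable_from_prod_countable_right fun i => (hF i).measurable
  set ψ : ((Fin l × ℝ) × EuclideanSpace ℝ (Fin n) × EuclideanSpace ℝ (Fin n) ×
    (Fin r → EuclideanSpace ℝ (Fin n))) × (Fin r → ℝ) → ℝ := fun y =>
      y.1.1.2 * (F y.1.1.1 (y.1.2.1 + ((δ : ℝ) • y.1.2.2.1 + ∑ k, y.2 k • y.1.2.2.2 k)) -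
        F y.1.1.1 y.1.2.1) with hψdef
  have hψ : Measurable ψ := by
    have e1 : Measurable fun y : ((Fin l × ℝ) × EuclideanSpace ℝ (Fin n) ×
        EuclideanSpace ℝ (Fin n) × (Fin r → EuclideanSpace ℝ (Fin n))) × (Fin r → ℝ) =>
        (y.1.1.1, y.1.2.1 + ((δ : ℝ) • y.1.2.2.1 + ∑ k, y.2 k • y.1.2.2.2 k)) := by fun_prop
    have e2 : Measurable fun y : ((Fin l × ℝ) × EuclideanSpace ℝ (Fin n) ×
        EuclideanSpace ℝ (Fin n) × (Fin r → EuclideanSpace ℝ (Fin n))) × (Fin r → ℝ) =>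
        (y.1.1.1, y.1.2.1) := by fun_prop
    have e3 : Measurable fun y : ((Fin l × ℝ) × EuclideanSpace ℝ (Fin n) ×
        EuclideanSpace ℝ (Fin n) × (Fin r → EuclideanSpace ℝ (Fin n))) × (Fin r → ℝ) =>
        y.1.1.2 := by fun_prop
    exact e3.mul ((hF'.comp e1).sub (hF'.comp e2))
  have hdiff : ∀ i x y, |F i x - F i y| ≤ 2 * b := fun i x y =>
    (abs_sub _ _).trans (by linarith [hFb i x, hFb i y])
  have hψb : ∀ ω w, |ψ (θ ω, w)| ≤ 2 * b := by
    intro ω w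
    have h1 := hdiff (M ω) (X ω + ((δ : ℝ) • a ω + ∑ k, w k • β ω k)) (X ω)
    simp only [hψdef, θ, abs_mul]
    by_cases hω : ω ∈ A
    · simpa [hω] using h1
    · simpa [hω] using (abs_nonneg _).trans h1
  have hψi : ∀ ω, Integrable (fun w => ψ (θ ω, w)) (gaussianVec r δ) := fun ω =>
    Integrable.of_bound (hψ.comp (measurable_const.prodMk measurable_id)).aestronglyMeasurable
      (2 * b) (ae_of_all _ (hψb ω))
  obtain ⟨-, h2, h3⟩ := integral_comp_indepFun hindep (hθ.mono hm le_rfl) hY hYlaw hψ hψi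
    (G := fun _ => 2 * b) (integrable_const _) fun ω => by
      calc _ ≤ ∫ _, 2 * b ∂gaussianVec r δ :=
            integral_mono (hψi ω).abs (integrable_const _) (hψb ω)
        _ = _ := by simp
  rw [← integral_indicator (hm _ hA), ← integral_indicator (hm _ hA)]
  have h4 : (fun ω => A.indicator (fun ω => F (M ω) (X ω + ((δ : ℝ) • a ω +
      ∑ k, Y ω k • β ω k)) - F (M ω) (X ω)) ω) = fun ω => ψ (θ ω, Y ω) := by
    ext ω
    by_cases hω : ω ∈ A <;> simp [hψdef, θ, hω]
  rw [h4, h3]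
  refine integral_mono h2 (((hh.const_mul _).add (integrable_const _)).indicator (hm _ hA))
    fun ω => ?_
  by_cases hω : ω ∈ A
  · simp only [hψdef, θ, hω, Set.indicator_of_mem, Pi.one_apply, one_mul]
    have h5 := (abs_le.1 (htay (M ω) (X ω) (a ω) (β ω) (haC ω) (hβC ω))).2
    have h6 := mul_le_mul_of_nonneg_left (hle ω hω) δ.coe_nonneg
    linarith
  · simp [hψdef, θ, hω]

end Step


/-! ## The stopped Euler scheme of a solution process -/

/-- The data of an Euler scheme: a switched system with noise `W`, mode process `μ` and solution
process `ξ`, the times `u`, the step size `δ` and the radius `R` of the ball in which `ξ` is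
followed. -/
structure EulerData (n r l : ℕ) (Ω : Type*) where
  S : SwitchedSystem n r l
  W : ℝ≥0 → Ω → EuclideanSpace ℝ (Fin r)
  μ : ℝ≥0 → Ω → Fin l
  ξ : ℝ≥0 → Ω → EuclideanSpace ℝ (Fin n)
  u : ℕ → ℝ≥0
  δ : ℝ≥0
  R : ℝ≥0

namespace EulerData

variable {n r l : ℕ} {Ω : Type*} (X : EulerData n r l Ω)

/-- `ξ` has not left the ball of radius `R` at the times `u 0, …, u j`. -/
def alive (j : ℕ) : Set Ω := {ω | ∀ i ≤ j, ‖X.ξ (X.u i) ω‖ ≤ X.R}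

/-- The increments of the noise. -/
def incr (j : ℕ) (ω : Ω) (k : Fin r) : ℝ := X.W (X.u (j + 1)) ω k - X.W (X.u j) ω k

/-- The drift coefficient, set to zero after the exit from the ball. -/
def drift (j : ℕ) : Ω → EuclideanSpace ℝ (Fin n) :=
  (X.alive j).indicator fun ω => X.S.f (X.μ (X.u j) ω) (X.ξ (X.u j) ω)

/-- The columns of the diffusion coefficient, set to zero after the exit from the ball. -/
def diffusion (j : ℕ) : Ω → Fin r → EuclideanSpace ℝ (Fin n) :=
  (X.alive j).indicator fun ω => X.S.col (X.μ (X.u j) ω) (X.ξ (X.u j) ω)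

/-- The increments of the Euler scheme. -/
def step (j : ℕ) (ω : Ω) : EuclideanSpace ℝ (Fin n) :=
  (X.δ : ℝ) • X.drift j ω + ∑ k, X.incr j ω k • X.diffusion j ω k

/-- The Euler scheme. -/
def euler : ℕ → Ω → EuclideanSpace ℝ (Fin n)
  | 0 => X.ξ (X.u 0)
  | j + 1 => fun ω => euler j ω + X.step j ω

/-- The processes are adapted, `W` is a Brownian motion and the times are equidistant. -/
structure Compatible [mΩ : MeasurableSpace Ω] (P : Measure Ω) (𝔽 : Filtration ℝ≥0 mΩ) : Prop where
  adapted_ξ : StronglyAdapted 𝔽 X.ξ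
  adapted_μ : StronglyAdapted 𝔽 X.μ
  brownian : IsBrownianMotion P 𝔽 X.W
  u_succ : ∀ j, X.u (j + 1) = X.u j + X.δ

variable {X}

lemma alive_antitone : Antitone X.alive := fun _ _ hij _ h k hk => h k (hk.trans hij)

/-- A bound of the coefficients in the ball of radius `R`. -/
def CoeffBound (X : EulerData n r l Ω) (C : ℝ) : Prop :=
  ∀ x, ‖x‖ ≤ X.R → (∀ m, ‖X.S.f m x‖ ≤ C) ∧ ∀ m k, ‖X.S.col m x k‖ ≤ C

lemma norm_drift_le {C : ℝ} (hC0 : 0 ≤ C) (hC : X.CoeffBound C) (j : ℕ) (ω : Ω) :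
    ‖X.drift j ω‖ ≤ C := by
  by_cases h : ω ∈ X.alive j
  · rw [drift, Set.indicator_of_mem h]
    exact (hC _ (h j le_rfl)).1 _
  · simpa [drift, Set.indicator_of_notMem h] using hC0

lemma norm_diffusion_le {C : ℝ} (hC0 : 0 ≤ C) (hC : X.CoeffBound C) (j : ℕ) (ω : Ω) (k : Fin r) :
    ‖X.diffusion j ω k‖ ≤ C := by
  by_cases h : ω ∈ X.alive j
  · rw [diffusion, Set.indicator_of_mem h]
    exact (hC _ (h j le_rfl)).2 _ _
  · simpa [diffusion, Set.indicator_of_notMem h] using hC0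

namespace Compatible

variable [mΩ : MeasurableSpace Ω] {P : Measure Ω} {𝔽 : Filtration ℝ≥0 mΩ}

lemma monotone_u (h : X.Compatible P 𝔽) : Monotone X.u :=
  monotone_nat_of_le_succ fun j => by rw [h.u_succ]; exact le_self_add

/-- The filtration at the times of the scheme. -/
def filtration (h : X.Compatible P 𝔽) : Filtration ℕ mΩ where
  seq j := 𝔽 (X.u j)
  mono' _ _ hij := 𝔽.mono (h.monotone_u hij)
  le' _ := 𝔽.le _

lemma measurable_ξ (h : X.Compatible P 𝔽) (t : ℝ≥0) : Measurable[𝔽 t] (X.ξ t) :=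
  (h.adapted_ξ t).measurable

lemma measurable_μ (h : X.Compatible P 𝔽) (t : ℝ≥0) : Measurable[𝔽 t] (X.μ t) :=
  (h.adapted_μ t).measurable

lemma measurableSet_alive (h : X.Compatible P 𝔽) (j : ℕ) :
    MeasurableSet[𝔽 (X.u j)] (X.alive j) := by
  have : X.alive j = ⋂ i ∈ Set.Iic j, X.ξ (X.u i) ⁻¹' Metric.closedBall 0 X.R := by
    ext ω
    simp [alive]
  rw [this]
  exact MeasurableSet.biInter (Set.to_countable _) fun i hi =>
    𝔽.mono (h.monotone_u hi) _ (h.measurable_ξ _ Metric.isClosed_closedBall.measurableSet)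

lemma measurable_drift (h : X.Compatible P 𝔽) (j : ℕ) : Measurable[𝔽 (X.u j)] (X.drift j) := by
  have h1 : Measurable fun y : Fin l × EuclideanSpace ℝ (Fin n) => X.S.f y.1 y.2 :=
    measurable_from_prod_countable_right fun m => (X.S.continuous_f m).measurable
  exact (h1.comp ((h.measurable_μ _).prodMk (h.measurable_ξ _))).indicator (h.measurableSet_alive j)

lemma measurable_diffusion (h : X.Compatible P 𝔽) (j : ℕ) :
    Measurable[𝔽 (X.u j)] (X.diffusion j) := by
  have h1 : Measurable fun y : Fin l × EuclideanSpace ℝ (Fin n) => X.S.col y.1 y.2 :=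
    measurable_from_prod_countable_right fun m =>
      measurable_pi_lambda _ fun k => (X.S.continuous_col m k).measurable
  exact (h1.comp ((h.measurable_μ _).prodMk (h.measurable_ξ _))).indicator (h.measurableSet_alive j)

lemma measurable_incr_of_le (h : X.Compatible P 𝔽) {i j : ℕ} (hij : i + 1 ≤ j) :
    Measurable[𝔽 (X.u j)] (X.incr i) := by
  have h1 : Measurable[𝔽 (X.u j)] (X.W (X.u (i + 1))) :=
    (h.brownian.adapted _).measurable.mono (𝔽.mono (h.monotone_u hij)) le_rfl
  have h2 : Measurable[𝔽 (X.u j)] (X.W (X.u i)) :=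
    (h.brownian.adapted _).measurable.mono (𝔽.mono (h.monotone_u (by omega))) le_rfl
  have h3 : Measurable fun y : EuclideanSpace ℝ (Fin r) × EuclideanSpace ℝ (Fin r) =>
      fun k => y.1 k - y.2 k := by fun_prop
  exact h3.comp (h1.prodMk h2)

lemma measurable_step_of_le (h : X.Compatible P 𝔽) {i j : ℕ} (hij : i + 1 ≤ j) :
    Measurable[𝔽 (X.u j)] (X.step i) := by
  have hle := 𝔽.mono (h.monotone_u (show i ≤ j by omega))
  have h1 := (h.measurable_drift i).mono hle le_rfl
  have h2 := (h.measurable_diffusion i).mono hle le_rfl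
  have h3 := h.measurable_incr_of_le hij
  have h4 : Measurable fun y : EuclideanSpace ℝ (Fin n) × (Fin r → EuclideanSpace ℝ (Fin n)) ×
      (Fin r → ℝ) => (X.δ : ℝ) • y.1 + ∑ k, y.2.2 k • y.2.1 k := by fun_prop
  exact h4.comp (h1.prodMk (h2.prodMk h3))

lemma measurable_euler_of_le (h : X.Compatible P 𝔽) {i j : ℕ} (hij : i ≤ j) :
    Measurable[𝔽 (X.u j)] (X.euler i) := by
  induction i with
  | zero => exact (h.measurable_ξ _).mono (𝔽.mono (h.monotone_u hij)) le_rfl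
  | succ i ih => exact (ih (by omega)).add (h.measurable_step_of_le hij)

lemma measurable_euler (h : X.Compatible P 𝔽) (j : ℕ) :
    Measurable[𝔽 (X.u j)] (X.euler j) := h.measurable_euler_of_le le_rfl

lemma measurable_incr (h : X.Compatible P 𝔽) (j : ℕ) : Measurable (X.incr j) :=
  (h.measurable_incr_of_le le_rfl).mono (𝔽.le _) le_rfl

lemma indep_incr (h : X.Compatible P 𝔽) (j : ℕ) :
    Indep (MeasurableSpace.comap (X.incr j) inferInstance) (𝔽 (X.u j)) P := by
  refine indep_of_indep_of_le_left
    (h.brownian.indep (X.u j) (X.u (j + 1)) (h.monotone_u (Nat.le_succ j))) ?_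
  have h1 : Measurable fun x : EuclideanSpace ℝ (Fin r) => fun k => x k := by fun_prop
  have h2 : X.incr j = (fun x : EuclideanSpace ℝ (Fin r) => fun k => x k) ∘
      fun ω => X.W (X.u (j + 1)) ω - X.W (X.u j) ω := by
    ext ω k
    simp [incr]
  rw [h2, ← MeasurableSpace.comap_comp]
  exact MeasurableSpace.comap_mono (measurable_iff_comap_le.1 h1)

lemma map_incr (h : X.Compatible P 𝔽) (j : ℕ) : P.map (X.incr j) = gaussianVec r X.δ := by
  have h1 := h.brownian.gaussian (X.u j) (X.u (j + 1)) (h.monotone_u (Nat.le_succ j))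
  rw [h.u_succ, add_tsub_cancel_left, ← h.u_succ] at h1
  exact h1

variable [IsProbabilityMeasure P]

/-- Fourth moments serve the remainder terms. The mean square displacement `a j` satisfies `a (j +
1) ≤ (1 + δ) a j + D δ`, because the noise is centered given the past, and a discrete Gronwall
argument gives `D (j δ) exp (j δ)`. The constant depends neither on the grid nor on the process. -/
lemma exists_step_moment (n r : ℕ) (C : ℝ) : ∃ κ : ℝ, 0 ≤ κ ∧
    ∀ (l : ℕ) (Ω : Type*) [mΩ : MeasurableSpace Ω] (P : Measure Ω) [IsProbabilityMeasure P]
      (𝔽 : Filtration ℝ≥0 mΩ) (X : EulerData n r l Ω), X.Compatible P 𝔽 → X.CoeffBound C →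
      X.δ ≤ 1 → 0 ≤ C → ∀ j, (Integrable (fun ω => ‖X.step j ω‖ ^ 4) P ∧
        ∫ ω, ‖X.step j ω‖ ^ 4 ∂P ≤ κ * X.δ ^ 2) ∧
      ∀ i, Integrable (fun ω => ‖X.euler (i + j) ω - X.euler i ω‖ ^ 2) P ∧
        ∫ ω, ‖X.euler (i + j) ω - X.euler i ω‖ ^ 2 ∂P ≤
          κ * (j * X.δ) * Real.exp (j * X.δ) := by
  obtain ⟨κ, hκ, hmom⟩ := gaussianVec.exists_moment_bound (EuclideanSpace ℝ (Fin n)) r C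
  refine ⟨C ^ 2 + κ, by positivity, fun l Ω _ P _ 𝔽 X h hC hδ hC0 j => ⟨?_, ?_⟩⟩
  · have h1 := integrable_norm_step_pow_four (κ := κ) (C := C) (h.measurable_incr j)
      (𝔽.le (X.u j)) (h.indep_incr j) (h.map_incr j) (h.measurable_drift j)
      (h.measurable_diffusion j) (norm_drift_le hC0 hC j) (norm_diffusion_le hC0 hC j)
      fun a β ha hβ => (hmom X.δ hδ a β ha hβ).2
    refine ⟨h1.1, h1.2.trans ?_⟩
    gcongr
    nlinarith [sq_nonneg C]
  · intro i
    induction j with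
    | zero => simp
    | succ j ih =>
      have h1 := integrable_norm_add_step_sq (κ := κ) (C := C) (h.measurable_incr (i + j))
        (𝔽.le (X.u (i + j))) (h.indep_incr _) (h.map_incr _) (h.measurable_drift _)
        (h.measurable_diffusion _) (norm_drift_le hC0 hC _) (norm_diffusion_le hC0 hC _)
        (fun a β ha hβ => (hmom X.δ hδ a β ha hβ).1)
        ((h.measurable_euler _).sub (h.measurable_euler_of_le (Nat.le_add_right i j))) ih.1
      have h2 : ∀ ω, X.euler (i + (j + 1)) ω - X.euler i ω =
          (X.euler (i + j) ω - X.euler i ω) + ((X.δ : ℝ) • X.drift (i + j) ω +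
            ∑ k, X.incr (i + j) ω k • X.diffusion (i + j) ω k) := by
        intro ω
        rw [← add_assoc i j 1]
        simp only [euler, step]
        abel
      simp only [h2]
      refine ⟨h1.1, h1.2.trans ?_⟩
      have hδ0 : (0 : ℝ) ≤ X.δ := X.δ.coe_nonneg
      have hD : (0 : ℝ) ≤ C ^ 2 + κ := by positivity
      set D := C ^ 2 + κ
      set d : ℝ := (X.δ : ℝ)
      have h3 : 1 + d ≤ Real.exp d := by linarith [Real.add_one_le_exp d]
      have h4 : (1 : ℝ) ≤ Real.exp ((j + 1 : ℕ) * d) := Real.one_le_exp (by positivity)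
      have h5 : Real.exp d * Real.exp (j * d) = Real.exp ((j + 1 : ℕ) * d) := by
        rw [← Real.exp_add]
        congr 1
        push_cast
        ring
      calc _ ≤ (1 + d) * (D * (j * d) * Real.exp (j * d)) + D * d := by
            gcongr
            exact ih.2
        _ ≤ Real.exp d * (D * (j * d) * Real.exp (j * d)) +
            D * d * Real.exp ((j + 1 : ℕ) * d) := by
            refine add_le_add (by gcongr) (le_mul_of_one_le_right (by positivity) h4)
        _ = D * (j * d) * (Real.exp d * Real.exp (j * d)) +
            D * d * Real.exp ((j + 1 : ℕ) * d) := by ring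
        _ = _ := by
            rw [h5]
            push_cast
            ring

end Compatible

end EulerData


/-! ## Convergence of Riemann sums -/

/-- The left Riemann sums of a bounded function with finitely many discontinuities converge to its
integral. -/
lemma tendsto_riemannSum {E : Type*} [NormedAddCommGroup E] [NormedSpace ℝ E] [CompleteSpace E]
    {F : ℝ≥0 → E} {t : ℝ≥0} {b : ℝ} (hb : ∀ s ≤ t, ‖F s‖ ≤ b)
    (hF : {s | s ≤ t ∧ ¬ ContinuousAt F s}.Finite) :
    Tendsto (fun N : ℕ => ∑ k ∈ Finset.range N, ((t : ℝ) / N) • F (k * t / N)) atTop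
      (𝓝 (∫ s in (0 : ℝ)..t, F s.toNNReal)) := by
  rcases eq_or_ne t 0 with rfl | ht
  · simp
  have ht0 : (0 : ℝ) < t := by exact_mod_cast pos_iff_ne_zero.2 ht
  -- The ceiling minus one is `k` exactly on `(k t / N, (k + 1) t / N]`. So `φ N` takes the left
  -- endpoint value on the half-open intervals used by the interval integral.
  set φ : ℕ → ℝ → E := fun N s => F ((⌈s * N / t⌉₊ - 1 : ℕ) * t / N) with hφ
  have hceil : ∀ N : ℕ, 0 < N → ∀ s ∈ Set.Ioc (0 : ℝ) t,
      s - t / N ≤ ((((⌈s * N / t⌉₊ - 1 : ℕ) * t / N : ℝ≥0)) : ℝ) ∧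
      ((((⌈s * N / t⌉₊ - 1 : ℕ) * t / N : ℝ≥0)) : ℝ) ≤ s := by
    intro N hN s hs
    have hN' : (0 : ℝ) < N := by exact_mod_cast hN
    have hpos : 0 < s * N / t := by have := hs.1; positivity
    have h1 : 1 ≤ ⌈s * N / t⌉₊ := Nat.one_le_iff_ne_zero.2 (Nat.ceil_pos.2 hpos).ne'
    have h2 : s * N / t ≤ ⌈s * N / t⌉₊ := Nat.le_ceil _
    have h3 : (⌈s * N / t⌉₊ : ℝ) < s * N / t + 1 := Nat.ceil_lt_add_one hpos.le
    have hcast : ((⌈s * N / t⌉₊ - 1 : ℕ) : ℝ) = ⌈s * N / t⌉₊ - 1 := by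
      push_cast [Nat.cast_sub h1]
      rfl
    simp only [NNReal.coe_div, NNReal.coe_mul, NNReal.coe_natCast]
    rw [hcast]
    rw [div_le_iff₀ ht0] at h2
    have h4 : (⌈s * N / t⌉₊ - 1 : ℝ) * t ≤ s * N := by
      have : (⌈s * N / t⌉₊ : ℝ) - 1 ≤ s * N / t := by linarith
      rwa [le_div_iff₀ ht0] at this
    constructor
    · rw [le_div_iff₀ hN', sub_mul, div_mul_cancel₀ _ hN'.ne']
      linarith
    · rwa [div_le_iff₀ hN']
  have hsum : ∀ N : ℕ, 0 < N → ∫ s in (0 : ℝ)..t, φ N s =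
      ∑ k ∈ Finset.range N, ((t : ℝ) / N) • F (k * t / N) := by
    intro N hN
    have hN' : (0 : ℝ) < N := by exact_mod_cast hN
    set a : ℕ → ℝ := fun k => k * t / N with ha
    have hle : ∀ k, a k ≤ a (k + 1) := fun k => by
      simp only [ha]
      gcongr
      simp
    have hconst : ∀ k, ∀ s ∈ Set.Ioc (a k) (a (k + 1)), φ N s = F (k * t / N) := by
      intro k s hs
      have h1 : ⌈s * N / t⌉₊ = k + 1 := by
        rw [Nat.ceil_eq_iff (by omega)]
        simp only [ha] at hs
        have hs1 := hs.1
        have hs2 := hs.2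
        rw [div_lt_iff₀ hN'] at hs1
        rw [le_div_iff₀ hN'] at hs2
        rw [lt_div_iff₀ ht0, div_le_iff₀ ht0]
        exact ⟨by simpa using hs1, hs2⟩
      simp [hφ, h1]
    have hint : ∀ k < N, IntervalIntegrable (φ N) volume (a k) (a (k + 1)) := by
      intro k _
      refine (intervalIntegrable_const (c := F (k * t / N))).congr ?_
      rw [Set.uIoc_of_le (hle k)]
      exact fun s hs => (hconst k s hs).symm
    have h0 : a 0 = 0 := by simp [ha]
    have h1 : a N = t := by simp only [ha]; field_simp
    rw [← h0, ← h1, ← intervalIntegral.sum_integral_adjacent_intervals hint]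
    refine Finset.sum_congr rfl fun k _ => ?_
    rw [intervalIntegral.integral_of_le (hle k),
      setIntegral_congr_fun measurableSet_Ioc (hconst k), setIntegral_const, measureReal_def,
      Real.volume_Ioc, ENNReal.toReal_ofReal (sub_nonneg.2 (hle k))]
    congr 1
    simp only [ha, Nat.cast_add, Nat.cast_one]
    field_simp
    ring
  have hlim : Tendsto (fun N : ℕ => ∫ s in (0 : ℝ)..t, φ N s) atTop
      (𝓝 (∫ s in (0 : ℝ)..t, F s.toNNReal)) := by
    refine intervalIntegral.tendsto_integral_filter_of_dominated_convergence (fun _ => b) ?_ ?_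
      intervalIntegrable_const ?_
    · refine Eventually.of_forall fun N => ?_
      have h1 : Measurable fun s : ℝ => ⌈s * N / t⌉₊ :=
        Nat.measurable_ceil.comp (by fun_prop)
      have h2 : StronglyMeasurable fun k : ℕ => F ((k - 1 : ℕ) * t / N) :=
        StronglyMeasurable.of_discrete
      exact (h2.comp_measurable h1).aestronglyMeasurable
    · filter_upwards [eventually_gt_atTop 0] with N hN
      refine ae_of_all _ fun s hs => hb _ ?_
      rw [Set.uIoc_of_le ht0.le] at hs
      exact_mod_cast (hceil N hN s hs).2.trans hs.2
    · have hfin : ((fun s : ℝ≥0 => (s : ℝ)) '' {s | s ≤ t ∧ ¬ ContinuousAt F s}).Finite :=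
        hF.image _
      have hae : ∀ᵐ s : ℝ, s ∉ (fun s : ℝ≥0 => (s : ℝ)) '' {s | s ≤ t ∧ ¬ ContinuousAt F s} :=
        measure_eq_zero_iff_ae_notMem.1 (hfin.measure_zero volume)
      filter_upwards [hae] with s hs hst
      rw [Set.uIoc_of_le ht0.le] at hst
      have hsn : s.toNNReal ≤ t := Real.toNNReal_le_iff_le_coe.2 hst.2
      have hcont : ContinuousAt F s.toNNReal := by
        by_contra h
        exact hs ⟨s.toNNReal, ⟨hsn, h⟩, Real.coe_toNNReal s hst.1.le⟩
      refine hcont.tendsto.comp ?_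
      rw [← NNReal.tendsto_coe, Real.coe_toNNReal s hst.1.le]
      have hl : Tendsto (fun N : ℕ => s - (t : ℝ) / N) atTop (𝓝 s) := by
        simpa using tendsto_const_nhds.sub (tendsto_const_div_atTop_nhds_zero_nat (t : ℝ))
      refine tendsto_of_tendsto_of_tendsto_of_le_of_le' hl tendsto_const_nhds ?_ ?_
      · filter_upwards [eventually_gt_atTop 0] with N hN
        exact (hceil N hN s hst).1
      · filter_upwards [eventually_gt_atTop 0] with N hN
        exact (hceil N hN s hst).2
  refine hlim.congr' ?_
  filter_upwards [eventually_gt_atTop 0] with N hN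
  exact hsum N hN

/-- The modes form a discrete space, so the signal is locally constant at its continuity points.
Hence the drift along the path can be discontinuous only where the signal is. -/
lemma SwitchedSystem.tendsto_riemannSum_drift {n r l : ℕ} (S : SwitchedSystem n r l)
    {μ : ℝ≥0 → Fin l} (hμ : IsSwitchingSignal μ) {x : ℝ≥0 → EuclideanSpace ℝ (Fin n)}
    (hx : Continuous x) (t : ℝ≥0) :
    Tendsto (fun N : ℕ => ∑ k ∈ Finset.range N,
        ((t : ℝ) / N) • S.f (μ (k * t / N)) (x (k * t / N))) atTop
      (𝓝 (∫ s in (0 : ℝ)..t, S.f (μ s.toNNReal) (x s.toNNReal))) := by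
  obtain ⟨b, -, hb⟩ := exists_uniform_bound (isCompact_Icc (a := (0 : ℝ≥0)) (b := t))
    (fun m s => S.f m (x s)) fun m => (S.continuous_f m).comp hx
  refine tendsto_riemannSum (F := fun s => S.f (μ s) (x s)) (b := b)
    (fun s hs => hb _ s ⟨zero_le, hs⟩) ((hμ.2.2 t).subset ?_)
  rintro s ⟨hs, hsc⟩
  refine ⟨hs, fun hc => hsc ?_⟩
  have h1 : ∀ᶠ y in 𝓝 s, μ y = μ s := hc.preimage_mem_nhds ((isOpen_discrete {μ s}).mem_nhds rfl)
  refine (((S.continuous_f (μ s)).comp hx).continuousAt (x := s)).congr ?_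
  filter_upwards [h1] with y hy
  simp [hy]


/-! ## The Euler scheme approximates the solution process -/

namespace EulerData

variable {n r l : ℕ} {Ω : Type*}

/-- The Euler scheme at the times `j T / K`. -/
def ofGrid (S : SwitchedSystem n r l) (W : ℝ≥0 → Ω → EuclideanSpace ℝ (Fin r))
    (μ : ℝ≥0 → Ω → Fin l) (ξ : ℝ≥0 → Ω → EuclideanSpace ℝ (Fin n)) (T R : ℝ≥0) (K : ℕ) :
    EulerData n r l Ω where
  S := S
  W := W
  μ := μ
  ξ := ξ
  u j := j * T / K
  δ := T / K
  R := R

/-- The Euler scheme without stopping. -/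
def free (X : EulerData n r l Ω) (j : ℕ) (ω : Ω) : EuclideanSpace ℝ (Fin n) :=
  X.ξ (X.u 0) ω + ∑ i ∈ Finset.range j,
    ((X.δ : ℝ) • X.S.f (X.μ (X.u i) ω) (X.ξ (X.u i) ω) +
      ∑ k, X.incr i ω k • X.S.col (X.μ (X.u i) ω) (X.ξ (X.u i) ω) k)

lemma euler_eq_free {X : EulerData n r l Ω} {j : ℕ} {ω : Ω} (h : ω ∈ X.alive j) :
    X.euler j ω = X.free j ω := by
  induction j with
  | zero => simp [euler, free]
  | succ j ih =>
    have hj : ω ∈ X.alive j := alive_antitone (Nat.le_succ j) h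
    simp only [euler, ih hj, free, Finset.sum_range_succ, ← add_assoc, step, drift, diffusion,
      Set.indicator_of_mem hj]

variable {S : SwitchedSystem n r l} {W : ℝ≥0 → Ω → EuclideanSpace ℝ (Fin r)}
  {μ : ℝ≥0 → Ω → Fin l} {ξ : ℝ≥0 → Ω → EuclideanSpace ℝ (Fin n)} {T R : ℝ≥0}

lemma ofGrid_compatible [mΩ : MeasurableSpace Ω] {P : Measure Ω} {𝔽 : Filtration ℝ≥0 mΩ}
    (hξ : StronglyAdapted 𝔽 ξ) (hμ : StronglyAdapted 𝔽 μ) (hW : IsBrownianMotion P 𝔽 W) (K : ℕ) :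
    (ofGrid S W μ ξ T R K).Compatible P 𝔽 where
  adapted_ξ := hξ
  adapted_μ := hμ
  brownian := hW
  u_succ j := by
    simp only [ofGrid]
    push_cast
    rw [add_mul, one_mul, add_div]

variable [mΩ : MeasurableSpace Ω] {P : Measure Ω} [IsProbabilityMeasure P]
  {𝔽 : Filtration ℝ≥0 mΩ} {x₀ : EuclideanSpace ℝ (Fin n)}

/-- At index `i * M` the unstopped scheme is `ξ 0` plus a drift sum and a noise sum for the time `i
T / N`. The drift sum converges almost surely and the noise sum in probability, by the definition of
the Itô integral; the drift integral cancels between the two limits. -/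
lemma tendsto_measureReal_free_sub (hS : S.Solves P 𝔽 W μ x₀ ξ) (hμa : StronglyAdapted 𝔽 μ)
    (hμ : ∀ᵐ ω ∂P, IsSwitchingSignal fun t => μ t ω) {N : ℕ} (hN : 0 < N) (i : ℕ) {ε : ℝ}
    (hε : 0 < ε) :
    Tendsto (fun M : ℕ => P.real {ω | ε ≤
      ‖(ofGrid S W μ ξ T R (N * M)).free (i * M) ω - ξ (i * T / N) ω‖}) atTop (𝓝 0) := by
  -- For `i = 0` the number `i * M` of parts does not tend to infinity, but the two values coincide.
  rcases Nat.eq_zero_or_pos i with rfl | hi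
  · have : ∀ M : ℕ, {ω | ε ≤ ‖(ofGrid S W μ ξ T R (N * M)).free (0 * M) ω -
        ξ ((0 : ℕ) * T / N) ω‖} = ∅ := by
      intro M
      ext ω
      simp [free, ofGrid, hε]
    simp only [this, measureReal_empty, tendsto_const_nhds_iff]
  set t : ℝ≥0 := i * T / N with ht
  have hscale : Tendsto (fun M : ℕ => i * M) atTop atTop :=
    tendsto_id.const_mul_atTop' hi
  have hI := (tendstoInMeasure_iff_measureReal_norm.1 (hS.equation t)) (ε / 2) (by positivity)
  have hmeas : ∀ s : ℝ≥0, StronglyMeasurable fun ω => S.f (μ s ω) (ξ s ω) := by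
    intro s
    have h1 : Measurable fun y : Fin l × EuclideanSpace ℝ (Fin n) => S.f y.1 y.2 :=
      measurable_from_prod_countable_right fun m => (S.continuous_f m).measurable
    exact (h1.comp ((((hμa s).measurable).mono (𝔽.le s) le_rfl).prodMk
      (((hS.adapted s).measurable).mono (𝔽.le s) le_rfl))).stronglyMeasurable
  have hD : TendstoInMeasure P (fun (K : ℕ) ω => ∑ k ∈ Finset.range K,
      ((t : ℝ) / K) • S.f (μ (k * t / K) ω) (ξ (k * t / K) ω)) atTop
      (fun ω => ∫ s in (0 : ℝ)..t, S.f (μ s.toNNReal ω) (ξ s.toNNReal ω)) := by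
    refine tendstoInMeasure_of_tendsto_ae (fun K => ?_) ?_
    · exact (Finset.stronglyMeasurable_fun_sum (Finset.range K)
        (f := fun (k : ℕ) ω => ((t : ℝ) / K) • S.f (μ (k * t / K) ω) (ξ (k * t / K) ω)) fun k _ =>
          (continuous_const_smul ((t : ℝ) / K)).comp_stronglyMeasurable
            (hmeas (k * t / K))).aestronglyMeasurable
    · filter_upwards [hμ, hS.continuous] with ω h1 h2
      exact S.tendsto_riemannSum_drift h1 h2 t
  have hD' := (tendstoInMeasure_iff_measureReal_norm.1 hD) (ε / 2) (by positivity)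
  have hsum := (hD'.comp hscale).add (hI.comp hscale)
  rw [add_zero] at hsum
  refine tendsto_of_tendsto_of_tendsto_of_le_of_le' tendsto_const_nhds hsum
    (Eventually.of_forall fun M => measureReal_nonneg) ?_
  filter_upwards [eventually_gt_atTop 0] with M hM
  have hN0 : (N : ℝ≥0) ≠ 0 := by exact_mod_cast hN.ne'
  have hM0 : (M : ℝ≥0) ≠ 0 := by exact_mod_cast hM.ne'
  have hi0 : (i : ℝ≥0) ≠ 0 := by exact_mod_cast hi.ne'
  -- Cutting `[0, i T / N]` into `i * M` equal parts has exactly the mesh `T / (N * M)` of the fine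
  -- grid.
  have hu : ∀ a : ℝ≥0, a * t / ((i * M : ℕ) : ℝ≥0) = a * T / ((N * M : ℕ) : ℝ≥0) := by
    intro a
    rw [ht]
    push_cast
    field_simp
  have hδ : (t : ℝ) / ((i * M : ℕ) : ℝ) = ((T / ((N * M : ℕ) : ℝ≥0) : ℝ≥0) : ℝ) := by
    have := congrArg (fun x : ℝ≥0 => (x : ℝ)) (hu 1)
    simpa using this
  have hfree : ∀ ω, (ofGrid S W μ ξ T R (N * M)).free (i * M) ω = ξ 0 ω +
      (∑ k ∈ Finset.range (i * M), ((t : ℝ) / (i * M : ℕ)) •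
        S.f (μ (k * t / (i * M : ℕ)) ω) (ξ (k * t / (i * M : ℕ)) ω) +
      ∑ k ∈ Finset.range (i * M), WithLp.toLp 2
        ((S.g (μ (k * t / (i * M : ℕ)) ω) (ξ (k * t / (i * M : ℕ)) ω)).mulVec fun j =>
          W (((k : ℝ≥0) + 1) * t / (i * M : ℕ)) ω j - W ((k : ℝ≥0) * t / (i * M : ℕ)) ω j)) := by
    intro ω
    simp only [free, hu, hδ, S.toLp_mulVec, incr, ofGrid, Finset.sum_add_distrib, Nat.cast_zero,
      zero_mul, zero_div, Nat.cast_add, Nat.cast_one]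
  refine (measureReal_mono ?_).trans (measureReal_union_le _ _)
  intro ω hω
  by_contra hcon
  simp only [Set.mem_union, Set.mem_ofPred_eq, not_or, not_le] at hω hcon
  rw [hfree] at hω
  refine absurd hω (not_le.2 ?_)
  have htri := norm_add_le
    (∑ k ∈ Finset.range (i * M), ((t : ℝ) / (i * M : ℕ)) •
        S.f (μ (k * t / (i * M : ℕ)) ω) (ξ (k * t / (i * M : ℕ)) ω) -
      ∫ s in (0 : ℝ)..t, S.f (μ s.toNNReal ω) (ξ s.toNNReal ω))
    (∑ k ∈ Finset.range (i * M), WithLp.toLp 2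
        ((S.g (μ (k * t / (i * M : ℕ)) ω) (ξ (k * t / (i * M : ℕ)) ω)).mulVec fun j =>
          W (((k : ℝ≥0) + 1) * t / (i * M : ℕ)) ω j - W ((k : ℝ≥0) * t / (i * M : ℕ)) ω j) -
      (ξ t ω - ξ 0 ω - ∫ s in (0 : ℝ)..t, S.f (μ s.toNNReal ω) (ξ s.toNNReal ω)))
  refine (le_of_eq ?_).trans_lt (htri.trans_lt ((add_lt_add hcon.1 hcon.2).trans_eq
    (add_halves ε)))
  congr 1
  abel

/-- The continuity of the paths at the rational multiples of `T`, uniformly in probability. -/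
lemma exists_oscillation_bound (hξa : StronglyAdapted 𝔽 ξ)
    (hξ : ∀ᵐ ω ∂P, Continuous fun t => ξ t ω) (T : ℝ≥0) {ε η : ℝ} (hε : 0 < ε) (hη : 0 < η) :
    ∃ N₀ : ℕ, 0 < N₀ ∧ ∀ N ≥ N₀, P.real (⋃ (a : ℕ × ℕ) (b : ℕ × ℕ)
      (_ : (a.1 * T / a.2 ≤ T ∧ b.1 * T / b.2 ≤ T) ∧
        dist (a.1 * T / a.2 : ℝ≥0) (b.1 * T / b.2) ≤ T / N),
      {ω | ε ≤ ‖ξ (a.1 * T / a.2) ω - ξ (b.1 * T / b.2) ω‖}) ≤ η := by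
  -- The index pairs are countable, so `O N` is measurable. These sets decrease to a null set by
  -- uniform continuity of the paths on `[0, T]`, and continuity from above applies. The shift `N +
  -- 1` avoids division by zero.
  set O : ℕ → Set Ω := fun N => ⋃ (a : ℕ × ℕ) (b : ℕ × ℕ)
      (_ : (a.1 * T / a.2 ≤ T ∧ b.1 * T / b.2 ≤ T) ∧
        dist (a.1 * T / a.2 : ℝ≥0) (b.1 * T / b.2) ≤ T / (N + 1 : ℕ)),
      {ω | ε ≤ ‖ξ (a.1 * T / a.2) ω - ξ (b.1 * T / b.2) ω‖} with hO
  have hmem : ∀ N ω, ω ∈ O N ↔ ∃ a b : ℕ × ℕ, ((a.1 * T / a.2 ≤ T ∧ b.1 * T / b.2 ≤ T) ∧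
        dist (a.1 * T / a.2 : ℝ≥0) (b.1 * T / b.2) ≤ T / (N + 1 : ℕ)) ∧
        ε ≤ ‖ξ (a.1 * T / a.2) ω - ξ (b.1 * T / b.2) ω‖ := by
    intro N ω
    simp only [hO, Set.mem_iUnion, Set.mem_ofPred_eq, exists_prop]
  have hmeas : ∀ N, MeasurableSet (O N) := by
    intro N
    refine MeasurableSet.iUnion fun a => MeasurableSet.iUnion fun b => MeasurableSet.iUnion fun _ =>
      measurableSet_le measurable_const ?_
    exact (((hξa _).measurable.mono (𝔽.le _) le_rfl).sub
      ((hξa _).measurable.mono (𝔽.le _) le_rfl)).norm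
  have hanti : Antitone O := by
    intro N N' hNN' ω hω
    rw [hmem] at hω ⊢
    obtain ⟨a, b, ⟨h1, h2⟩, h3⟩ := hω
    refine ⟨a, b, ⟨h1, h2.trans ?_⟩, h3⟩
    gcongr
  have hinter : P (⋂ N, O N) = 0 := by
    rw [measure_eq_zero_iff_ae_notMem]
    filter_upwards [hξ] with ω hω hmemω
    obtain ⟨ρ, hρ, huc⟩ := Metric.uniformContinuousOn_iff.1
      ((isCompact_Icc (a := (0 : ℝ≥0)) (b := T)).uniformContinuousOn_of_continuous
        hω.continuousOn) ε hε
    obtain ⟨N, hN⟩ : ∃ N : ℕ, (T : ℝ) / (N + 1 : ℕ) < ρ := by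
      have h1 := (tendsto_const_div_atTop_nhds_zero_nat (T : ℝ)).comp (tendsto_add_atTop_nat 1)
      obtain ⟨N, hN⟩ := (h1.eventually (gt_mem_nhds hρ)).exists
      exact ⟨N, hN⟩
    obtain ⟨a, b, ⟨⟨h1, h2⟩, h3⟩, h4⟩ := (hmem N ω).1 (Set.mem_iInter.1 hmemω N)
    have := huc _ ⟨zero_le, h1⟩ _ ⟨zero_le, h2⟩ (h3.trans_lt hN)
    rw [dist_eq_norm] at this
    exact absurd h4 (not_le.2 this)
  have hlim := tendsto_measure_iInter_atTop (μ := P) (fun N => (hmeas N).nullMeasurableSet) hanti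
    ⟨0, measure_ne_top _ _⟩
  rw [hinter] at hlim
  have hlim' : Tendsto (fun N => P.real (O N)) atTop (𝓝 0) := by
    have := (ENNReal.tendsto_toReal (by simp : (0 : ℝ≥0∞) ≠ ⊤)).comp hlim
    exact this
  obtain ⟨N₀, hN₀⟩ := eventually_atTop.1 (hlim'.eventually (gt_mem_nhds hη))
  refine ⟨N₀ + 1, by omega, fun N hN => ?_⟩
  obtain ⟨M, rfl⟩ : ∃ M, N = M + 1 := ⟨N - 1, by omega⟩
  exact (hN₀ M (by omega)).le

/-- On a coarse grid that is fine enough, and then a fine grid that is fine enough, the Euler scheme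
is close to the solution process, in probability at every time of the fine grid, and simultaneously
at the times of the coarse grid. -/
lemma exists_grid (hS : S.Solves P 𝔽 W μ x₀ ξ) (hW : IsBrownianMotion P 𝔽 W)
    (hμa : StronglyAdapted 𝔽 μ) (hμ : ∀ᵐ ω ∂P, IsSwitchingSignal fun t => μ t ω) (hT : 0 < T)
    {C : ℝ} (hC0 : 0 ≤ C) (hC : ∀ x, ‖x‖ ≤ R → (∀ m, ‖S.f m x‖ ≤ C) ∧ ∀ m k, ‖S.col m x k‖ ≤ C)
    {ρ η δ₀ : ℝ} (hρ : 0 < ρ) (hη : 0 < η) (hδ₀ : 0 < δ₀) :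
    ∃ N₀ : ℕ, 0 < N₀ ∧ ∀ N ≥ N₀, ∃ M : ℕ, 0 < M ∧ (T : ℝ) / (N * M : ℕ) ≤ δ₀ ∧
      (∀ j ≤ N * M, P.real {ω | ω ∈ (ofGrid S W μ ξ T R (N * M)).alive j ∧
        ρ ≤ ‖(ofGrid S W μ ξ T R (N * M)).euler j ω - ξ (j * T / (N * M : ℕ)) ω‖} ≤ η) ∧
      P.real {ω | ω ∈ (ofGrid S W μ ξ T R (N * M)).alive (N * M) ∧ ∃ i ≤ N,
        ρ ≤ ‖(ofGrid S W μ ξ T R (N * M)).euler (i * M) ω - ξ (i * T / N) ω‖} ≤ η := by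
  obtain ⟨κ, hκ, hmom⟩ := Compatible.exists_step_moment n r C
  obtain ⟨N₁, hN₁, hosc⟩ := exists_oscillation_bound (P := P) hS.adapted hS.continuous T
    (ε := ρ / 3) (η := η / 3) (by positivity) (by positivity)
  -- This bounds the mean square displacement of the scheme within one coarse cell. Below `η / 3 *
  -- (ρ / 3) ^ 2`, Chebyshev's inequality gives probability at most `η / 3`.
  have hexp : Tendsto (fun N : ℕ => κ * ((T : ℝ) / N) * Real.exp ((T : ℝ) / N)) atTop (𝓝 0) := by
    have h1 := tendsto_const_div_atTop_nhds_zero_nat (T : ℝ)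
    have h2 := (h1.const_mul κ).mul ((Real.continuous_exp.tendsto 0).comp h1)
    simpa using h2
  obtain ⟨N₂, hN₂⟩ := eventually_atTop.1 (hexp.eventually
    (gt_mem_nhds (show (0 : ℝ) < η / 3 * (ρ / 3) ^ 2 by positivity)))
  refine ⟨max N₁ N₂, by omega, fun N hN => ?_⟩
  have hN0 : 0 < N := by omega
  have hN0' : (0 : ℝ) < N := by exact_mod_cast hN0
  have hN0'' : (N : ℝ≥0) ≠ 0 := by exact_mod_cast hN0.ne'
  -- `N` is fixed first and `M` is chosen afterwards: convergence is known at each coarse time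
  -- separately, and the level `η / (3 * (N + 1))` pays for a union over all `N + 1` of them.
  have hM1 : ∀ᶠ M : ℕ in atTop, ∀ i ∈ Finset.range (N + 1), P.real {ω | ρ / 3 ≤
      ‖(ofGrid S W μ ξ T R (N * M)).free (i * M) ω - ξ (i * T / N) ω‖} < η / (3 * (N + 1)) := by
    rw [Filter.eventually_all_finset]
    exact fun i _ => (tendsto_measureReal_free_sub hS hμa hμ hN0 i (by positivity)).eventually
      (gt_mem_nhds (by positivity))
  have hM2 : ∀ᶠ M : ℕ in atTop, (T : ℝ) / (N * M : ℕ) < min 1 δ₀ := by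
    have h1 := (tendsto_const_div_atTop_nhds_zero_nat (T : ℝ)).comp
      (tendsto_id.const_mul_atTop' hN0)
    exact h1.eventually (gt_mem_nhds (by positivity))
  obtain ⟨M, ⟨hM1, hM2⟩, hM0⟩ := ((hM1.and hM2).and (eventually_gt_atTop 0)).exists
  have hM0' : (0 : ℝ) < M := by exact_mod_cast hM0
  have hM0'' : (M : ℝ≥0) ≠ 0 := by exact_mod_cast hM0.ne'
  set X := ofGrid S W μ ξ T R (N * M) with hX
  have hcomp : X.Compatible P 𝔽 := ofGrid_compatible hS.adapted hμa hW _
  have hXC : X.CoeffBound C := hC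
  have hδ : X.δ ≤ 1 := by
    have : (X.δ : ℝ) ≤ 1 := by
      have := hM2.le.trans (min_le_left _ _)
      simpa [hX, ofGrid] using this
    exact_mod_cast this
  have hδr : (X.δ : ℝ) = T / (N * M) := by simp [hX, ofGrid]
  have hu : ∀ i : ℕ, ((i * M : ℕ) : ℝ≥0) * T / (N * M : ℕ) = i * T / N := by
    intro i
    push_cast
    field_simp
  have hcoarse : ∀ i ≤ N, P.real {ω | ω ∈ X.alive (i * M) ∧
      ρ / 3 ≤ ‖X.euler (i * M) ω - ξ (i * T / N) ω‖} ≤ η / (3 * (N + 1)) := by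
    intro i hi
    refine (measureReal_mono ?_).trans (hM1 i (by simpa using Nat.lt_succ_of_le hi)).le
    rintro ω ⟨h1, h2⟩
    rw [euler_eq_free h1] at h2
    exact h2
  have hNη : η / (3 * ((N : ℝ) + 1)) ≤ η / 3 := by
    gcongr
    linarith
  refine ⟨M, hM0, (hM2.le.trans (min_le_right _ _)), fun j hj => ?_, ?_⟩
  -- The fine time is compared with the coarse time just before it. The error splits into the motion
  -- of the scheme, the discrepancy at the coarse time and the oscillation of `ξ`, each less than `ρ
  -- / 3` outside an event of probability at most `η / 3`.
  · set i := j / M with hi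
    set k := j % M with hk
    have hjik : i * M + k = j := by rw [mul_comm]; exact Nat.div_add_mod j M
    have hkM : k < M := Nat.mod_lt _ hM0
    have hiN : i ≤ N := (Nat.div_le_div_right hj).trans (by rw [Nat.mul_div_cancel _ hM0])
    obtain ⟨-, hmom2⟩ := hmom l Ω P 𝔽 X hcomp hXC hδ hC0 k
    obtain ⟨hint, hE⟩ := hmom2 (i * M)
    have hkδ : (k : ℝ) * X.δ ≤ T / N := by
      rw [hδr, ← mul_div_assoc, div_le_div_iff₀ (by positivity) hN0']
      have h1 : (k : ℝ) ≤ M := by exact_mod_cast hkM.le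
      have h2 : (0 : ℝ) ≤ T * N := by positivity
      nlinarith
    have hcheb : P.real {ω | ρ / 3 ≤ ‖X.euler (i * M + k) ω - X.euler (i * M) ω‖} ≤ η / 3 := by
      have h1 := mul_meas_ge_le_integral_of_nonneg (μ := P)
        (f := fun ω => ‖X.euler (i * M + k) ω - X.euler (i * M) ω‖ ^ 2)
        (ae_of_all _ fun ω => by positivity) hint ((ρ / 3) ^ 2)
      have h2 : {ω | ρ / 3 ≤ ‖X.euler (i * M + k) ω - X.euler (i * M) ω‖} ⊆
          {ω | (ρ / 3) ^ 2 ≤ ‖X.euler (i * M + k) ω - X.euler (i * M) ω‖ ^ 2} := by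
        intro ω hω
        simp only [Set.mem_ofPred_eq] at hω ⊢
        gcongr
      have h3 : κ * (k * X.δ) * Real.exp (k * X.δ) ≤ κ * ((T : ℝ) / N) * Real.exp (T / N) := by
        gcongr
      have h4 := hN₂ N (by omega)
      have h5 : (ρ / 3) ^ 2 * P.real {ω | (ρ / 3) ^ 2 ≤
          ‖X.euler (i * M + k) ω - X.euler (i * M) ω‖ ^ 2} ≤ (ρ / 3) ^ 2 * (η / 3) := by
        linarith
      exact (measureReal_mono h2).trans (le_of_mul_le_mul_left h5 (by positivity))
    refine (measureReal_mono (?_ : _ ⊆ ({ω | ρ / 3 ≤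
      ‖X.euler (i * M + k) ω - X.euler (i * M) ω‖} ∪ {ω | ω ∈ X.alive (i * M) ∧
      ρ / 3 ≤ ‖X.euler (i * M) ω - ξ (i * T / N) ω‖}) ∪ _)).trans
      ((measureReal_union_le _ _).trans ((add_le_add ((measureReal_union_le _ _).trans
      (add_le_add hcheb ((hcoarse i hiN).trans hNη))) (hosc N (by omega))).trans_eq (by ring)))
    rintro ω ⟨halive, hω⟩
    by_contra hcon
    simp only [Set.mem_union, Set.mem_ofPred_eq, not_or, not_and, not_le] at hcon
    obtain ⟨⟨h1, h2⟩, h3⟩ := hcon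
    have h4 := h2 (alive_antitone (by omega) halive)
    have h5 : ‖ξ (i * T / N) ω - ξ (j * T / (N * M : ℕ)) ω‖ < ρ / 3 := by
      by_contra h6
      refine h3 (Set.mem_iUnion.2 ⟨(i, N), Set.mem_iUnion.2 ⟨(j, N * M), Set.mem_iUnion.2
        ⟨⟨⟨?_, ?_⟩, ?_⟩, not_lt.1 h6⟩⟩⟩)
      · rw [div_le_iff₀ (by positivity), mul_comm]
        gcongr
      · rw [div_le_iff₀ (by positivity), mul_comm]
        gcongr
      · simp only
        rw [← hu i, NNReal.dist_eq]
        simp only [NNReal.coe_div, NNReal.coe_mul, NNReal.coe_natCast]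
        have h7 : ((i * M : ℕ) : ℝ) * T / (N * M : ℕ) - j * T / (N * M : ℕ) = - (k * X.δ) := by
          rw [hδr, ← hjik]
          push_cast
          field_simp
          ring
        rw [h7, abs_neg, abs_of_nonneg (by positivity)]
        exact hkδ
    rw [hjik] at h1
    have h8 := norm_add₃_le (a := X.euler j ω - X.euler (i * M) ω)
      (b := X.euler (i * M) ω - ξ (i * T / N) ω)
      (c := ξ (i * T / N) ω - ξ (j * T / (N * M : ℕ)) ω)
    have h9 : X.euler j ω - X.euler (i * M) ω + (X.euler (i * M) ω - ξ (i * T / N) ω) +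
        (ξ (i * T / N) ω - ξ (j * T / (N * M : ℕ)) ω) =
        X.euler j ω - ξ (j * T / (N * M : ℕ)) ω := by abel
    rw [h9] at h8
    linarith
  · calc _ ≤ P.real (⋃ i ∈ Finset.range (N + 1), {ω | ω ∈ X.alive (i * M) ∧
          ρ / 3 ≤ ‖X.euler (i * M) ω - ξ (i * T / N) ω‖}) := by
          refine measureReal_mono ?_ (measure_ne_top _ _)
          rintro ω ⟨h1, i, hi, h2⟩
          simp only [Set.mem_iUnion, Finset.mem_range]
          exact ⟨i, by omega, alive_antitone (Nat.mul_le_mul_right _ hi) h1, by linarith⟩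
      _ ≤ ∑ i ∈ Finset.range (N + 1), P.real {ω | ω ∈ X.alive (i * M) ∧
          ρ / 3 ≤ ‖X.euler (i * M) ω - ξ (i * T / N) ω‖} := measureReal_biUnion_finset_le _ _
      _ ≤ ∑ i ∈ Finset.range (N + 1), η / (3 * (N + 1)) :=
          Finset.sum_le_sum fun i hi => hcoarse i (by simpa [Nat.lt_succ_iff] using hi)
      _ ≤ η := by
          simp only [Finset.sum_const, Finset.card_range, nsmul_eq_mul, Nat.cast_add, Nat.cast_one]
          field_simp
          norm_num

end EulerData


/-! ## The contribution of the mode switches -/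

section Switching

variable {Ω E : Type*} {l : ℕ} {m : MeasurableSpace Ω} [mΩ : MeasurableSpace Ω] {P : Measure Ω}
  [IsProbabilityMeasure P] [NormedAddCommGroup E] [MeasurableSpace E] [BorelSpace E] {M M' : Ω → Fin l} {Z Z' : Ω → E} {F : Fin l → E → ℝ} {b h : ℝ}
  {q : Fin l → Ω → ℝ}

/-- The deviation of the conditional probability of `M' = i` from its first order approximation. -/
def transitionError (P : Measure Ω) (m : MeasurableSpace Ω) (M M' : Ω → Fin l) (q : Fin l → Ω → ℝ)
    (h : ℝ) (i : Fin l) (ω : Ω) : ℝ :=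
  |(P[fun ω' => if M' ω' = i then (1 : ℝ) else 0 | m]) ω -
    ((if M ω = i then (1 : ℝ) else 0) + q i ω * h)|

omit mΩ in
lemma measurable_ite_mode (hM : Measurable[m] M)
    (i : Fin l) : Measurable[m] fun ω => if M ω = i then (1 : ℝ) else 0 := by
  have h1 : Measurable fun a : Fin l => if a = i then (1 : ℝ) else 0 := measurable_of_finite _
  exact h1.comp hM

lemma integrable_ite_mode (hM : Measurable M) (i : Fin l) :
    Integrable (fun ω => if M ω = i then (1 : ℝ) else 0) P :=
  Integrable.of_bound (measurable_ite_mode hM i).aestronglyMeasurable 1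
    (ae_of_all _ fun ω => by split_ifs <;> simp)

lemma integrable_transitionError (hm : m ≤ mΩ) (hM : Measurable[m] M)
    (hq : ∀ i, Integrable (q i) P) (i : Fin l) :
    Integrable (transitionError P m M M' q h i) P :=
  (integrable_condExp.sub ((integrable_ite_mode (hM.mono hm le_rfl) i).add
    ((hq i).mul_const h))).abs

/-- The effect of a mode switch on a function of the mode and the state. -/
lemma setIntegral_switch_le (hm : m ≤ mΩ) (hM : Measurable[m] M) (hM' : Measurable M')
    (hZ : Measurable[m] Z) (hF : ∀ i, Continuous (F i)) (hFb : ∀ i x, |F i x| ≤ b)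
    (hZ' : Measurable Z') {ε C : ℝ}
    (hmod : ∀ i x y, |F i x - F i y| ≤ ε + C * ‖x - y‖ ^ 4)
    (hC : 0 ≤ C) (hint : Integrable (fun ω => ‖Z' ω - Z ω‖ ^ 4) P)
    (hq : ∀ i, Integrable (q i) P) (A : Set Ω) (hA : MeasurableSet[m] A) :
    ∫ ω in A, (F (M' ω) (Z' ω) - F (M ω) (Z' ω)) ∂P ≤
      ∫ ω in A, (h * ∑ i, q i ω * F i (Z ω) + (b * ∑ i, transitionError P m M M' q h i ω +
        2 * ε * {ω | M' ω ≠ M ω}.indicator 1 ω + 2 * C * ‖Z' ω - Z ω‖ ^ 4)) ∂P := by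
  have hMm := hM.mono hm le_rfl
  have hZm := hZ.mono hm le_rfl
  have hFm : Measurable fun y : Fin l × E => F y.1 y.2 :=
    measurable_from_prod_countable_right fun i => (hF i).measurable
  have hFi : ∀ {N : Ω → Fin l} {Y : Ω → E}, Measurable N → Measurable Y →
      Integrable (fun ω => F (N ω) (Y ω)) P := fun hN hY =>
    Integrable.of_bound (hFm.comp (hN.prodMk hY)).aestronglyMeasurable b
      (ae_of_all _ fun ω => hFb _ _)
  have hne : MeasurableSet {ω | M' ω ≠ M ω} := (measurableSet_eq_fun hM' hMm).compl
  have hE1 : Integrable (fun ω => 2 * ε * {ω | M' ω ≠ M ω}.indicator (1 : Ω → ℝ) ω) P :=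
    ((integrable_const (1 : ℝ)).indicator hne).const_mul _
  have hE2 : Integrable (fun ω => 2 * C * ‖Z' ω - Z ω‖ ^ 4) P := hint.const_mul _
  have hE0 : Integrable (fun ω => b * ∑ i, transitionError P m M M' q h i ω) P :=
    (integrable_finsetSum _ fun i _ => integrable_transitionError hm hM hq i).const_mul _
  have hqF : ∀ i, Integrable (fun ω => q i ω * F i (Z ω)) P := fun i =>
    (hq i).mul_bdd (c := b) ((hF i).measurable.comp hZm).aestronglyMeasurable
      (ae_of_all _ fun ω => hFb _ _)
  have hL : Integrable (fun ω => h * ∑ i, q i ω * F i (Z ω)) P :=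
    (integrable_finsetSum _ fun i _ => hqF i).const_mul _
  -- `F i (Z ω)` is known in `m`, so the indicator of `M' = i` may be replaced by its conditional
  -- probability, which differs from its first order approximation by `transitionError`.
  have hcond : ∀ i, ∫ ω in A, F i (Z ω) * (if M' ω = i then (1 : ℝ) else 0) ∂P ≤
      ∫ ω in A, (F i (Z ω) * (if M ω = i then (1 : ℝ) else 0) + h * (q i ω * F i (Z ω)) +
        b * transitionError P m M M' q h i ω) ∂P := by
    intro i
    have h1 := condExp_stronglyMeasurable_mul_of_bound hm (μ := P)
      (f := fun ω => F i (Z ω)) (g := fun ω => if M' ω = i then (1 : ℝ) else 0)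
      ((hF i).measurable.comp hZ).stronglyMeasurable (integrable_ite_mode hM' i) b
      (ae_of_all _ fun ω => hFb _ _)
    have h2 : Integrable ((fun ω => F i (Z ω)) * fun ω => if M' ω = i then (1 : ℝ) else 0) P :=
      (integrable_ite_mode hM' i).bdd_mul (c := b)
        ((hF i).measurable.comp hZm).aestronglyMeasurable (ae_of_all _ fun ω => hFb _ _)
    have h3 := setIntegral_condExp hm h2 hA
    have h4 : Integrable (fun ω => F i (Z ω) *
        (P[fun ω' => if M' ω' = i then (1 : ℝ) else 0 | m]) ω) P :=
      integrable_condExp.bdd_mul (c := b)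
        ((hF i).measurable.comp hZm).aestronglyMeasurable (ae_of_all _ fun ω => hFb _ _)
    have h5 : Integrable (fun ω => F i (Z ω) * (if M ω = i then (1 : ℝ) else 0)) P :=
      (integrable_ite_mode hMm i).bdd_mul (c := b)
        ((hF i).measurable.comp hZm).aestronglyMeasurable (ae_of_all _ fun ω => hFb _ _)
    calc _ = ∫ ω in A, F i (Z ω) *
          (P[fun ω' => if M' ω' = i then (1 : ℝ) else 0 | m]) ω ∂P :=
          h3.symm.trans (setIntegral_congr_ae (hm _ hA) (h1.mono fun ω hω _ => hω))
      _ ≤ _ := by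
        refine setIntegral_mono h4.integrableOn ((h5.add ((hqF i).const_mul h)).add
          ((integrable_transitionError hm hM hq i).const_mul b)).integrableOn fun ω => ?_
        set p := (P[fun ω' => if M' ω' = i then (1 : ℝ) else 0 | m]) ω
        set χ : ℝ := if M ω = i then (1 : ℝ) else 0
        have h6 : F i (Z ω) * (p - (χ + q i ω * h)) ≤ b * |p - (χ + q i ω * h)| :=
          (le_abs_self _).trans (by rw [abs_mul]; gcongr; exact hFb _ _)
        have h7 : transitionError P m M M' q h i ω = |p - (χ + q i ω * h)| := rfl
        rw [h7]
        linarith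
  have hsumF : ∀ (N : Ω → Fin l) ω, F (N ω) (Z ω) =
      ∑ i, F i (Z ω) * (if N ω = i then (1 : ℝ) else 0) := fun N ω => by simp
  have hI : ∀ {N : Ω → Fin l}, Measurable N → ∀ i,
      Integrable (fun ω => F i (Z ω) * (if N ω = i then (1 : ℝ) else 0)) P := fun hN i =>
    (integrable_ite_mode hN i).bdd_mul (c := b)
      ((hF i).measurable.comp hZm).aestronglyMeasurable (ae_of_all _ fun ω => hFb _ _)
  have hmain : ∫ ω in A, F (M' ω) (Z ω) ∂P ≤ ∫ ω in A, (F (M ω) (Z ω) +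
      h * ∑ i, q i ω * F i (Z ω) + b * ∑ i, transitionError P m M M' q h i ω) ∂P := by
    calc _ = ∑ i, ∫ ω in A, F i (Z ω) * (if M' ω = i then (1 : ℝ) else 0) ∂P := by
          rw [← integral_finsetSum _ fun i _ => (hI hM' i).integrableOn]
          exact integral_congr_ae (ae_of_all _ fun ω => hsumF M' ω)
      _ ≤ _ := Finset.sum_le_sum fun i _ => hcond i
      _ = _ := by
          have hsum : ∀ i, Integrable (fun ω => F i (Z ω) * (if M ω = i then (1 : ℝ) else 0) +
              h * (q i ω * F i (Z ω)) + b * transitionError P m M M' q h i ω) P := fun i =>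
            ((hI hMm i).add ((hqF i).const_mul h)).add
              ((integrable_transitionError hm hM hq i).const_mul b)
          rw [← integral_finsetSum _ fun i _ => (hsum i).integrableOn]
          refine integral_congr_ae (ae_of_all _ fun ω => ?_)
          simp only [Finset.sum_add_distrib, Finset.mul_sum]
          rw [← hsumF M ω]
  -- The state after the step is replaced by the one before it. Without a switch both differences
  -- vanish, so the tolerance `ε` is paid only on the switching event, whose probability is of order
  -- `h`.
  have hpt : ∀ ω, F (M' ω) (Z' ω) - F (M ω) (Z' ω) ≤ (F (M' ω) (Z ω) - F (M ω) (Z ω)) +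
      (2 * ε * {ω | M' ω ≠ M ω}.indicator 1 ω + 2 * C * ‖Z' ω - Z ω‖ ^ 4) := by
    intro ω
    by_cases hω : M' ω = M ω
    · simp only [hω, sub_self, ne_eq, Set.mem_ofPred_eq, not_true_eq_false, not_false_eq_true,
        Set.indicator_of_notMem, mul_zero, zero_add]
      positivity
    · have h1 := (abs_le.1 (hmod (M' ω) (Z' ω) (Z ω))).2
      have h2 := (abs_le.1 (hmod (M ω) (Z' ω) (Z ω))).1
      simp only [ne_eq, Set.mem_ofPred_eq, hω, not_false_eq_true, Set.indicator_of_mem,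
        Pi.one_apply, mul_one]
      linarith
  have hIM' := hFi hM' hZm
  have hIM := hFi hMm hZm
  have hd : Integrable (fun ω => F (M' ω) (Z ω) - F (M ω) (Z ω)) P := hIM'.sub hIM
  have hE : Integrable (fun ω => 2 * ε * {ω | M' ω ≠ M ω}.indicator 1 ω +
      2 * C * ‖Z' ω - Z ω‖ ^ 4) P := hE1.add hE2
  have hG : Integrable (fun ω => F (M ω) (Z ω) + h * ∑ i, q i ω * F i (Z ω) +
      b * ∑ i, transitionError P m M M' q h i ω) P := (hIM.add hL).add hE0
  have hGd : Integrable (fun ω => F (M ω) (Z ω) + h * ∑ i, q i ω * F i (Z ω) +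
      b * ∑ i, transitionError P m M M' q h i ω - F (M ω) (Z ω)) P := hG.sub hIM
  calc _ ≤ ∫ ω in A, ((F (M' ω) (Z ω) - F (M ω) (Z ω)) +
        (2 * ε * {ω | M' ω ≠ M ω}.indicator 1 ω + 2 * C * ‖Z' ω - Z ω‖ ^ 4)) ∂P :=
        setIntegral_mono ((hFi hM' hZ').sub (hFi hMm hZ')).integrableOn
          (hd.add hE).integrableOn hpt
    _ = (∫ ω in A, F (M' ω) (Z ω) ∂P - ∫ ω in A, F (M ω) (Z ω) ∂P) + ∫ ω in A,
        (2 * ε * {ω | M' ω ≠ M ω}.indicator 1 ω + 2 * C * ‖Z' ω - Z ω‖ ^ 4) ∂P := by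
        rw [integral_add hd.integrableOn hE.integrableOn,
          integral_sub hIM'.integrableOn hIM.integrableOn]
    _ ≤ (∫ ω in A, (F (M ω) (Z ω) +
        h * ∑ i, q i ω * F i (Z ω) + b * ∑ i, transitionError P m M M' q h i ω) ∂P -
        ∫ ω in A, F (M ω) (Z ω) ∂P) + ∫ ω in A,
        (2 * ε * {ω | M' ω ≠ M ω}.indicator 1 ω + 2 * C * ‖Z' ω - Z ω‖ ^ 4) ∂P := by gcongr
    _ = _ := by
        rw [← integral_sub hG.integrableOn hIM.integrableOn,
          ← integral_add hGd.integrableOn hE.integrableOn]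
        exact integral_congr_ae (ae_of_all _ fun ω => by ring)

/-- The probability of a mode switch. -/
lemma measureReal_switch_le (hm : m ≤ mΩ) (hM : Measurable[m] M) (hM' : Measurable M')
    (hh : 0 ≤ h) {c : ℝ} (hq : ∀ i, Integrable (q i) P) (hqc : ∀ i ω, |q i ω| ≤ c) :
    P.real {ω | M' ω ≠ M ω} ≤
      l * c * h + ∑ i, ∫ ω, transitionError P m M M' q h i ω ∂P := by
  have hMm := hM.mono hm le_rfl
  have hset : ∀ i, MeasurableSet[m] {ω | M ω ≠ i} := fun i =>
    (hM (measurableSet_singleton i)).compl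
  have hi : ∀ i, P.real {ω | M ω ≠ i ∧ M' ω = i} ≤
      c * h + ∫ ω, transitionError P m M M' q h i ω ∂P := by
    intro i
    have hnn : ∀ ω, 0 ≤ transitionError P m M M' q h i ω := fun ω => abs_nonneg _
    have hc : 0 ≤ c ∨ IsEmpty Ω := by
      rcases isEmpty_or_nonempty Ω with h | ⟨⟨ω⟩⟩
      · exact .inr h
      · exact .inl ((abs_nonneg _).trans (hqc i ω))
    have hqe : Integrable (fun ω => c * h + transitionError P m M M' q h i ω) P :=
      (integrable_const _).add (integrable_transitionError hm hM hq i)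
    calc P.real {ω | M ω ≠ i ∧ M' ω = i}
        = ∫ ω in {ω | M ω ≠ i}, (if M' ω = i then (1 : ℝ) else 0) ∂P := by
          have h1 : (fun ω => if M' ω = i then (1 : ℝ) else 0) =
              {ω | M' ω = i}.indicator 1 := by
            ext ω
            by_cases hω : M' ω = i <;> simp [hω]
          have h2 : MeasurableSet {ω | M' ω = i} := hM' (measurableSet_singleton i)
          rw [h1, integral_indicator_one h2, measureReal_restrict_apply h2]
          congr 1
          ext ω
          simp [and_comm]
      _ = ∫ ω in {ω | M ω ≠ i}, (P[fun ω' => if M' ω' = i then (1 : ℝ) else 0 | m]) ω ∂P :=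
          (setIntegral_condExp hm (integrable_ite_mode hM' i) (hset i)).symm
      _ ≤ ∫ ω in {ω | M ω ≠ i}, (c * h + transitionError P m M M' q h i ω) ∂P := by
          refine setIntegral_mono_on integrable_condExp.integrableOn hqe.integrableOn
            (hm _ (hset i)) fun ω hω => ?_
          have h1 := le_abs_self ((P[fun ω' => if M' ω' = i then (1 : ℝ) else 0 | m]) ω -
            ((if M ω = i then (1 : ℝ) else 0) + q i ω * h))
          rw [if_neg hω, zero_add] at h1
          have h2 : q i ω * h ≤ c * h := by
            gcongr
            exact (le_abs_self _).trans (hqc i ω)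
          simp only [transitionError, if_neg hω, zero_add]
          linarith
      _ ≤ ∫ ω, (c * h + transitionError P m M M' q h i ω) ∂P := by
          refine setIntegral_le_integral hqe (ae_of_all _ fun ω => ?_)
          have hc' : 0 ≤ c := hc.resolve_right fun h => h.false ω
          exact add_nonneg (mul_nonneg hc' hh) (hnn ω)
      _ = _ := by
          rw [integral_add (integrable_const _) (integrable_transitionError hm hM hq i)]
          simp
  calc P.real {ω | M' ω ≠ M ω} ≤ P.real (⋃ i, {ω | M ω ≠ i ∧ M' ω = i}) := by
        refine measureReal_mono (fun ω hω => ?_) (measure_ne_top _ _)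
        simp only [Set.mem_iUnion]
        exact ⟨M' ω, fun h => hω h.symm, rfl⟩
    _ ≤ ∑ i, P.real {ω | M ω ≠ i ∧ M' ω = i} := measureReal_iUnion_fintype_le _
    _ ≤ ∑ i, (c * h + ∫ ω, transitionError P m M M' q h i ω ∂P) :=
        Finset.sum_le_sum fun i _ => hi i
    _ = _ := by
        rw [Finset.sum_add_distrib]
        simp [mul_assoc]

end Switching


/-! ### Uniform bounds and moduli for compactly supported functions -/

/-- Uniform continuity handles short distances; beyond `ρ` the bound `M` is at most `M / ρ ^ 4 * ‖x
- y‖ ^ 4`. The fourth power makes the remainder `o(δ)` in mean along a step, which a square would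
not. -/
lemma exists_fourth_power_modulus {ι E : Type*} [Finite ι] [NormedAddCommGroup E] {F : ι → E → ℝ}
    (hF : ∀ i, Continuous (F i)) (hFc : ∀ i, HasCompactSupport (F i)) {ε : ℝ} (hε : 0 < ε) :
    ∃ C : ℝ, 0 ≤ C ∧ ∀ i x y, |F i x - F i y| ≤ ε + C * ‖x - y‖ ^ 4 := by
  cases nonempty_fintype ι
  choose ρ M hρ hM0 _ hM hρε using fun i => exists_modulus (hF i) (hFc i) hε
  have hnn : ∀ i, 0 ≤ M i / ρ i ^ 4 := fun i => div_nonneg (hM0 i) (pow_nonneg (hρ i).le 4)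
  refine ⟨∑ i, M i / ρ i ^ 4, Finset.sum_nonneg fun i _ => hnn i, fun i x y => ?_⟩
  have hle : M i / ρ i ^ 4 ≤ ∑ i, M i / ρ i ^ 4 :=
    Finset.single_le_sum (f := fun i => M i / ρ i ^ 4) (fun j _ => hnn j) (Finset.mem_univ i)
  have hsum := (hnn i).trans hle
  rw [← Real.norm_eq_abs]
  rcases lt_or_ge ‖x - y‖ (ρ i) with h | h
  · exact (hρε i x y h).trans (le_add_of_nonneg_right (by positivity))
  · have h1 : M i ≤ M i / ρ i ^ 4 * ‖x - y‖ ^ 4 := by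
      have := hρ i
      rw [div_mul_eq_mul_div, le_div_iff₀ (by positivity)]
      have := hM0 i
      gcongr
    have h2 : M i / ρ i ^ 4 * ‖x - y‖ ^ 4 ≤ (∑ i, M i / ρ i ^ 4) * ‖x - y‖ ^ 4 := by gcongr
    linarith [hM i x y]

lemma exists_bound_of_compactSupport {ι E : Type*} [Finite ι] [NormedAddCommGroup E]
    {F : ι → E → ℝ} (hF : ∀ i, Continuous (F i)) (hFc : ∀ i, HasCompactSupport (F i)) :
    ∃ b : ℝ, 0 ≤ b ∧ ∀ i x, |F i x| ≤ b :=
  exists_uniform_bound_of_finite (fun i x => |F i x|) fun i => by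
    obtain ⟨M, hM⟩ := (hF i).bounded_above_of_compact_support (hFc i)
    exact ⟨M, hM⟩

namespace EulerData

variable {n r l : ℕ} {Ω : Type*}

/-- The expected change, due to a mode switch during a step, of a function of the mode and the state
is given by the rates `Λ`, up to an error of mean `η δ`. -/
def SwitchControl [mΩ : MeasurableSpace Ω] (X : EulerData n r l Ω) (P : Measure Ω)
    (𝔽 : Filtration ℝ≥0 mΩ) (Λ : Fin l → Fin l → EuclideanSpace ℝ (Fin n) → ℝ)
    (F : Fin l → EuclideanSpace ℝ (Fin n) → ℝ) (η : ℝ) (j : ℕ) : Prop :=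
  ∃ e : Ω → ℝ, Integrable e P ∧ (∀ ω, 0 ≤ e ω) ∧ ∫ ω, e ω ∂P ≤ η * X.δ ∧
    Integrable (fun ω => ∑ i, Λ (X.μ (X.u j) ω) i (X.ξ (X.u j) ω) * F i (X.euler j ω)) P ∧
    ∀ A, MeasurableSet[𝔽 (X.u j)] A →
      ∫ ω in A, (F (X.μ (X.u (j + 1)) ω) (X.euler (j + 1) ω) -
        F (X.μ (X.u j) ω) (X.euler (j + 1) ω)) ∂P ≤
      ∫ ω in A, (X.δ * ∑ i, Λ (X.μ (X.u j) ω) i (X.ξ (X.u j) ω) * F i (X.euler j ω) + e ω) ∂P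

variable [mΩ : MeasurableSpace Ω] {P : Measure Ω} [IsProbabilityMeasure P]
  {𝔽 : Filtration ℝ≥0 mΩ}

omit [IsProbabilityMeasure P] in
-- A function that ignores the mode does not notice a switch. With zero rates, this is how
-- deterministic signals enter the common argument.
lemma switchControl_zero {X : EulerData n r l Ω} {F : Fin l → EuclideanSpace ℝ (Fin n) → ℝ}
    (hF : ∀ i i', F i = F i') {η : ℝ} (hη : 0 ≤ η) (j : ℕ) :
    X.SwitchControl P 𝔽 (fun _ _ _ => 0) F η j := by
  refine ⟨fun _ => 0, integrable_zero _ _ _, fun _ => le_rfl, ?_, by simp, fun A _ => ?_⟩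
  · rw [integral_zero]
    positivity
  · simp [fun ω => hF (X.μ (X.u (j + 1)) ω) (X.μ (X.u j) ω)]

/-- Three errors share `η δ` equally: the remainder in the transition probabilities, the modulus of
`F` on the event of a switch, and the fourth moment of the step. -/
lemma exists_switchControl {S : SwitchedSystem n r l}
    {Λ : Fin l → Fin l → EuclideanSpace ℝ (Fin n) → ℝ} (hΛ : IsTransitionRate Λ)
    {W : ℝ≥0 → Ω → EuclideanSpace ℝ (Fin r)} (hW : IsBrownianMotion P 𝔽 W) {μ : ℝ≥0 → Ω → Fin l}
    {x₀ : EuclideanSpace ℝ (Fin n)} {ξ : ℝ≥0 → Ω → EuclideanSpace ℝ (Fin n)}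
    (hS : S.IsRateSolution Λ P 𝔽 W μ x₀ ξ) {T : ℝ≥0} (hT : 0 < T) (R : ℝ≥0)
    {F : Fin l → EuclideanSpace ℝ (Fin n) → ℝ} (hF : ∀ i, Continuous (F i))
    (hFc : ∀ i, HasCompactSupport (F i)) {η : ℝ} (hη : 0 < η) :
    ∃ δ₀ : ℝ, 0 < δ₀ ∧ ∀ K : ℕ, 0 < K → (T : ℝ) / K ≤ δ₀ → ∀ j < K,
      (ofGrid S W μ ξ T R K).SwitchControl P 𝔽 Λ F η j := by
  have hΛc : ∀ i i', Continuous (Λ i i') := fun i i' => (hΛ.lipschitz i i').choose_spec.continuous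
  obtain ⟨b, hb0, hb⟩ := exists_bound_of_compactSupport hF hFc
  obtain ⟨c, hc0, hc⟩ := exists_uniform_bound_of_finite
    (fun (i : Fin l × Fin l) x => |Λ i.1 i.2 x|) fun i => hΛ.bounded i.1 i.2
  obtain ⟨C₁, hC₁0, hC₁⟩ := S.exists_coeff_bound Λ hΛc R
  obtain ⟨κ, hκ, hmom⟩ := Compatible.exists_step_moment n r C₁
  -- A switch has probability at most `(l * c + l) δ`, using `ε' ≤ 1` below, so `2 ε` times it is at
  -- most `η δ / 3`.
  set ε : ℝ := η / (6 * (l * c + l + 1)) with hε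
  have hε0 : 0 < ε := by positivity
  obtain ⟨C, hC0, hC⟩ := exists_fourth_power_modulus hF hFc hε0
  set ε' : ℝ := min 1 (η / (3 * (b * l + 1))) with hε'
  have hε'0 : 0 < ε' := by positivity
  choose δ₁ hδ₁0 hδ₁ using fun i => hS.transition i T ε' hε'0
  obtain ⟨δ₂, hδ₂, hle⟩ : ∃ δ₂ > 0, ∀ i, δ₂ ≤ δ₁ i := by
    rcases isEmpty_or_nonempty (Fin l) with h | h
    · exact ⟨1, one_pos, fun m => h.elim m⟩
    · obtain ⟨i₀, hi₀⟩ := Finite.exists_min δ₁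
      exact ⟨δ₁ i₀, hδ₁0 i₀, hi₀⟩
  -- Halving `δ₂` yields the strict inequality demanded of the step in `transition`; the last entry
  -- makes the fourth moment term at most `η δ / 3`.
  refine ⟨min (δ₂ / 2) (min 1 (η / (6 * (C * κ + 1)))), by positivity, fun K hK hδ j hj => ?_⟩
  set X := ofGrid S W μ ξ T R K with hX
  have hcomp : X.Compatible P 𝔽 := ofGrid_compatible hS.solves.adapted hS.mode_adapted hW _
  have hXC : X.CoeffBound C₁ := fun x hx => ⟨(hC₁ x hx).1, (hC₁ x hx).2.1⟩
  have hXδ : (X.δ : ℝ) = T / K := by simp [hX, ofGrid]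
  rw [← hXδ] at hδ
  have hδ0 : 0 < X.δ := by
    have : (0 : ℝ≥0) < K := by exact_mod_cast hK
    simp only [hX, ofGrid]
    positivity
  have hδ0' : (0 : ℝ) < X.δ := hδ0
  have hδ1 : X.δ ≤ 1 := by
    have : (X.δ : ℝ) ≤ 1 := hδ.trans ((min_le_right _ _).trans (min_le_left _ _))
    exact_mod_cast this
  have hδ2 : ∀ i, X.δ < δ₁ i := fun i => by
    have h1 : (X.δ : ℝ) ≤ δ₂ / 2 := hδ.trans (min_le_left _ _)
    have h2 : (δ₂ : ℝ) ≤ δ₁ i := by exact_mod_cast hle i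
    have h3 : (0 : ℝ) < δ₂ := hδ₂
    have : (X.δ : ℝ) < δ₁ i := by linarith
    exact_mod_cast this
  have hδ3 : (X.δ : ℝ) ≤ η / (6 * (C * κ + 1)) :=
    hδ.trans ((min_le_right _ _).trans (min_le_right _ _))
  have huT : X.u j ≤ T := by
    have hK' : (0 : ℝ≥0) < K := by exact_mod_cast hK
    have hj' : (j : ℝ≥0) ≤ K := by exact_mod_cast hj.le
    simp only [hX, ofGrid]
    rw [div_le_iff₀ hK', mul_comm]
    gcongr
  set q : Fin l → Ω → ℝ := fun i ω => Λ (X.μ (X.u j) ω) i (X.ξ (X.u j) ω) with hq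
  have hqm : ∀ i, Measurable (q i) := fun i => by
    have h1 : Measurable fun y : Fin l × EuclideanSpace ℝ (Fin n) => Λ y.1 i y.2 :=
      measurable_from_prod_countable_right fun m => (hΛc m i).measurable
    exact h1.comp (((hcomp.measurable_μ _).mono (𝔽.le _) le_rfl).prodMk
      ((hcomp.measurable_ξ _).mono (𝔽.le _) le_rfl))
  have hqc : ∀ i ω, |q i ω| ≤ c := fun i ω => hc (_, i) _
  have hqi : ∀ i, Integrable (q i) P := fun i =>
    Integrable.of_bound (hqm i).aestronglyMeasurable c (ae_of_all _ (hqc i))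
  have hM := hcomp.measurable_μ (X.u j)
  have hM' : Measurable (X.μ (X.u (j + 1))) := (hcomp.measurable_μ _).mono (𝔽.le _) le_rfl
  have hZm := (hcomp.measurable_euler j).mono (𝔽.le _) le_rfl
  have hZm' := (hcomp.measurable_euler (j + 1)).mono (𝔽.le _) le_rfl
  have hstep : ∀ ω, X.euler (j + 1) ω - X.euler j ω = X.step j ω := fun ω => by simp [euler]
  obtain ⟨⟨hi4, hm4⟩, -⟩ := hmom l Ω P 𝔽 X hcomp hXC hδ1 hC₁0 j
  have hi4' : Integrable (fun ω => ‖X.euler (j + 1) ω - X.euler j ω‖ ^ 4) P := by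
    simpa only [hstep] using hi4
  have htr : ∀ i, ∫ ω, transitionError P (𝔽 (X.u j)) (X.μ (X.u j)) (X.μ (X.u (j + 1))) q X.δ i ω ∂P
      ≤ ε' * X.δ := fun i => by
    rw [hcomp.u_succ]
    exact hδ₁ i (X.u j) X.δ huT hδ0 (hδ2 i)
  have htri := fun i => integrable_transitionError (𝔽.le (X.u j)) hM hqi
    (M' := X.μ (X.u (j + 1))) (h := X.δ) i
  have hsw := measureReal_switch_le (𝔽.le (X.u j)) hM hM' X.δ.coe_nonneg hqi hqc
  have hsum : ∑ i, ∫ ω, transitionError P (𝔽 (X.u j)) (X.μ (X.u j)) (X.μ (X.u (j + 1)))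
      q X.δ i ω ∂P ≤ l * (ε' * X.δ) :=
    (Finset.sum_le_sum fun i _ => htr i).trans_eq (by simp)
  have hne : MeasurableSet {ω | X.μ (X.u (j + 1)) ω ≠ X.μ (X.u j) ω} :=
    (measurableSet_eq_fun hM' (hM.mono (𝔽.le _) le_rfl)).compl
  have hE0 : Integrable (fun ω => b * ∑ i, transitionError P (𝔽 (X.u j)) (X.μ (X.u j))
      (X.μ (X.u (j + 1))) q X.δ i ω) P := (integrable_finsetSum _ fun i _ => htri i).const_mul _
  have hE1 : Integrable (fun ω => 2 * ε *
      {ω | X.μ (X.u (j + 1)) ω ≠ X.μ (X.u j) ω}.indicator (1 : Ω → ℝ) ω) P :=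
    ((integrable_const (1 : ℝ)).indicator hne).const_mul _
  have hE01 : Integrable (fun ω => b * ∑ i, transitionError P (𝔽 (X.u j)) (X.μ (X.u j))
      (X.μ (X.u (j + 1))) q X.δ i ω + 2 * ε *
      {ω | X.μ (X.u (j + 1)) ω ≠ X.μ (X.u j) ω}.indicator (1 : Ω → ℝ) ω) P := hE0.add hE1
  have hE2 : Integrable (fun ω => 2 * C * ‖X.euler (j + 1) ω - X.euler j ω‖ ^ 4) P :=
    hi4'.const_mul _
  refine ⟨_, hE01.add hE2, fun ω => ?_, ?_, ?_, fun A hA => setIntegral_switch_le (𝔽.le (X.u j)) hM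
    hM' (hcomp.measurable_euler j) hF hb hZm' hC hC0 hi4' hqi A hA⟩
  · have h1 : ∀ i, 0 ≤ transitionError P (𝔽 (X.u j)) (X.μ (X.u j)) (X.μ (X.u (j + 1)))
      q X.δ i ω := fun i => abs_nonneg _
    have h2 := Finset.sum_nonneg fun i (_ : i ∈ Finset.univ) => h1 i
    have h3 : 0 ≤ {ω | X.μ (X.u (j + 1)) ω ≠ X.μ (X.u j) ω}.indicator (1 : Ω → ℝ) ω :=
      Set.indicator_nonneg (fun _ _ => zero_le_one) _
    simp only [Pi.add_apply]
    positivity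
  · simp only [Pi.add_apply]
    rw [integral_add hE01 hE2, integral_add hE0 hE1, integral_const_mul, integral_const_mul,
      integral_const_mul, integral_finsetSum _ fun i _ => htri i, integral_indicator_one hne]
    simp only [hstep]
    have hl : (0 : ℝ) ≤ l := Nat.cast_nonneg l
    set d : ℝ := (X.δ : ℝ) with hd
    have hε'1 : ε' ≤ 1 := min_le_left _ _
    have e1 : b * (l * ε') ≤ η / 3 := by
      have h1 : ε' ≤ η / (3 * (b * l + 1)) := min_le_right _ _
      have h2 : (b * l) * ε' ≤ (b * l + 1) * (η / (3 * (b * l + 1))) := by gcongr; linarith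
      have h3 : (b * l + 1) * (η / (3 * (b * l + 1))) = η / 3 := by field_simp
      nlinarith
    have e2 : 2 * ε * (l * c + l) ≤ η / 3 := by
      have h3 : 2 * ε * (l * c + l + 1) = η / 3 := by rw [hε]; field_simp; norm_num
      nlinarith
    have e3 : 2 * C * (κ * d) ≤ η / 3 := by
      have h2 : (C * κ) * d ≤ (C * κ + 1) * (η / (6 * (C * κ + 1))) := by gcongr; linarith
      have h3 : (C * κ + 1) * (η / (6 * (C * κ + 1))) = η / 6 := by field_simp
      nlinarith
    have hpr : P.real {ω | X.μ (X.u (j + 1)) ω ≠ X.μ (X.u j) ω} ≤ (l * c + l) * d := by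
      have : l * (ε' * d) ≤ l * (1 * d) := by gcongr
      linarith
    calc _ ≤ b * (l * (ε' * d)) + 2 * ε * ((l * c + l) * d) + 2 * C * (κ * d ^ 2) := by gcongr
      _ = (b * (l * ε') + 2 * ε * (l * c + l) + 2 * C * (κ * d)) * d := by ring
      _ ≤ (η / 3 + η / 3 + η / 3) * d := by gcongr
      _ = _ := by ring
  · exact integrable_finsetSum _ fun i _ => (hqi i).mul_bdd (c := b)
      ((hF i).measurable.comp hZm).aestronglyMeasurable (ae_of_all _ fun ω => hb _ _)

end EulerData


/-! ## The supermartingales of localized certificates -/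

namespace EulerData

variable {n r l : ℕ} {Ω : Type*}

/-- A localized certificate along the Euler scheme. -/
def stage (X : EulerData n r l Ω) (C : BarrierCert n l) (e : ℕ → Ω → ℝ) : Stage Ω where
  V j ω := C.localized X.R (X.μ (X.u j) ω) (X.euler j ω)
  γ := C.γ
  c := C.c
  e := e

variable [mΩ : MeasurableSpace Ω] {P : Measure Ω} [IsProbabilityMeasure P]
  {𝔽 : Filtration ℝ≥0 mΩ}

set_option maxHeartbeats 1000000 in
/-- If the Euler scheme stays close to the solution process, in probability, then the localized
certificate along the scheme is an approximate supermartingale. -/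
lemma exists_isSupermartingale {S : SwitchedSystem n r l}
    {Λ : Fin l → Fin l → EuclideanSpace ℝ (Fin n) → ℝ} (hΛ : ∀ i i', Continuous (Λ i i'))
    {W : ℝ≥0 → Ω → EuclideanSpace ℝ (Fin r)} {μ : ℝ≥0 → Ω → Fin l}
    {ξ : ℝ≥0 → Ω → EuclideanSpace ℝ (Fin n)} {T : ℝ≥0} (hT : 0 < T) (R : ℝ≥0)
    {C : BarrierCert n l} (hC : C.Valid S Λ)
    (hsw : ∀ η : ℝ, 0 < η → ∃ δ₀ : ℝ, 0 < δ₀ ∧ ∀ K : ℕ, 0 < K → (T : ℝ) / K ≤ δ₀ → ∀ j < K,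
      (ofGrid S W μ ξ T R K).SwitchControl P 𝔽 Λ (C.localized R) η j) {η : ℝ} (hη : 0 < η) :
    ∃ τ : ℝ, 0 < τ ∧ ∀ (K : ℕ) (hcomp : (ofGrid S W μ ξ T R K).Compatible P 𝔽),
      0 < K → (T : ℝ) / K ≤ τ →
      (∀ j ≤ K, P.real {ω | ω ∈ (ofGrid S W μ ξ T R K).alive j ∧
        τ ≤ ‖(ofGrid S W μ ξ T R K).euler j ω - ξ (j * T / K) ω‖} ≤ τ) →
      ∃ e, ((ofGrid S W μ ξ T R K).stage C e).IsSupermartingale P hcomp.filtration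
        (ofGrid S W μ ξ T R K).alive K ((T : ℝ) / K) ∧
        ∑ j ∈ Finset.range K, ∫ ω, e j ω ∂P ≤ η := by
  have hT' : (0 : ℝ) < T := hT
  have hF := fun m => hC.contDiff_localized R m
  have hFc := fun m => C.hasCompactSupport_localized R m
  have hFcont := fun m => (hF m).continuous
  obtain ⟨b, hb0, hb⟩ := exists_bound_of_compactSupport hFcont hFc
  obtain ⟨G, hG0, hG⟩ := S.exists_mixedGenerator_bound hΛ hF hFc R
  obtain ⟨C₁, hC₁0, hC₁⟩ := S.exists_coeff_bound Λ hΛ R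
  -- Each step has four errors of at most `ε δ`: Taylor expansion, modulus of the generator, bad
  -- event and mode switch. Since the `K` steps have total length `T`, they sum to `η`.
  set ε : ℝ := η / (4 * T) with hε
  have hε0 : 0 < ε := by positivity
  obtain ⟨ρ, hρ, hmod⟩ := S.exists_mixedGenerator_modulus hΛ hF R hε0
  choose δ₁ hδ₁0 hδ₁ using fun m => exists_abs_integral_gaussianVec_sub_le r (hF m) (hFc m) hC₁0 hε0
  obtain ⟨δ₂, hδ₂, hle⟩ : ∃ δ₂ > 0, ∀ i, δ₂ ≤ δ₁ i := by
    rcases isEmpty_or_nonempty (Fin l) with h | h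
    · exact ⟨1, one_pos, fun m => h.elim m⟩
    · obtain ⟨i₀, hi₀⟩ := Finite.exists_min δ₁
      exact ⟨δ₁ i₀, hδ₁0 i₀, hi₀⟩
  obtain ⟨δ₃, hδ₃, hswitch⟩ := hsw ε hε0
  have hδ₂' : (0 : ℝ) < δ₂ := hδ₂
  refine ⟨min ρ (min (ε / (G + 1)) (min δ₂ δ₃)), by positivity,
    fun K hcomp hK hτ hclose => ?_⟩
  set X := ofGrid S W μ ξ T R K with hX
  set τ := min ρ (min (ε / (G + 1)) (min (δ₂ : ℝ) δ₃))
  have hXC : X.CoeffBound C₁ := fun x hx => ⟨(hC₁ x hx).1, (hC₁ x hx).2.1⟩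
  have hXδ : (X.δ : ℝ) = T / K := by simp [hX, ofGrid]
  have hKr : (0 : ℝ) < K := by exact_mod_cast hK
  rw [← hXδ] at hτ ⊢
  have hδ2 : ∀ i, X.δ ≤ δ₁ i := fun i => by
    have h1 : (X.δ : ℝ) ≤ δ₂ :=
      hτ.trans ((min_le_right _ _).trans ((min_le_right _ _).trans (min_le_left _ _)))
    have h2 : X.δ ≤ δ₂ := by exact_mod_cast h1
    exact h2.trans (hle i)
  have hδ3 : (T : ℝ) / K ≤ δ₃ := by
    rw [← hXδ]
    exact hτ.trans ((min_le_right _ _).trans ((min_le_right _ _).trans (min_le_right _ _)))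
  have hsc : ∀ j, ∃ e : Ω → ℝ, Integrable e P ∧ (∀ ω, 0 ≤ e ω) ∧ (j < K → ∫ ω, e ω ∂P ≤ ε * X.δ ∧
      Integrable (fun ω => ∑ i, Λ (X.μ (X.u j) ω) i (X.ξ (X.u j) ω) *
        C.localized R i (X.euler j ω)) P ∧
      ∀ A, MeasurableSet[𝔽 (X.u j)] A →
        ∫ ω in A, (C.localized R (X.μ (X.u (j + 1)) ω) (X.euler (j + 1) ω) -
          C.localized R (X.μ (X.u j) ω) (X.euler (j + 1) ω)) ∂P ≤
        ∫ ω in A, (X.δ * ∑ i, Λ (X.μ (X.u j) ω) i (X.ξ (X.u j) ω) *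
          C.localized R i (X.euler j ω) + e ω) ∂P) := by
    intro j
    by_cases hj : j < K
    · obtain ⟨e, h1, h2, h3⟩ := hswitch K hK hδ3 j hj
      exact ⟨e, h1, h2, fun _ => h3⟩
    · exact ⟨0, integrable_zero _ _ _, fun _ => le_rfl, fun h => absurd h hj⟩
  choose e he he0 hsc using hsc
  -- Where the scheme has strayed from `ξ`, only the crude bound `G` of the mixed generator is
  -- available, but this event has probability at most `ε / (G + 1)`. Closeness at each single time
  -- suffices, as the errors are added in mean.
  set bad : ℕ → Set Ω := fun j => {ω | ω ∈ X.alive j ∧ τ ≤ ‖X.euler j ω - X.ξ (X.u j) ω‖} with hbad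
  have hbadm : ∀ j, MeasurableSet (bad j) := fun j => by
    have h1 : Measurable fun ω => ‖X.euler j ω - X.ξ (X.u j) ω‖ :=
      (((hcomp.measurable_euler j).mono (𝔽.le _) le_rfl).sub
        ((hcomp.measurable_ξ _).mono (𝔽.le _) le_rfl)).norm
    exact (𝔽.le _ _ (hcomp.measurableSet_alive j)).inter (h1 measurableSet_Ici)
  have hbi : ∀ j, Integrable (fun ω => X.δ * G * (bad j).indicator (1 : Ω → ℝ) ω) P := fun j =>
    ((integrable_const (1 : ℝ)).indicator (hbadm j)).const_mul _
  have hei : ∀ j, Integrable (fun ω => X.δ * (2 * ε) + X.δ * G * (bad j).indicator 1 ω + e j ω) P :=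
    fun j => ((integrable_const _).add (hbi j)).add (he j)
  have hFm : Measurable fun y : Fin l × EuclideanSpace ℝ (Fin n) => C.localized R y.1 y.2 :=
    measurable_from_prod_countable_right fun i => (hFcont i).measurable
  have hVm : ∀ j, Measurable[𝔽 (X.u j)] fun ω => C.localized R (X.μ (X.u j) ω) (X.euler j ω) :=
    fun j => hFm.comp ((hcomp.measurable_μ _).prodMk (hcomp.measurable_euler j))
  have hVi : ∀ i j, Integrable (fun ω => C.localized R (X.μ (X.u i) ω) (X.euler j ω)) P :=
    fun i j => Integrable.of_bound (hFm.comp (((hcomp.measurable_μ _).mono (𝔽.le _) le_rfl).prodMk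
      ((hcomp.measurable_euler j).mono (𝔽.le _) le_rfl))).aestronglyMeasurable b
      (ae_of_all _ fun ω => hb _ _)
  refine ⟨fun j ω => X.δ * (2 * ε) + X.δ * G * (bad j).indicator 1 ω + e j ω, ?_, ?_⟩
  · refine ⟨hVm, fun j => hVi j j, fun j ω => hC.localized_nonneg _ _, hC.γ_nonneg, hC.c_nonneg,
      hei, fun j ω => ?_, fun j hj A hA hAD => ?_⟩
    · have h1 : 0 ≤ (bad j).indicator (1 : Ω → ℝ) ω :=
        Set.indicator_nonneg (fun _ _ => zero_le_one) _
      have h2 := he0 j ω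
      change 0 ≤ X.δ * (2 * ε) + X.δ * G * (bad j).indicator (1 : Ω → ℝ) ω + e j ω
      positivity
    · obtain ⟨-, hLi, hsA⟩ := hsc j hj
      set L : Ω → ℝ := fun ω => ∑ i, Λ (X.μ (X.u j) ω) i (X.ξ (X.u j) ω) *
        C.localized R i (X.euler j ω) with hL
      -- The Gaussian step controls the generator without the rate term, hence the subtraction of
      -- `L`; the mode switch returns `δ L`.
      have hh : Integrable (fun ω => C.c + ε + G * (bad j).indicator (1 : Ω → ℝ) ω - L ω) P :=
        ((integrable_const _).add
          (((integrable_const (1 : ℝ)).indicator (hbadm j)).const_mul _)).sub hLi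
      have hstep := setIntegral_step_sub_le (hcomp.measurable_incr j) (𝔽.le (X.u j))
        (hcomp.indep_incr j) (hcomp.map_incr j) (hcomp.measurable_drift j)
        (hcomp.measurable_diffusion j) (norm_drift_le hC₁0 hXC j) (norm_diffusion_le hC₁0 hXC j)
        (hcomp.measurable_euler j) (hcomp.measurable_μ (X.u j)) hFcont hb
        (fun i z a β ha hβ => hδ₁ i X.δ (hδ2 i) z a β ha hβ) hA hh (fun ω hω => by
          have hωD : ω ∈ X.alive j := hAD hω
          have hR : ‖X.ξ (X.u j) ω‖ ≤ R := hωD j le_rfl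
          have hmix : X.S.mixedGenerator Λ (C.localized R) (X.μ (X.u j) ω) (X.ξ (X.u j) ω)
              (X.euler j ω) ≤ C.c + ε + G * (bad j).indicator (1 : Ω → ℝ) ω := by
            by_cases hωb : ω ∈ bad j
            · rw [Set.indicator_of_mem hωb]
              have h1 := (abs_le.1 (hG (X.μ (X.u j) ω) (X.ξ (X.u j) ω) (X.euler j ω) hR)).2
              have h2 := hC.c_nonneg
              simp only [Pi.one_apply, mul_one]
              exact h1.trans (by linarith)
            · rw [Set.indicator_of_notMem hωb]
              have h1 : ‖X.euler j ω - X.ξ (X.u j) ω‖ < ρ := by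
                by_contra hcon
                exact hωb ⟨hωD, (min_le_left _ _).trans (not_lt.1 hcon)⟩
              have h2 := hmod (X.μ (X.u j) ω) (X.ξ (X.u j) ω) (X.euler j ω) hR h1
              have h3 := hC.mixedGenerator_localized_le (X.μ (X.u j) ω) hR
              have h4 : S.mixedGenerator Λ (C.localized R) (X.μ (X.u j) ω) (X.ξ (X.u j) ω)
                (X.euler j ω) ≤ C.c + ε := by linarith
              simp only [mul_zero, add_zero]
              exact h4
          rw [drift, diffusion, Set.indicator_of_mem hωD, Set.indicator_of_mem hωD]
          simp only [SwitchedSystem.mixedGenerator] at hmix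
          simp only [hL]
          linarith)
      have hd1 : Integrable (fun ω => C.localized R (X.μ (X.u j) ω) (X.euler (j + 1) ω) -
          C.localized R (X.μ (X.u j) ω) (X.euler j ω)) P := (hVi j (j + 1)).sub (hVi j j)
      have hd2 : Integrable (fun ω => C.localized R (X.μ (X.u (j + 1)) ω) (X.euler (j + 1) ω) -
          C.localized R (X.μ (X.u j) ω) (X.euler (j + 1) ω)) P :=
        (hVi (j + 1) (j + 1)).sub (hVi j (j + 1))
      have hd3 : Integrable (fun ω => X.δ * (C.c + ε + G * (bad j).indicator (1 : Ω → ℝ) ω - L ω) +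
          ε * X.δ) P := (hh.const_mul _).add (integrable_const _)
      have hd4 : Integrable (fun ω => X.δ * L ω + e j ω) P := (hLi.const_mul _).add (he j)
      have hd12 : Integrable (fun ω =>
          (C.localized R (X.μ (X.u j) ω) (X.euler (j + 1) ω) -
            C.localized R (X.μ (X.u j) ω) (X.euler j ω)) +
          (C.localized R (X.μ (X.u (j + 1)) ω) (X.euler (j + 1) ω) -
            C.localized R (X.μ (X.u j) ω) (X.euler (j + 1) ω))) P := hd1.add hd2
      have hd34 : Integrable (fun ω => (X.δ * (C.c + ε + G * (bad j).indicator (1 : Ω → ℝ) ω -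
          L ω) + ε * X.δ) + (X.δ * L ω + e j ω)) P := hd3.add hd4
      -- The increment splits into a motion of the state in the old mode and a change of mode at the
      -- new state.
      calc ∫ ω in A, (X.stage C _).V (j + 1) ω ∂P
          = ∫ ω in A, C.localized R (X.μ (X.u j) ω) (X.euler j ω) ∂P +
            (∫ ω in A, (C.localized R (X.μ (X.u j) ω) (X.euler (j + 1) ω) -
              C.localized R (X.μ (X.u j) ω) (X.euler j ω)) ∂P +
            ∫ ω in A, (C.localized R (X.μ (X.u (j + 1)) ω) (X.euler (j + 1) ω) -
              C.localized R (X.μ (X.u j) ω) (X.euler (j + 1) ω)) ∂P) := by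
            rw [← integral_add hd1.integrableOn hd2.integrableOn,
              ← integral_add (hVi j j).integrableOn hd12.integrableOn]
            refine integral_congr_ae (ae_of_all _ fun ω => ?_)
            simp only [stage]
            change C.localized R _ _ = _
            ring
        _ ≤ ∫ ω in A, C.localized R (X.μ (X.u j) ω) (X.euler j ω) ∂P +
            (∫ ω in A, (X.δ * (C.c + ε + G * (bad j).indicator (1 : Ω → ℝ) ω - L ω) +
              ε * X.δ) ∂P + ∫ ω in A, (X.δ * L ω + e j ω) ∂P) := by
            exact add_le_add le_rfl (add_le_add hstep (hsA A hA))
        _ = _ := by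
            rw [← integral_add hd3.integrableOn hd4.integrableOn,
              ← integral_add (hVi j j).integrableOn hd34.integrableOn]
            refine integral_congr_ae (ae_of_all _ fun ω => ?_)
            simp only [stage]
            change C.localized R _ _ + _ = C.localized R _ _ + _ + _
            ring
  · have h1 : ∀ j ∈ Finset.range K, ∫ ω, (X.δ * (2 * ε) + X.δ * G * (bad j).indicator 1 ω +
        e j ω) ∂P ≤ X.δ * (4 * ε) := by
      intro j hj
      have hj : j < K := Finset.mem_range.1 hj
      have hi : Integrable (fun ω => X.δ * (2 * ε) + X.δ * G * (bad j).indicator (1 : Ω → ℝ) ω) P :=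
        (integrable_const _).add (hbi j)
      rw [integral_add hi (he j), integral_add (integrable_const _) (hbi j), integral_const_mul ((X.δ : ℝ) * G),
        integral_indicator_one (hbadm j)]
      simp only [integral_const, probReal_univ, smul_eq_mul, one_mul]
      have h2 : P.real (bad j) ≤ ε / (G + 1) :=
        (hclose j hj.le).trans ((min_le_right _ _).trans (min_le_left _ _))
      have h3 : G * P.real (bad j) ≤ ε := by
        calc _ ≤ (G + 1) * (ε / (G + 1)) := by gcongr; linarith
          _ = ε := by field_simp
      have h4 := (hsc j hj).1
      have h5 := mul_le_mul_of_nonneg_left h3 X.δ.coe_nonneg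
      nlinarith
    refine (Finset.sum_le_sum h1).trans_eq ?_
    rw [Finset.sum_const, Finset.card_range, nsmul_eq_mul, hXδ, hε]
    field_simp

end EulerData


/-! ## The probability of passing through the sets of a chain of certificates -/

/-! ### Common thresholds and bounds for finite lists -/

lemma exists_pos_forall_mem {α : Type*} {p : α → ℝ → Prop}
    (hp : ∀ a τ τ', τ' ≤ τ → p a τ → p a τ') :
    ∀ L : List α, (∀ a ∈ L, ∃ τ, 0 < τ ∧ p a τ) → ∃ τ, 0 < τ ∧ ∀ a ∈ L, p a τ := by
  intro L
  induction L with
  | nil => exact fun _ => ⟨1, one_pos, by simp⟩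
  | cons a L ih =>
    intro h
    obtain ⟨τ, hτ, h1⟩ := ih fun b hb => h b (by simp [hb])
    obtain ⟨τ', hτ', h2⟩ := h a (by simp)
    refine ⟨min τ τ', lt_min hτ hτ', fun b hb => ?_⟩
    rcases List.mem_cons.1 hb with rfl | hb
    · exact hp _ _ _ (min_le_right _ _) h2
    · exact hp _ _ _ (min_le_left _ _) (h1 b hb)

lemma exists_forall_mem_le {α : Type*} (g : α → ℝ) (L : List α) : ∃ b, ∀ a ∈ L, g a ≤ b := by
  induction L with
  | nil => exact ⟨0, by simp⟩
  | cons a L ih =>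
    obtain ⟨b, hb⟩ := ih
    refine ⟨max b (g a), fun c hc => ?_⟩
    rcases List.mem_cons.1 hc with rfl | hc
    · exact le_max_right _ _
    · exact (hb c hc).trans (le_max_left _ _)

namespace BarrierCert

variable {n r l : ℕ}

/-- The path passes, at the times `i T / N` from `i` on, through the sublevel sets and the superlevel
sets of the certificates in the list, up to the tolerance `ε`. -/
def VisitsGrid (T : ℝ≥0) (x : ℝ≥0 → EuclideanSpace ℝ (Fin n)) (N : ℕ) (ε : ℝ) :
    List (BarrierCert n l) → ℕ → Prop
  | [], _ => True
  | C :: Cs, i => (∀ m, C.B m (x (i * T / N)) < C.γ + ε) ∧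
      ∃ i', i ≤ i' ∧ i' ≤ N ∧ (∀ m, 1 - ε < C.B m (x (i' * T / N))) ∧ VisitsGrid T x N ε Cs i'

lemma tendsto_floor_mul_div {T : ℝ≥0} (hT : 0 < T) (t : ℝ≥0) :
    Tendsto (fun N : ℕ => ((⌊((t / T : ℝ≥0) : ℝ) * N⌋₊ : ℕ) : ℝ≥0) * T / N) atTop (𝓝 t) := by
  rw [← NNReal.tendsto_coe]
  have h1 := ((tendsto_nat_floor_mul_div_atTop (t / T : ℝ≥0).coe_nonneg).comp
    tendsto_natCast_atTop_atTop).mul_const (T : ℝ)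
  have h2 : (T : ℝ) ≠ 0 := by exact_mod_cast hT.ne'
  rw [NNReal.coe_div, div_mul_cancel₀ _ h2] at h1
  refine h1.congr fun N => ?_
  simp only [Function.comp_apply, NNReal.coe_div, NNReal.coe_mul, NNReal.coe_natCast]
  ring

/-- The tolerance makes the conditions open, so by continuity they persist at the nearby grid times
`⌊t N / T⌋ T / N`. Rounding down is monotone and keeps the passages in order. -/
lemma Visits.eventually_visitsGrid {T : ℝ≥0} (hT : 0 < T) {x : ℝ≥0 → EuclideanSpace ℝ (Fin n)}
    (hx : Continuous x) {ε : ℝ} (hε : 0 < ε) {Cs : List (BarrierCert n l)}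
    (hCs : ∀ C ∈ Cs, ∀ m, Continuous (C.B m)) {t : ℝ≥0} (h : Visits T x Cs t) :
    ∀ᶠ N : ℕ in atTop, VisitsGrid T x N ε Cs ⌊((t / T : ℝ≥0) : ℝ) * N⌋₊ := by
  induction Cs generalizing t with
  | nil => exact Eventually.of_forall fun _ => True.intro
  | cons C Cs ih =>
    obtain ⟨h1, t', htt', ht'T, h2, h3⟩ := h
    have hlim : ∀ (s : ℝ≥0) (m : Fin l), Tendsto
        (fun N : ℕ => C.B m (x (((⌊((s / T : ℝ≥0) : ℝ) * N⌋₊ : ℕ) : ℝ≥0) * T / N))) atTop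
          (𝓝 (C.B m (x s))) :=
      fun s m => ((hCs C (by simp) m).comp hx).continuousAt.tendsto.comp (tendsto_floor_mul_div hT s)
    have e1 := eventually_all.2 fun m =>
      (hlim t m).eventually (gt_mem_nhds (show C.B m (x t) < C.γ + ε by linarith [h1 m]))
    have e2 := eventually_all.2 fun m =>
      (hlim t' m).eventually (lt_mem_nhds (show 1 - ε < C.B m (x t') by linarith [h2 m]))
    filter_upwards [e1, e2, ih (fun C hC => hCs C (by simp [hC])) h3] with N g1 g2 g3
    refine ⟨g1, _, Nat.floor_mono ?_, Nat.floor_le_of_le ?_, g2, g3⟩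
    · gcongr
    · have : ((t' / T : ℝ≥0) : ℝ) ≤ 1 := by exact_mod_cast div_le_one_of_le₀ ht'T zero_le
      exact mul_le_of_le_one_left (Nat.cast_nonneg N) this

/-- The bound with tolerance `ε`. -/
def slackBound (T ε : ℝ) (Cs : List (BarrierCert n l)) : ℝ :=
  (Cs.map fun C => (C.γ + 2 * ε + C.c * T) / (1 - 2 * ε)).prod

lemma tendsto_slackBound (T : ℝ) (Cs : List (BarrierCert n l)) :
    Tendsto (fun ε => slackBound T ε Cs) (𝓝 0) (𝓝 (chainBound T Cs)) := by
  induction Cs with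
  | nil => simp [slackBound, chainBound]
  | cons C Cs ih =>
    simp only [slackBound, chainBound, List.map_cons, List.prod_cons] at ih ⊢
    refine Tendsto.mul ?_ ih
    have h1 : ContinuousAt (fun ε : ℝ => (C.γ + 2 * ε + C.c * T) / (1 - 2 * ε)) 0 :=
      ContinuousAt.div (by fun_prop) (by fun_prop) (by norm_num)
    simpa using h1.tendsto

end BarrierCert

namespace EulerData

variable {n r l : ℕ} {Ω : Type*}

/-- One `ε` is the slack at the grid times and the other the distance between scheme and solution.
The bounds hold for every mode, so also for the current one, and inside the ball the cutoff has no
effect at `ξ`. -/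
lemma win_of_visitsGrid {S : SwitchedSystem n r l} {W : ℝ≥0 → Ω → EuclideanSpace ℝ (Fin r)}
    {μ : ℝ≥0 → Ω → Fin l} {ξ : ℝ≥0 → Ω → EuclideanSpace ℝ (Fin n)} {T R : ℝ≥0} {N M : ℕ}
    {ω : Ω} (hR : ∀ i ≤ N, ‖ξ (i * T / N) ω‖ ≤ R) {ε ρ : ℝ}
    (hρ : ∀ i ≤ N, ‖(ofGrid S W μ ξ T R (N * M)).euler (i * M) ω - ξ (i * T / N) ω‖ < ρ)
    (e : BarrierCert n l → ℕ → Ω → ℝ) {Cs : List (BarrierCert n l)}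
    (hCs : ∀ C ∈ Cs, ∀ m x y, ‖x - y‖ < ρ → |C.localized R m x - C.localized R m y| ≤ ε)
    {i : ℕ} (hi : i ≤ N) (h : BarrierCert.VisitsGrid T (fun t => ξ t ω) N ε Cs i) :
    Stage.Win (N * M) (2 * ε) ω
      (Cs.map fun C => (ofGrid S W μ ξ T R (N * M)).stage C (e C)) (i * M) := by
  induction Cs generalizing i with
  | nil => exact True.intro
  | cons C Cs ih =>
    obtain ⟨h1, i', hii', hi'N, h2, h3⟩ := h
    have key : ∀ k ≤ N, ∀ m, |C.localized R m
        ((ofGrid S W μ ξ T R (N * M)).euler (k * M) ω) - C.B m (ξ (k * T / N) ω)| ≤ ε := by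
      intro k hk m
      rw [← BarrierCert.localized_eq (C := C) m (hR k hk)]
      exact hCs C (by simp) m _ _ (hρ k hk)
    refine ⟨?_, i' * M, Nat.mul_le_mul_right _ hii', Nat.mul_le_mul_right _ hi'N, ?_,
      ih (fun C hC => hCs C (by simp [hC])) hi'N h3⟩
    · change C.localized R _ _ < C.γ + 2 * ε
      have h4 := (abs_le.1 (key i hi (μ ((ofGrid S W μ ξ T R (N * M)).u (i * M)) ω))).2
      have h5 := h1 (μ ((ofGrid S W μ ξ T R (N * M)).u (i * M)) ω)
      refine lt_of_le_of_lt (sub_le_iff_le_add.1 h4) ?_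
      linarith
    · change 1 - 2 * ε < C.localized R _ _
      have h4 := (abs_le.1 (key i' hi'N (μ ((ofGrid S W μ ξ T R (N * M)).u (i' * M)) ω))).1
      have h5 := h2 (μ ((ofGrid S W μ ξ T R (N * M)).u (i' * M)) ω)
      have h6 : C.B (μ ((ofGrid S W μ ξ T R (N * M)).u (i' * M)) ω) (ξ (i' * T / N) ω) - ε ≤
          C.localized R (μ ((ofGrid S W μ ξ T R (N * M)).u (i' * M)) ω)
            ((ofGrid S W μ ξ T R (N * M)).euler (i' * M) ω) := by linarith
      exact lt_of_lt_of_le (by linarith) h6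

end EulerData

section Chain

variable {n r l : ℕ} {Ω : Type*} [mΩ : MeasurableSpace Ω] {P : Measure Ω} [IsProbabilityMeasure P]
  {𝔽 : Filtration ℝ≥0 mΩ} {S : SwitchedSystem n r l}
  {Λ : Fin l → Fin l → EuclideanSpace ℝ (Fin n) → ℝ} {W : ℝ≥0 → Ω → EuclideanSpace ℝ (Fin r)}
  {μ : ℝ≥0 → Ω → Fin l} {x₀ : EuclideanSpace ℝ (Fin n)}
  {ξ : ℝ≥0 → Ω → EuclideanSpace ℝ (Fin n)} {T : ℝ≥0} {Cs : List (BarrierCert n l)}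

open EulerData BarrierCert

/-- The bound for paths in a ball that pass through the sets at the times of all fine grids. -/
lemma measureReal_visitsGrid_le (hS : S.Solves P 𝔽 W μ x₀ ξ) (hW : IsBrownianMotion P 𝔽 W)
    (hμa : StronglyAdapted 𝔽 μ) (hμ : ∀ᵐ ω ∂P, IsSwitchingSignal fun t => μ t ω) (hT : 0 < T)
    (hΛ : ∀ i i', Continuous (Λ i i')) (hCs : ∀ C ∈ Cs, C.Valid S Λ) (R : ℝ≥0)
    (hsw : ∀ C ∈ Cs, ∀ η : ℝ, 0 < η → ∃ δ₀ : ℝ, 0 < δ₀ ∧ ∀ K : ℕ, 0 < K →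
      (T : ℝ) / K ≤ δ₀ → ∀ j < K,
      (ofGrid S W μ ξ T R K).SwitchControl P 𝔽 Λ (C.localized R) η j)
    {ε : ℝ} (hε : 0 < ε) (hε1 : 2 * ε < 1) (k : ℕ) :
    P.real {ω | (∀ t ≤ T, ‖ξ t ω‖ ≤ R) ∧ ∀ N ≥ k, VisitsGrid T (fun t => ξ t ω) N ε Cs 0} ≤
      slackBound T ε Cs := by
  obtain ⟨C₁, hC₁0, hC₁⟩ := S.exists_coeff_bound Λ hΛ R
  -- The errors of a stage are multiplied by the bound for the stages after it, so all tails are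
  -- bounded at once, independently of `η` and the grid.
  obtain ⟨b, hb⟩ := exists_forall_mem_le (slackBound T ε) Cs.tails
  obtain ⟨ρ, hρ, hmod⟩ := exists_pos_forall_mem
    (p := fun (C : BarrierCert n l) ρ => ∀ m x y, ‖x - y‖ < ρ →
      |C.localized R m x - C.localized R m y| ≤ ε)
    (fun C τ τ' h h1 m x y hxy => h1 m x y (hxy.trans_le h)) Cs (fun C hC => by
      obtain ⟨D, hD, h1⟩ := exists_fourth_power_modulus
        (fun m => ((hCs C hC).contDiff_localized R m).continuous)
        (fun m => C.hasCompactSupport_localized R m) (ε := ε / 2) (by positivity)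
      refine ⟨min 1 (ε / (2 * (D + 1))), by positivity, fun m x y hxy => (h1 m x y).trans ?_⟩
      have h2 : ‖x - y‖ ≤ 1 := hxy.le.trans (min_le_left _ _)
      have h3 : ‖x - y‖ ≤ ε / (2 * (D + 1)) := hxy.le.trans (min_le_right _ _)
      have h4 : ‖x - y‖ ^ 4 ≤ ‖x - y‖ := pow_le_of_le_one (norm_nonneg _) h2 (by norm_num)
      have h5 : D * ‖x - y‖ ^ 4 ≤ (D + 1) * (ε / (2 * (D + 1))) :=
        mul_le_mul (by linarith) (h4.trans h3) (by positivity) (by positivity)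
      have h6 : (D + 1) * (ε / (2 * (D + 1))) = ε / 2 := by field_simp
      linarith)
  -- The event on the left does not involve the grid, which may thus be chosen depending on `η`
  -- before `η` tends to zero.
  have hmain : ∀ η : ℝ, 0 < η →
      P.real {ω | (∀ t ≤ T, ‖ξ t ω‖ ≤ R) ∧ ∀ N ≥ k, VisitsGrid T (fun t => ξ t ω) N ε Cs 0} ≤
        slackBound T ε Cs + (Cs.length * (b / (1 - 2 * ε)) + 1) * η := by
    intro η hη
    obtain ⟨τ, hτ, hstage⟩ := exists_pos_forall_mem
      (p := fun (C : BarrierCert n l) τ => ∀ (K : ℕ)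
        (hcomp : (ofGrid S W μ ξ T R K).Compatible P 𝔽), 0 < K → (T : ℝ) / K ≤ τ →
        (∀ j ≤ K, P.real {ω | ω ∈ (ofGrid S W μ ξ T R K).alive j ∧
          τ ≤ ‖(ofGrid S W μ ξ T R K).euler j ω - ξ (j * T / K) ω‖} ≤ τ) →
        ∃ e, ((ofGrid S W μ ξ T R K).stage C e).IsSupermartingale P hcomp.filtration
          (ofGrid S W μ ξ T R K).alive K ((T : ℝ) / K) ∧
          ∑ j ∈ Finset.range K, ∫ ω, e j ω ∂P ≤ η)
      (fun C τ τ' h h1 K hcomp hK hδ hcl => h1 K hcomp hK (hδ.trans h) fun j hj => by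
        refine (measureReal_mono ?_ (measure_ne_top _ _)).trans ((hcl j hj).trans h)
        exact fun ω hω => ⟨hω.1, h.trans hω.2⟩) Cs
      (fun C hC => exists_isSupermartingale hΛ hT R (hCs C hC) (hsw C hC) hη)
    obtain ⟨N₀, hN₀, hgrid⟩ := exists_grid (R := R) hS hW hμa hμ hT hC₁0
      (fun x hx => ⟨(hC₁ x hx).1, (hC₁ x hx).2.1⟩) (ρ := min ρ τ) (η := min η τ) (δ₀ := τ)
      (lt_min hρ hτ) (lt_min hη hτ) hτ
    -- Taking `N ≥ k` makes the passages available on this very grid.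
    obtain ⟨M, hM, hδ, hfine, hcoarse⟩ := hgrid (max N₀ k) (le_max_left _ _)
    set N := max N₀ k
    have hN : 0 < N := hN₀.trans_le (le_max_left _ _)
    set K := N * M with hK
    have hK0 : 0 < K := Nat.mul_pos hN hM
    have hK0' : (K : ℝ) ≠ 0 := by exact_mod_cast hK0.ne'
    have hcomp : (ofGrid S W μ ξ T R K).Compatible P 𝔽 := ofGrid_compatible hS.adapted hμa hW K
    have hst : ∀ C : BarrierCert n l, ∃ e, C ∈ Cs →
        ((ofGrid S W μ ξ T R K).stage C e).IsSupermartingale P hcomp.filtration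
          (ofGrid S W μ ξ T R K).alive K ((T : ℝ) / K) ∧
          ∑ j ∈ Finset.range K, ∫ ω, e j ω ∂P ≤ η := by
      intro C
      by_cases hC : C ∈ Cs
      · obtain ⟨e, he⟩ := hstage C hC K hcomp hK0 hδ fun j hj => by
          refine (measureReal_mono ?_ (measure_ne_top _ _)).trans
            ((hfine j hj).trans (min_le_right _ _))
          exact fun ω hω => ⟨hω.1, (min_le_right _ _).trans hω.2⟩
        exact ⟨e, fun _ => he⟩
      · exact ⟨0, fun h => absurd h hC⟩
    choose e he using hst
    set Ds := Cs.map fun C => (ofGrid S W μ ξ T R K).stage C (e C) with hDs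
    have hDs1 : ∀ D ∈ Ds, D.IsSupermartingale P hcomp.filtration
        (ofGrid S W μ ξ T R K).alive K ((T : ℝ) / K) := by
      intro D hD
      obtain ⟨C, hC, rfl⟩ := List.mem_map.1 hD
      exact (he C hC).1
    have hDs2 : ∀ D ∈ Ds, ∑ j ∈ Finset.range K, ∫ ω, D.e j ω ∂P ≤ η := by
      intro D hD
      obtain ⟨C, hC, rfl⟩ := List.mem_map.1 hD
      exact (he C hC).2
    have hbound : ∀ Es : List (BarrierCert n l), Stage.bound K ((T : ℝ) / K) (2 * ε)
        (Es.map fun C => (ofGrid S W μ ξ T R K).stage C (e C)) = slackBound T ε Es := by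
      intro Es
      simp only [Stage.bound, slackBound, List.map_map]
      congr 2
      ext C
      simp only [Function.comp_apply, stage, mul_assoc, div_mul_cancel₀ _ hK0']
    have hDs3 : ∀ Es, Es <:+ Ds → Stage.bound K ((T : ℝ) / K) (2 * ε) Es ≤ b := by
      intro Es hEs
      obtain ⟨Fs, hFs, rfl⟩ := List.suffix_map_iff.1 hEs
      rw [hbound]
      exact hb Fs ((List.mem_tails _ _).2 hFs)
    have hδ0 : 0 ≤ (T : ℝ) / K := by positivity
    have hwin := Stage.measureReal_win_le hδ0 (by positivity : 0 < 2 * ε) hε1 alive_antitone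
      hcomp.measurableSet_alive hDs1
    have herr := Stage.integral_error_le hδ0 (by positivity : 0 < 2 * ε) hε1 hDs1 hDs3 hDs2
    rw [hbound] at hwin
    have hsub : {ω | (∀ t ≤ T, ‖ξ t ω‖ ≤ R) ∧
        ∀ N ≥ k, VisitsGrid T (fun t => ξ t ω) N ε Cs 0} ⊆
        {ω | Stage.Win K (2 * ε) ω Ds 0 ∧ ω ∈ (ofGrid S W μ ξ T R K).alive K} ∪
        {ω | ω ∈ (ofGrid S W μ ξ T R K).alive K ∧ ∃ i ≤ N, min ρ τ ≤
          ‖(ofGrid S W μ ξ T R K).euler (i * M) ω - ξ (i * T / N) ω‖} := by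
      rintro ω ⟨h1, h2⟩
      have hle : ∀ {i L : ℕ}, i ≤ L → (i : ℝ≥0) * T / L ≤ T := by
        intro i L hi
        rcases Nat.eq_zero_or_pos L with rfl | hL
        · simp
        · have hL' : (0 : ℝ≥0) < L := by exact_mod_cast hL
          have hi' : (i : ℝ≥0) ≤ L := by exact_mod_cast hi
          rw [div_le_iff₀ hL', mul_comm]
          gcongr
      have halive : ω ∈ (ofGrid S W μ ξ T R K).alive K := fun j hj => h1 _ (hle hj)
      by_cases hbad : ∃ i ≤ N, min ρ τ ≤
          ‖(ofGrid S W μ ξ T R K).euler (i * M) ω - ξ (i * T / N) ω‖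
      · exact .inr ⟨halive, hbad⟩
      · push Not at hbad
        refine .inl ⟨?_, halive⟩
        have h3 := win_of_visitsGrid (M := M) (fun i hi => h1 _ (hle hi))
          (fun i hi => (hbad i hi).trans_le (min_le_left _ _)) e hmod (Nat.zero_le N)
          (h2 N (le_max_right _ _))
        rw [Nat.zero_mul] at h3
        exact h3
    calc _ ≤ _ := measureReal_mono hsub (measure_ne_top _ _)
      _ ≤ _ := measureReal_union_le _ _
      _ ≤ (slackBound T ε Cs + Ds.length * (b / (1 - 2 * ε) * η)) + min η τ := by
          refine add_le_add (hwin.trans (add_le_add le_rfl herr)) hcoarse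
      _ ≤ _ := by
          have h1 : min η τ ≤ η := min_le_left _ _
          have h2 : Ds.length = Cs.length := by simp [hDs]
          rw [h2]
          linarith
  have hlim : Tendsto (fun η : ℝ => slackBound T ε Cs + (Cs.length * (b / (1 - 2 * ε)) + 1) * η)
      (𝓝[>] 0) (𝓝 (slackBound T ε Cs)) := by
    have h1 : Continuous fun η : ℝ =>
        slackBound (T : ℝ) ε Cs + (Cs.length * (b / (1 - 2 * ε)) + 1) * η := by fun_prop
    have h2 := h1.tendsto 0
    rw [mul_zero, add_zero] at h2
    exact h2.mono_left nhdsWithin_le_nhds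
  exact ge_of_tendsto hlim (eventually_mem_nhdsWithin.mono hmain)

/-- The probability that a solution process passes through the sets of a chain of certificates. -/
theorem measure_visits_le (hS : S.Solves P 𝔽 W μ x₀ ξ) (hW : IsBrownianMotion P 𝔽 W)
    (hμa : StronglyAdapted 𝔽 μ) (hμ : ∀ᵐ ω ∂P, IsSwitchingSignal fun t => μ t ω) (hT : 0 < T)
    (hΛ : ∀ i i', Continuous (Λ i i')) (hCs : ∀ C ∈ Cs, C.Valid S Λ)
    (hsw : ∀ C ∈ Cs, ∀ R : ℝ≥0, ∀ η : ℝ, 0 < η → ∃ δ₀ : ℝ, 0 < δ₀ ∧ ∀ K : ℕ, 0 < K →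
      (T : ℝ) / K ≤ δ₀ → ∀ j < K,
      (ofGrid S W μ ξ T R K).SwitchControl P 𝔽 Λ (C.localized R) η j) :
    P {ω | Visits T (fun t => ξ t ω) Cs 0} ≤ ENNReal.ofReal (chainBound T Cs) := by
  set E : ℕ → Set Ω := fun R => {ω | (∀ t ≤ T, ‖ξ t ω‖ ≤ (R : ℝ≥0)) ∧
    Continuous (fun t => ξ t ω) ∧ Visits T (fun t => ξ t ω) Cs 0} with hE
  have hE1 : ∀ R ε, 0 < ε → 2 * ε < 1 → P (E R) ≤ ENNReal.ofReal (slackBound T ε Cs) := by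
    intro R ε hε hε1
    -- The threshold beyond which all grids see the passages depends on the path. The sets `A k`
    -- increase with it, and continuity along increasing unions holds without measurability.
    set A : ℕ → Set Ω := fun k => {ω | (∀ t ≤ T, ‖ξ t ω‖ ≤ (R : ℝ≥0)) ∧
      ∀ N ≥ k, VisitsGrid T (fun t => ξ t ω) N ε Cs 0} with hA
    have hAmono : Monotone A := fun k k' hk ω hω => ⟨hω.1, fun N hN => hω.2 N (hk.trans hN)⟩
    have hsub : E R ⊆ ⋃ k, A k := by
      rintro ω ⟨h1, h2, h3⟩
      obtain ⟨k, hk⟩ := eventually_atTop.1 (h3.eventually_visitsGrid hT h2 hε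
        fun C hC m => ((hCs C hC).contDiff m).continuous)
      simp only [Set.mem_iUnion]
      refine ⟨k, h1, fun N hN => ?_⟩
      simpa using hk N hN
    calc P (E R) ≤ P (⋃ k, A k) := measure_mono hsub
      _ = ⨆ k, P (A k) := hAmono.measure_iUnion
      _ ≤ _ := iSup_le fun k => by
          rw [← ofReal_measureReal (measure_ne_top P (A k))]
          exact ENNReal.ofReal_le_ofReal (measureReal_visitsGrid_le hS hW hμa hμ hT hΛ hCs R
            (fun C hC => hsw C hC R) hε hε1 k)
  have hE2 : ∀ R, P (E R) ≤ ENNReal.ofReal (chainBound T Cs) := by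
    intro R
    have h1 : Tendsto (fun ε => ENNReal.ofReal (slackBound T ε Cs)) (𝓝[>] 0)
        (𝓝 (ENNReal.ofReal (chainBound T Cs))) :=
      (ENNReal.tendsto_ofReal (tendsto_slackBound T Cs)).mono_left nhdsWithin_le_nhds
    refine ge_of_tendsto h1 ?_
    filter_upwards [Ioo_mem_nhdsGT (show (0 : ℝ) < 1 / 2 by norm_num)] with ε hε
    exact hE1 R ε hε.1 (by linarith [hε.2])
  have hEmono : Monotone E := fun R R' hR ω hω =>
    ⟨fun t ht => (hω.1 t ht).trans (by exact_mod_cast hR), hω.2⟩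
  have hsub : {ω | Visits T (fun t => ξ t ω) Cs 0} ≤ᵐ[P] ⋃ R, E R := by
    filter_upwards [hS.continuous] with ω hω hv
    obtain ⟨B, hB⟩ := (isCompact_Icc (a := (0 : ℝ≥0)) (b := T)).exists_bound_of_continuousOn
      hω.continuousOn
    obtain ⟨R, hR⟩ := exists_nat_ge B
    refine Set.mem_iUnion.2 ⟨R, fun t ht => (hB t ⟨zero_le, ht⟩).trans ?_, hω, hv⟩
    exact_mod_cast hR
  calc _ ≤ P (⋃ R, E R) := measure_mono_ae hsub
    _ = ⨆ R, P (E R) := hEmono.measure_iUnion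
    _ ≤ _ := iSup_le hE2

end Chain


/-! ## The bound on the probability of violation -/

/-- Both settings meet here. Control of the switches is required only for the given certificates and
the trivial one, because for deterministic signals it is available only for functions independent of
the mode. -/
lemma probSatNeg_le_of_valid {n r l : ℕ} {S : SwitchedSystem n r l} {AP : Type*}
    {L : EuclideanSpace ℝ (Fin n) → AP} {φ : LTLf AP} {Q : Type*} [Finite Q] [DecidableEq Q]
    {A : DetAut AP Q} (hA : A.Recognizes φ.neg) {T : ℝ≥0} (hT : 0 < T) {p : AP}
    {x₀ : EuclideanSpace ℝ (Fin n)} (hx₀ : x₀ ∈ L ⁻¹' {p}) {Ω : Type*} [mΩ : MeasurableSpace Ω]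
    {P : Measure Ω} [IsProbabilityMeasure P] {𝔽 : Filtration ℝ≥0 mΩ}
    {W : ℝ≥0 → Ω → EuclideanSpace ℝ (Fin r)} (hW : IsBrownianMotion P 𝔽 W) {μ : ℝ≥0 → Ω → Fin l}
    {ξ : ℝ≥0 → Ω → EuclideanSpace ℝ (Fin n)} (hS : S.Solves P 𝔽 W μ x₀ ξ)
    (hμa : StronglyAdapted 𝔽 μ) (hμ : ∀ᵐ ω ∂P, IsSwitchingSignal fun t => μ t ω)
    {Λ : Fin l → Fin l → EuclideanSpace ℝ (Fin n) → ℝ} (hΛ : ∀ i i', Continuous (Λ i i'))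
    (hΛ0 : ∀ m x, ∑ m', Λ m m' x = 0) (hp : ∀ q₀ ∈ A.init, A.step q₀ p ≠ q₀)
    (C : Q × Q × Q → BarrierCert n l)
    (hC : ∀ q ∈ A.runsFrom p, ∀ ν ∈ triples q, (C ν).Valid S Λ)
    (hsets : ∀ q ∈ A.runsFrom p, ∀ ν ∈ triples q, ∀ m,
      (∀ y ∈ L ⁻¹' A.letters ν.1 ν.2.1, (C ν).B m y ≤ (C ν).γ) ∧
      ∀ y ∈ L ⁻¹' A.letters ν.2.1 ν.2.2, 1 ≤ (C ν).B m y)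
    (hsw : ∀ D : BarrierCert n l, D.Valid S Λ → (D = BarrierCert.trivial n l ∨ ∃ ν, D = C ν) →
      ∀ R : ℝ≥0, ∀ η : ℝ, 0 < η → ∃ δ₀ : ℝ, 0 < δ₀ ∧ ∀ K : ℕ, 0 < K →
      (T : ℝ) / K ≤ δ₀ → ∀ j < K,
      (EulerData.ofGrid S W μ ξ T R K).SwitchControl P 𝔽 Λ (D.localized R) η j) :
    probSatNeg P L T ξ φ ≤ sumProdBound A p T (fun ν => (C ν).γ) (fun ν => (C ν).c) := by
  refine probSatNeg_le_sumProdBound hA hx₀ hS.initial hp C hsets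
    (fun q hq ν hν => ⟨(hC q hq ν hν).γ_nonneg, (hC q hq ν hν).c_nonneg⟩) fun q hq => ?_
  have hmem : ∀ D ∈ BarrierCert.along C (DetAut.tripleList q), D.Valid S Λ ∧
      (D = BarrierCert.trivial n l ∨ ∃ ν, D = C ν) := by
    intro D hD
    rcases BarrierCert.mem_along hD with rfl | ⟨ν, hν, rfl⟩
    · exact ⟨BarrierCert.trivial_valid S Λ hΛ0, .inl rfl⟩
    · exact ⟨hC q hq ν (by simpa [triples, DetAut.tripleList] using hν), .inr ⟨ν, rfl⟩⟩
  exact measure_visits_le hS hW hμa hμ hT hΛ (fun D hD => (hmem D hD).1)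
    fun D hD => hsw D (hmem D hD).1 (hmem D hD).2

end

theorem corollary1 {n r l : ℕ} (S : SwitchedSystem n r l)
    {AP : Type*} [Finite AP] (L : EuclideanSpace ℝ (Fin n) → AP)
    (hL : ∀ a, MeasurableSet (L ⁻¹' {a}))
    (φ : LTLf AP) (hφ : φ.IsSafe)
    {Q : Type*} [Finite Q] [DecidableEq Q] (A : DetAut AP Q) (hA : A.Recognizes φ.neg)
    (T : ℝ≥0) (hT : 0 < T) (p : AP) (x₀ : EuclideanSpace ℝ (Fin n)) (hx₀ : x₀ ∈ L ⁻¹' {p})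
    {Ω : Type*} [mΩ : MeasurableSpace Ω] (P : Measure Ω) [IsProbabilityMeasure P]
    (𝔽 : Filtration ℝ≥0 mΩ) (h𝔽 : UsualConditions P 𝔽)
    (W : ℝ≥0 → Ω → EuclideanSpace ℝ (Fin r)) (hW : IsBrownianMotion P 𝔽 W)
    (ξ : ℝ≥0 → Ω → EuclideanSpace ℝ (Fin n)) :
    -- an arbitrary admissible switching signal, common barrier certificates
    (S.IsSolution P 𝔽 W x₀ ξ →
      1 - probSatNeg P L T ξ φ ≤ probSat P L T ξ φ ∧
      ∀ (B : Q × Q × Q → EuclideanSpace ℝ (Fin n) → ℝ) (γ c : Q × Q × Q → ℝ),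
        (∀ q₀ ∈ A.init, A.step q₀ p ≠ q₀) →
        (∀ q ∈ A.runsFrom p, ∀ ν ∈ triples q,
          S.IsCommonBarrier (L ⁻¹' A.letters ν.1 ν.2.1) (L ⁻¹' A.letters ν.2.1 ν.2.2)
            (B ν) (γ ν) (c ν)) →
        probSatNeg P L T ξ φ ≤ sumProdBound A p T γ c ∧
        1 - sumProdBound A p T γ c ≤ probSat P L T ξ φ) ∧
    -- random switching with given transition rates, multiple barrier certificates
    (∀ (Λ : Fin l → Fin l → EuclideanSpace ℝ (Fin n) → ℝ) (μ : ℝ≥0 → Ω → Fin l),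
      IsTransitionRate Λ → S.IsRateSolution Λ P 𝔽 W μ x₀ ξ →
      1 - probSatNeg P L T ξ φ ≤ probSat P L T ξ φ ∧
      ∀ (B : Q × Q × Q → Fin l → EuclideanSpace ℝ (Fin n) → ℝ) (γ c : Q × Q × Q → ℝ),
        (∀ q₀ ∈ A.init, A.step q₀ p ≠ q₀) →
        (∀ q ∈ A.runsFrom p, ∀ ν ∈ triples q,
          S.IsMultipleBarrier Λ (L ⁻¹' A.letters ν.1 ν.2.1) (L ⁻¹' A.letters ν.2.1 ν.2.2)
            (B ν) (γ ν) (c ν)) →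
        probSatNeg P L T ξ φ ≤ sumProdBound A p T γ c ∧
        1 - sumProdBound A p T γ c ≤ probSat P L T ξ φ) := by
  refine ⟨fun ⟨μ, hμ, hS⟩ => ⟨one_sub_probSatNeg_le P L T ξ φ, fun B γ c hp hB => ?_⟩,
    fun Λ μ hΛ hS => ⟨one_sub_probSatNeg_le P L T ξ φ, fun B γ c hp hB => ?_⟩⟩
  -- A deterministic signal is treated with zero rates and the same function in every mode; the
  -- coupling term then vanishes and the inequality is that of a common certificate.
  · have hle : probSatNeg P L T ξ φ ≤ sumProdBound A p T γ c := by
      refine probSatNeg_le_of_valid hA hT hx₀ hW hS (fun t => stronglyMeasurable_const)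
        (ae_of_all _ fun _ => S.isSwitchingSignal μ hμ) (Λ := fun _ _ _ => 0)
        (fun _ _ => continuous_const) (by simp) hp (fun ν => ⟨fun _ => B ν, γ ν, c ν⟩)
        (fun q hq ν hν => ?_)
        (fun q hq ν hν m => ⟨(hB q hq ν hν).le_gamma, (hB q hq ν hν).one_le⟩)
        fun D _ hD R η hη => ⟨1, one_pos, fun K _ _ j _ =>
          EulerData.switchControl_zero (fun i i' => ?_) hη.le j⟩
      · have h := hB q hq ν hν
        exact ⟨fun _ => h.contDiff, fun _ => h.nonneg, h.gamma_mem.1, h.c_nonneg,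
          fun m x => by simpa using h.generator_le m x⟩
      · rcases hD with rfl | ⟨ν, rfl⟩ <;> rfl
    exact ⟨hle, (tsub_le_tsub_left hle 1).trans (one_sub_probSatNeg_le P L T ξ φ)⟩
  · have hle : probSatNeg P L T ξ φ ≤ sumProdBound A p T γ c := by
      refine probSatNeg_le_of_valid hA hT hx₀ hW hS.solves hS.mode_adapted
        (hS.mode_signal.mono fun ω h => S.isSwitchingSignal _ h) (Λ := Λ)
        (fun i i' => (hΛ.lipschitz i i').choose_spec.continuous) hΛ.sum_eq_zero hp
        (fun ν => ⟨B ν, γ ν, c ν⟩) (fun q hq ν hν => ?_)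
        (fun q hq ν hν m => ⟨(hB q hq ν hν).le_gamma m, (hB q hq ν hν).one_le m⟩)
        fun D hDv _ R η hη => EulerData.exists_switchControl hΛ hW hS hT R
          (fun m => (hDv.contDiff_localized R m).continuous)
          (fun m => D.hasCompactSupport_localized R m) hη
      have h := hB q hq ν hν
      exact ⟨h.contDiff, h.nonneg, h.gamma_mem.1, h.c_nonneg, h.generator_le⟩
    exact ⟨hle, (tsub_le_tsub_left hle 1).trans (one_sub_probSatNeg_le P L T ξ φ)⟩
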